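/- Notation. Let $$E_1=\begin{pmatrix}0&0&0&0&\sqrt3\\0&0&1&0&0\\0&-1&0&0&0\\0&0&0&0&1\\-\sqrt3&0&0&-1&0\end{pmatrix},\quad E_2=\begin{pmatrix}0&0&\sqrt3&0&0\\0&0&0&0&1\\-\sqrt3&0&0&1&0\\0&0&-1&0&0\\0&-1&0&0&0\end{pmatrix},\quad E_3=\begin{pmatrix}0&0&0&0&0\\0&0&0&2&0\\0&0&0&0&1\\0&-2&0&0&0\\0&0&-1&0&0\end{pmatrix}$$ be the basis of the irreducible $\mathfrak{so}(3)\subset\mathfrak{so}(5)$, let $\mathbf e_1,\dots,\mathbf e_5\in M_4(\mathbb C)$ be the matrices $$\mathbf e_1=\begin{pmatrix}0&0&1&0\\0&0&0&-1\\1&0&0&0\\0&-1&0&0\end{pmatrix},\ \mathbf e_2=\begin{pmatrix}0&1&0&0\\1&0&0&0\\0&0&0&1\\0&0&1&0\end{pmatrix},\ \mathbf e_3=\begin{pmatrix}0&0&-i&0\\0&0&0&i\\i&0&0&0\\0&-i&0&0\end{pmatrix},\ \mathbf e_4=\begin{pmatrix}0&-i&0&0\\i&0&0&0\\0&0&0&-i\\0&0&i&0\end{pmatrix},\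 \mathbf e_5=\begin{pmatrix}1&0&0&0\\0&-1&0&0\\0&0&-1&0\\0&0&0&1\end{pmatrix},$$ which satisfy $\mathbf e_i\mathbf e_j+\mathbf e_j\mathbf e_i=2\delta_{ij}$, and let $$\mathbf E_1=\tfrac12(\sqrt3\,\mathbf e_1\mathbf e_5+\mathbf e_2\mathbf e_3+\mathbf e_4\mathbf e_5),\quad \mathbf E_2=\tfrac12(\sqrt3\,\mathbf e_1\mathbf e_3+\mathbf e_2\mathbf e_5+\mathbf e_3\mathbf e_4),\quad \mathbf E_3=\tfrac12(2\,\mathbf e_2\mathbf e_4+\mathbf e_3\mathbf e_5)$$ be the corresponding basis of $\mathfrak{spin}(3)\subset\mathfrak{spin}(5)$; $\mathbf{Spin}(3)\subset GL(4,\mathbb C)$ is the group generated by the matrices $\exp(x^I\mathbf E_I)$, $x\in\mathbb R^3$. An $\mathbf{SO}(3)$ geometry $(M,g,\Upsilon)$ is a smooth 5-manifold with a smooth Riemannian metric $g$ and a smooth rank 3 tensor field $\Upsilon(u,v,w)=g(u,\Upsilon_v w)$ that is totally symmetric, trace free ($\operatorname{tr}\Upsilon_v=0$), and satisfies $\Upsilon_v^2v=g(v,v)v$.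 An adapted coframe is a smooth local coframe $(\theta^1,\dots,\theta^5)$ with $g=\sum(\theta^i)^2$ and $$\Upsilon(v,v,v)=\tfrac12a_1(6a_2^2+6a_4^2-2a_1^2-3a_3^2-3a_5^2)+\tfrac{3\sqrt3}2a_4(a_5^2-a_3^2)+3\sqrt3\,a_2a_3a_5,\qquad a_i=\theta^i(v).$$ An $\mathfrak{so}(3)$ connection $\Gamma$ is a connection on $TM$ given in every adapted coframe by a smooth $\mathfrak{so}(3)$-valued 1-form $\Gamma=\gamma^IE_I$, i.e. $\theta^i(\nabla_vX)=v(\theta^i(X))+\Gamma^i{}_j(v)\theta^j(X)$; it is flat on an open set if its curvature $K=d\Gamma+\Gamma\wedge\Gamma$ vanishes there. A spin structure over an open set $\Omega\subset M$ is a cover of $\Omega$ by domains $U_a$ of adapted coframes $\theta_a$ with a smooth $\mathbf{Spin}(3)$-valued cocycle $(s_{ab})$ on the overlaps, such that $s_{ab}\big(\theta_b^i(v)\mathbf e_i\big)s_{ab}^{-1}=\theta_a^i(v)\mathbf e_i$ for all tangent vectors $v$. A spinor field over an open $U$ is a family of smooth maps $\Psi_a:U_a\cap U\to\mathbb C^4$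 with $\Psi_a=s_{ab}\Psi_b$ on overlaps; it is parallel if $d\Psi_a+\Gamma_{\mathfrak{spin}}\Psi_a=0$ for all $a$, where $\Gamma_{\mathfrak{spin}}=\gamma^I\mathbf E_I$ in the coframe $\theta_a$. Proposition. Let $(M,g,\Upsilon)$ be a 5-dimensional $\mathbf{SO}(3)$ geometry equipped with an $\mathfrak{so}(3)$ connection $\Gamma$. 1. For all $r\in\mathbb R^3$, $\det(r^I\mathbf E_I)=\tfrac9{16}\big((r^1)^2+(r^2)^2+(r^3)^2\big)^2$. 2. Let $\Omega\subset M$ be a connected open set with a spin structure (for example $\Omega=M$, if $M$ is connected and carries a spin structure). If there is a parallel spinor field over $\Omega$ that is not identically zero, then $\Gamma$ is flat on $\Omega$. 3. Conversely, let $\Gamma$ be flat on an open set $W\subset M$ and $x\in W$. Then there are an open neighbourhood $U\subset W$ of $x$ and a spin structure over $U$ for which the parallel spinor fields over $U$ form a complex vector space of dimension exactly 4. Moreover, for every spin structure over an open set $\Omega\ni x$ there is an open neighbourhood $U\subset W\cap\Omega$ of $x$ such that the parallel spinor fields over $U$ form a complex vector space of dimension exactly 4. -/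

import Mathlib

open Set TopologicalSpace Bundle
open scoped Manifold ContDiff Matrix

noncomputable section

namespace IrreducibleSO3

universe u w

/-- The model space `ℝ⁵`. -/
abbrev E5 : Type := EuclideanSpace ℝ (Fin 5)

/-! ### Linear algebra: the irreducible `so(3) ⊂ so(5)` and its lift to `spin(3) ⊂ spin(5)` -/

/-- The basis `E₁, E₂, E₃` of the irreducible Lie algebra `so(3) ⊂ so(5)`. -/
def soBasis : Fin 3 → Matrix (Fin 5) (Fin 5) ℝ :=
  ![!![0, 0, 0, 0, √3;
       0, 0, 1, 0, 0;
       0, -1, 0, 0, 0;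
       0, 0, 0, 0, 1;
       -√3, 0, 0, -1, 0],
    !![0, 0, √3, 0, 0;
       0, 0, 0, 0, 1;
       -√3, 0, 0, 1, 0;
       0, 0, -1, 0, 0;
       0, -1, 0, 0, 0],
    !![0, 0, 0, 0, 0;
       0, 0, 0, 2, 0;
       0, 0, 0, 0, 1;
       0, -2, 0, 0, 0;
       0, 0, -1, 0, 0]]

/-- The images `𝐞₁, …, 𝐞₅` of the standard orthonormal basis of `ℝ⁵` in the 4-dimensional spin
representation of the Clifford algebra (`𝐞ᵢ² = 1`, `𝐞ᵢ𝐞ⱼ + 𝐞ⱼ𝐞ᵢ = 0` for `i ≠ j`). -/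
def cliff : Fin 5 → Matrix (Fin 4) (Fin 4) ℂ :=
  ![!![0, 0, 1, 0;
       0, 0, 0, -1;
       1, 0, 0, 0;
       0, -1, 0, 0],
    !![0, 1, 0, 0;
       1, 0, 0, 0;
       0, 0, 0, 1;
       0, 0, 1, 0],
    !![0, 0, -Complex.I, 0;
       0, 0, 0, Complex.I;
       Complex.I, 0, 0, 0;
       0, -Complex.I, 0, 0],
    !![0, -Complex.I, 0, 0;
       Complex.I, 0, 0, 0;
       0, 0, 0, -Complex.I;
       0, 0, Complex.I, 0],
    !![1, 0, 0, 0;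
       0, -1, 0, 0;
       0, 0, -1, 0;
       0, 0, 0, 1]]

/-- Clifford multiplication by the vector `a = ∑ᵢ aᵢ eᵢ` of `ℝ⁵`. -/
def cliffVec (a : Fin 5 → ℝ) : Matrix (Fin 4) (Fin 4) ℂ := ∑ i, (a i : ℂ) • cliff i

/-- The isomorphism `so(5) → spin(5)`, `A ↦ ¼ ∑ᵢⱼ Aᵢⱼ 𝐞ᵢ𝐞ⱼ = ½ ∑_{i<j} Aᵢⱼ 𝐞ᵢ𝐞ⱼ`, inverse to the
differential of the double covering `Spin(5) → SO(5)`. -/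
def spinLift (A : Matrix (Fin 5) (Fin 5) ℝ) : Matrix (Fin 4) (Fin 4) ℂ :=
  (1 / 4 : ℂ) • ∑ i, ∑ j, (A i j : ℂ) • (cliff i * cliff j)

/-- The basis `𝐄₁, 𝐄₂, 𝐄₃` of `spin(3)` corresponding to the basis `E₁, E₂, E₃` of `so(3)`. -/
def spinBasis (I : Fin 3) : Matrix (Fin 4) (Fin 4) ℂ := spinLift (soBasis I)

/-- The group `Spin(3) ⊂ Spin(5) ⊂ GL(4, ℂ)` generated by the exponentials of the elements
of `spin(3) = span (𝐄₁, 𝐄₂, 𝐄₃)`. -/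
def spin3 : Subgroup (Matrix.GeneralLinearGroup (Fin 4) ℂ) :=
  Subgroup.closure {s | ∃ x : Fin 3 → ℝ,
    (s : Matrix (Fin 4) (Fin 4) ℂ) = NormedSpace.exp (∑ I, (x I : ℂ) • spinBasis I)}

/-- The standard form of the cubic `Υ(A, A, A)`. -/
def cubic (a : Fin 5 → ℝ) : ℝ :=
  1 / 2 * a 0 * (6 * a 1 ^ 2 + 6 * a 3 ^ 2 - 2 * a 0 ^ 2 - 3 * a 2 ^ 2 - 3 * a 4 ^ 2)
    + 3 * √3 / 2 * a 3 * (a 4 ^ 2 - a 2 ^ 2) + 3 * √3 * a 1 * a 2 * a 4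

/-! ### Differential forms of degree one on a 5-manifold -/

variable (M : Type u) [TopologicalSpace M] [ChartedSpace E5 M]

/-- (Not necessarily smooth) real differential 1-forms on `M`. -/
abbrev OneForm : Type u := ∀ x : M, TangentSpace (𝓡 5) x →L[ℝ] ℝ

variable {M}

/-- Smoothness of a 1-form on a set. -/
def SmoothOn [IsManifold (𝓡 5) ∞ M] (α : OneForm M) (U : Set M) : Prop :=
  ContMDiffOn (𝓡 5) ((𝓡 5).prod 𝓘(ℝ, E5 →L[ℝ] ℝ)) ∞
    (fun x ↦ TotalSpace.mk' (E5 →L[ℝ] ℝ) (E := fun x : M ↦ TangentSpace (𝓡 5) x →L[ℝ] ℝ) x (α x)) U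

/-- The expression of a 1-form in the preferred chart at `x₀`: its pull-back by the inverse
of the chart. -/
def formInChart (α : OneForm M) (x₀ : M) : E5 → E5 →L[ℝ] ℝ := fun y ↦
  (α ((extChartAt (𝓡 5) x₀).symm y)).comp
    (mfderiv 𝓘(ℝ, E5) (𝓡 5) (extChartAt (𝓡 5) x₀).symm y)

/-- The exterior derivative `(dα)ₓ(v₁, v₂)`, computed in the preferred chart at `x`, with
the convention `dα(X, Y) = X(α(Y)) - Y(α(X)) - α([X, Y])`. -/
def extDer (α : OneForm M) (x : M) (v₁ v₂ : TangentSpace (𝓡 5) x) : ℝ :=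
  fderiv ℝ (formInChart α x) (extChartAt (𝓡 5) x x)
      (mfderiv (𝓡 5) 𝓘(ℝ, E5) (extChartAt (𝓡 5) x) x v₁)
      (mfderiv (𝓡 5) 𝓘(ℝ, E5) (extChartAt (𝓡 5) x) x v₂)
    - fderiv ℝ (formInChart α x) (extChartAt (𝓡 5) x x)
      (mfderiv (𝓡 5) 𝓘(ℝ, E5) (extChartAt (𝓡 5) x) x v₂)
      (mfderiv (𝓡 5) 𝓘(ℝ, E5) (extChartAt (𝓡 5) x) x v₁)

/-! ### `SO(3)` structures and their adapted coframes -/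

variable (M) in
/-- A 5-dimensional `SO(3)` geometry on `M`: a smooth Riemannian metric `g` and a smooth tensor
field `Υ` of rank 3, given through the associated map `v ↦ Υ_v ∈ End(TM)`, so that
`Υ(u, v, w) = g(u, Υ_v w)`, which is totally symmetric, trace free and satisfies
`Υ_v² v = g(v, v) v`. -/
structure SO3Structure [IsManifold (𝓡 5) ∞ M] where
  /-- The Riemannian metric. -/
  g : ContMDiffRiemannianMetric (𝓡 5) ∞ E5 (fun x : M ↦ TangentSpace (𝓡 5) x)
  /-- The tensor field `v ↦ Υ_v`. -/
  Υ (x : M) : TangentSpace (𝓡 5) x →L[ℝ] TangentSpace (𝓡 5) x →L[ℝ] TangentSpace (𝓡 5) x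
  contMDiff_Υ : ContMDiff (𝓡 5) ((𝓡 5).prod 𝓘(ℝ, E5 →L[ℝ] E5 →L[ℝ] E5)) ∞
    (fun x ↦ TotalSpace.mk' (E5 →L[ℝ] E5 →L[ℝ] E5) (E := fun x : M ↦
      TangentSpace (𝓡 5) x →L[ℝ] TangentSpace (𝓡 5) x →L[ℝ] TangentSpace (𝓡 5) x) x (Υ x))
  symm₁ (x : M) (u v w : TangentSpace (𝓡 5) x) :
    g.inner x u (Υ x v w) = g.inner x w (Υ x v u)
  symm₂ (x : M) (u v w : TangentSpace (𝓡 5) x) :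
    g.inner x u (Υ x v w) = g.inner x u (Υ x w v)
  trace_free (x : M) (v : TangentSpace (𝓡 5) x) :
    LinearMap.trace ℝ (TangentSpace (𝓡 5) x) (Υ x v).toLinearMap = 0
  sq_apply (x : M) (v : TangentSpace (𝓡 5) x) : Υ x v (Υ x v v) = g.inner x v v • v

variable [IsManifold (𝓡 5) ∞ M]

/-- A (smooth, local) coframe adapted to an `SO(3)` structure: on its open domain,
`g = ∑ᵢ (θⁱ)²` and `Υ` has the standard form. The values of `θ` outside the domain are
irrelevant. -/
structure AdaptedCoframe (G : SO3Structure M) where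
  /-- The domain of the coframe. -/
  U : Opens M
  /-- The 1-forms `θ¹, …, θ⁵`. -/
  θ : Fin 5 → OneForm M
  smoothOn (i : Fin 5) : SmoothOn (θ i) U
  metric_eq (x : M) (hx : x ∈ U) (v w : TangentSpace (𝓡 5) x) :
    G.g.inner x v w = ∑ i, θ i x v * θ i x w
  cubic_eq (x : M) (hx : x ∈ U) (v : TangentSpace (𝓡 5) x) :
    G.g.inner x v (G.Υ x v v) = cubic (fun i ↦ θ i x v)

/-! ### `so(3)` connections -/

/-- An `so(3)` connection: a covariant derivative `∇` on `TM` which in every adapted coframe `θ`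
is represented by a smooth `so(3)`-valued 1-form `Γ = γ¹E₁ + γ²E₂ + γ³E₃`, that is
`θⁱ(∇_v X) = v(θⁱ(X)) + Γⁱⱼ(v) θʲ(X)`. -/
structure SO3Connection (G : SO3Structure M) where
  /-- The covariant derivative. -/
  nabla : CovariantDerivative (𝓡 5) E5 (fun x : M ↦ TangentSpace (𝓡 5) x)
  /-- The local 1-forms `γ¹, γ², γ³` in an adapted coframe. -/
  γ : AdaptedCoframe G → Fin 3 → OneForm M
  smoothOn (c : AdaptedCoframe G) (I : Fin 3) : SmoothOn (γ c I) c.U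
  nabla_eq (c : AdaptedCoframe G) (X : ∀ x : M, TangentSpace (𝓡 5) x) (x : M) (hx : x ∈ c.U)
    (hX : MDifferentiableAt (𝓡 5) (𝓡 5).tangent
      (fun y ↦ (⟨y, X y⟩ : TangentBundle (𝓡 5) M)) x)
    (v : TangentSpace (𝓡 5) x) (i : Fin 5) :
    c.θ i x (nabla X x v) = mvfderiv (𝓡 5) (fun y ↦ c.θ i y (X y)) x v
      + ∑ j, (∑ I, γ c I x v • soBasis I) i j * c.θ j x (X x)

namespace SO3Connection

variable {G : SO3Structure M} (Γ : SO3Connection G)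

/-- The connection form `Γⁱⱼ` in an adapted coframe. -/
def form (c : AdaptedCoframe G) (i j : Fin 5) : OneForm M := fun x ↦
  ∑ I, soBasis I i j • Γ.γ c I x

/-- The curvature 2-form `Kⁱⱼ = dΓⁱⱼ + Γⁱₖ ∧ Γᵏⱼ` in an adapted coframe. -/
def curv (c : AdaptedCoframe G) (i j : Fin 5) (x : M) (v₁ v₂ : TangentSpace (𝓡 5) x) : ℝ :=
  extDer (Γ.form c i j) x v₁ v₂
    + ∑ k, (Γ.form c i k x v₁ * Γ.form c k j x v₂ - Γ.form c i k x v₂ * Γ.form c k j x v₁)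

/-- `Γ` is flat on `W` if its curvature vanishes at all points of `W`. -/
def IsFlatOn (W : Set M) : Prop :=
  ∀ (c : AdaptedCoframe G) (x : M), x ∈ W → x ∈ c.U →
    ∀ (i j : Fin 5) (v₁ v₂ : TangentSpace (𝓡 5) x), Γ.curv c i j x v₁ v₂ = 0

/-- The `spin(3)` connection `Γ_spin = γ¹𝐄₁ + γ²𝐄₂ + γ³𝐄₃` in an adapted coframe. -/
def spinForm (c : AdaptedCoframe G) (x : M) (v : TangentSpace (𝓡 5) x) :
    Matrix (Fin 4) (Fin 4) ℂ :=
  ∑ I, (Γ.γ c I x v : ℂ) • spinBasis I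

end SO3Connection

/-! ### Spinor fields -/

/-- A `Spin(3)` structure over the open set `Ω`, lifting the `SO(3)` structure: a cover of `Ω` by
domains of adapted coframes `θ_a`, and a smooth cocycle of `Spin(3)`-valued functions `s_ab` which
cover the transition functions `h_ab`, where `θ_a = h_ab θ_b`. (That `s ∈ Spin(5)` covers
`h ∈ SO(5)` means `s (v · 𝐞) s⁻¹ = (h v) · 𝐞` for all `v ∈ ℝ⁵`.) -/
structure SpinStructure (G : SO3Structure M) (Ω : Opens M) (ι : Type w) where
  /-- The adapted coframes. -/
  coframe : ι → AdaptedCoframe G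
  cover : ⋃ a, ((coframe a).U : Set M) = Ω
  /-- The transition functions. -/
  s : ι → ι → M → Matrix.GeneralLinearGroup (Fin 4) ℂ
  s_mem (a b : ι) (x : M) (ha : x ∈ (coframe a).U) (hb : x ∈ (coframe b).U) : s a b x ∈ spin3
  s_smooth (a b : ι) (k l : Fin 4) : ContMDiffOn (𝓡 5) 𝓘(ℝ, ℂ) ∞
    (fun x ↦ (s a b x : Matrix (Fin 4) (Fin 4) ℂ) k l) ((coframe a).U ∩ (coframe b).U)
  s_cocycle (a b c : ι) (x : M) (ha : x ∈ (coframe a).U) (hb : x ∈ (coframe b).U)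
    (hc : x ∈ (coframe c).U) : s a b x * s b c x = s a c x
  s_covers (a b : ι) (x : M) (ha : x ∈ (coframe a).U) (hb : x ∈ (coframe b).U)
    (v : TangentSpace (𝓡 5) x) :
    (s a b x : Matrix (Fin 4) (Fin 4) ℂ) * cliffVec (fun i ↦ (coframe b).θ i x v)
      = cliffVec (fun i ↦ (coframe a).θ i x v) * (s a b x : Matrix (Fin 4) (Fin 4) ℂ)

variable {G : SO3Structure M} {Ω : Opens M} {ι : Type w}

/-- Spinor fields over an open set `U`, that is, smooth sections over `U` of the bundle associated
to the `Spin(3)` structure `S` and its representation on `ℂ⁴`. Such a section is a family of local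
representatives `Ψ_a : U_a ∩ U → ℂ⁴` with `Ψ_a = s_ab Ψ_b`; to make it determined by its local
representatives, `Ψ_a` is extended by zero to `M`. -/
structure SpinStructure.IsSpinorField (S : SpinStructure G Ω ι) (U : Opens M)
    (Ψ : ι → M → Fin 4 → ℂ) : Prop where
  eq_zero (a : ι) (x : M) (hx : x ∉ (S.coframe a).U ⊓ U) : Ψ a x = 0
  smooth (a : ι) : ContMDiffOn (𝓡 5) 𝓘(ℝ, Fin 4 → ℂ) ∞ (Ψ a) ((S.coframe a).U ∩ U)
  compat (a b : ι) (x : M) (hx : x ∈ U) (ha : x ∈ (S.coframe a).U) (hb : x ∈ (S.coframe b).U) :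
    Ψ a x = (S.s a b x : Matrix (Fin 4) (Fin 4) ℂ) *ᵥ Ψ b x

/-- The spinor field `Ψ` over `U` is parallel: `dΨ + Γ_spin Ψ = 0`. -/
def SpinStructure.IsParallel (S : SpinStructure G Ω ι) (Γ : SO3Connection G) (U : Opens M)
    (Ψ : ι → M → Fin 4 → ℂ) : Prop :=
  ∀ (a : ι) (x : M), x ∈ U → x ∈ (S.coframe a).U → ∀ v : TangentSpace (𝓡 5) x,
    mvfderiv (𝓡 5) (Ψ a) x v + Γ.spinForm (S.coframe a) x v *ᵥ Ψ a x = 0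

theorem SpinStructure.IsSpinorField.mdifferentiableAt {S : SpinStructure G Ω ι} {U : Opens M}
    {Ψ : ι → M → Fin 4 → ℂ} (h : S.IsSpinorField U Ψ) {a : ι} {x : M} (hx : x ∈ U)
    (ha : x ∈ (S.coframe a).U) : MDifferentiableAt (𝓡 5) 𝓘(ℝ, Fin 4 → ℂ) (Ψ a) x :=
  ((h.smooth a).contMDiffAt
    (((S.coframe a).U.isOpen.inter U.isOpen).mem_nhds ⟨ha, hx⟩)).mdifferentiableAt (by simp)

/-- The complex vector space of parallel spinor fields over `U`. -/
def SpinStructure.parallelSpinors (S : SpinStructure G Ω ι) (Γ : SO3Connection G) (U : Opens M) :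
    Submodule ℂ (ι → M → Fin 4 → ℂ) where
  carrier := {Ψ | S.IsSpinorField U Ψ ∧ S.IsParallel Γ U Ψ}
  zero_mem' := by
    refine ⟨⟨fun a x _ ↦ rfl, fun a ↦ contMDiffOn_const (c := (0 : Fin 4 → ℂ)),
      fun a b x _ _ _ ↦ by simp⟩, fun a x _ _ v ↦ ?_⟩
    have h : mvfderiv (𝓡 5) ((0 : ι → M → Fin 4 → ℂ) a) x = 0 := mvfderiv_zero
    rw [h]
    simp
  add_mem' := by
    rintro Ψ Φ ⟨hΨ, hΨ'⟩ ⟨hΦ, hΦ'⟩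
    refine ⟨⟨fun a x hx ↦ by simp [hΨ.eq_zero a x hx, hΦ.eq_zero a x hx],
      fun a ↦ (hΨ.smooth a).add (hΦ.smooth a), fun a b x hx ha hb ↦ ?_⟩, fun a x hx ha v ↦ ?_⟩
    · simp only [Pi.add_apply, Matrix.mulVec_add]
      rw [hΨ.compat a b x hx ha hb, hΦ.compat a b x hx ha hb]
    · have h : mvfderiv (𝓡 5) ((Ψ + Φ) a) x = _ :=
        mvfderiv_add (hΨ.mdifferentiableAt hx ha) (hΦ.mdifferentiableAt hx ha)
      have h₁ := hΨ' a x hx ha v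
      have h₂ := hΦ' a x hx ha v
      rw [h]
      simp only [Pi.add_apply, Matrix.mulVec_add, add_apply]
      rw [add_add_add_comm, h₁, h₂, add_zero]
  smul_mem' := by
    rintro z Ψ ⟨hΨ, hΨ'⟩
    have hL : ∀ a, (z • Ψ) a = (z • ContinuousLinearMap.id ℝ (Fin 4 → ℂ)) ∘ Ψ a := fun a ↦ rfl
    refine ⟨⟨fun a x hx ↦ by simp [hΨ.eq_zero a x hx], fun a ↦ ?_, fun a b x hx ha hb ↦ ?_⟩,
      fun a x hx ha v ↦ ?_⟩
    · rw [hL]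
      exact (ContinuousLinearMap.contMDiff _).comp_contMDiffOn (hΨ.smooth a)
    · simp only [Pi.smul_apply, Matrix.mulVec_smul]
      rw [hΨ.compat a b x hx ha hb]
    · have h : mvfderiv (𝓡 5) ((z • Ψ) a) x v = z • mvfderiv (𝓡 5) (Ψ a) x v := by
        have h' : mfderiv (𝓡 5) 𝓘(ℝ, Fin 4 → ℂ) ((z • Ψ) a) x = _ :=
          (((z • ContinuousLinearMap.id ℝ (Fin 4 → ℂ)).hasMFDerivAt).comp x
            (hΨ.mdifferentiableAt hx ha).hasMFDerivAt).mfderiv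
        simp only [mvfderiv, h']
        rfl
      rw [h]
      simp only [Pi.smul_apply, Matrix.mulVec_smul]
      rw [← smul_add, hΨ' a x hx ha v, smul_zero]

end IrreducibleSO3

end

open IrreducibleSO3

/-!
A parallel spinor `Ψ` is annihilated by the curvature of the spin connection, which is
`spinMat κ = ∑ κᴵ 𝐄_I` for the `ℝ³`-valued 2-form `κ = dγ + γ × γ`. Indeed the brackets of both
`so(3)` and `spin(3)` are the cross product in the bases `E_I` and `𝐄_I` (`soMat_bracket`,
`spinMat_bracket`), so that `κ` also determines the curvature `soMat κ` of `Γ`. By the determinant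
identity `det_spinMat` the matrix `spinMat κ` is invertible unless `κ = 0`
(`eq_zero_of_spinMat_mulVec`). A parallel spinor field which vanishes at one point of a connected
open set vanishes identically, because it solves a linear system of first order
(`eq_zero_of_mem_parallelSpinors`). Hence a nonzero parallel spinor field vanishes nowhere and
`κ = 0` in the coframes of the spin structure. An arbitrary adapted coframe is reached by a change
of coframe `h`, which satisfies `dh = h Γ_a - Γ_c h` and therefore intertwines the curvatures
(`SO3Connection.curvInChart_eq_zero`).

Conversely, if `κ = 0`, the system `dψ = -Γ_spin ψ` is integrable, and Picard iteration with the
radial homotopy operator solves it near any point for all initial values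
(`exists_parallel_of_flat`, `exists_isParallelOn`). A solution `ψ` in one coframe `a` of a spin
structure gives the representatives `s_ba ψ` in the other coframes `b`. They are parallel because
`ds = s Γ_b - Γ_a s` for the transition functions `s` of a spin structure
(`SO3Connection.matDeriv_transition`): the defect `s⁻¹ (ds - s Γ_b + Γ_a s)` commutes with Clifford
multiplication, hence is a scalar, and it is infinitesimally symplectic since `Spin(3)` preserves a
symplectic form on `ℂ⁴`, hence zero. Evaluation at a point is then an isomorphism from the space of
parallel spinor fields to `ℂ⁴` (`finrank_parallelSpinors`).

A spin structure near a given point is provided by any adapted coframe, so it remains to find one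
(`SO3Structure.exists_adaptedCoframe`). For a unit vector `b` with `Υ(b, b, b) = 0` the identity
`Υ_v² v = ⟨v, v⟩ v` and the vanishing of the traces force the eigenvalues `± √3 / 2` of `Υ_b`, and
unit eigenvectors of these eigenvalues, together with `b`, generate an orthonormal frame in which `Υ`
has the standard form (`SO3Algebra.IsFrameData.form_eq_cubic`). All the choices can be made smoothly:
`b` by an explicit formula which involves the trisection of an angle (`SO3Algebra.nullVector`), the
eigenvectors by a polynomial projection (`SO3Algebra.eigenProj`).

Derivatives on the manifold are computed in the preferred chart at a point `x₀`, at a point `y` of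
its target, through `invChart x₀` and `invChartDeriv x₀ y`; the exterior derivative does not depend
on the chart (`exteriorDeriv_chartForm`).
-/

noncomputable section

namespace IrreducibleSO3

/-! ### Linear algebra of `so(3)`, `spin(3)` and the Clifford matrices -/

/-- The element `∑ aᴵ E_I` of the irreducible `so(3) ⊂ so(5)`. -/
def soMat (a : Fin 3 → ℝ) : Matrix (Fin 5) (Fin 5) ℝ := ∑ I, a I • soBasis I

/-- The element `∑ aᴵ 𝐄_I` of `spin(3) ⊂ spin(5)`. -/
def spinMat (a : Fin 3 → ℝ) : Matrix (Fin 4) (Fin 4) ℂ := ∑ I, (a I : ℂ) • spinBasis I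

theorem sqrt_three_sq : (√3 : ℝ) ^ 2 = 3 := Real.sq_sqrt (by norm_num)

theorem ofReal_sqrt_three_sq : ((√3 : ℝ) : ℂ) ^ 2 = 3 := by
  exact_mod_cast sqrt_three_sq

theorem soMat_eq (a : Fin 3 → ℝ) : soMat a =
    !![0, 0, √3 * a 1, 0, √3 * a 0;
       0, 0, a 0, 2 * a 2, a 1;
       -(√3 * a 1), -a 0, 0, a 1, a 2;
       0, -(2 * a 2), -a 1, 0, a 0;
       -(√3 * a 0), -a 1, -a 2, -a 0, 0] := by
  ext i j
  fin_cases i <;> fin_cases j <;> simp [soMat, soBasis, Fin.sum_univ_three, mul_comm]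

theorem cliffVec_eq (u : Fin 5 → ℝ) : cliffVec u =
    !![(u 4 : ℂ), u 1 - Complex.I * u 3, u 0 - Complex.I * u 2, 0;
       u 1 + Complex.I * u 3, -u 4, 0, -u 0 + Complex.I * u 2;
       u 0 + Complex.I * u 2, 0, -u 4, u 1 - Complex.I * u 3;
       0, -u 0 - Complex.I * u 2, u 1 + Complex.I * u 3, u 4] := by
  ext i j
  fin_cases i <;> fin_cases j <;>
    simp [cliffVec, cliff, Fin.sum_univ_five] <;> ring

theorem cliffVec_mul_self (u : Fin 5 → ℝ) :
    cliffVec u * cliffVec u = ((∑ i, u i ^ 2 : ℝ) : ℂ) • 1 := by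
  have hI := Complex.I_sq
  rw [cliffVec_eq]
  ext i j
  fin_cases i <;> fin_cases j <;> simp [Fin.sum_univ_five] <;> grind

theorem cliffVec_add (u v : Fin 5 → ℝ) : cliffVec (u + v) = cliffVec u + cliffVec v := by
  simp [cliffVec, add_smul, Finset.sum_add_distrib]

theorem cliffVec_single (i : Fin 5) : cliffVec (Pi.single i 1) = cliff i := by
  rw [cliffVec, Finset.sum_eq_single i] <;> simp +contextual

theorem cliff_mul_comm (i j : Fin 5) (h : i ≠ j := by decide) :
    cliff i * cliff j = -(cliff j * cliff i) := by
  have h1 := cliffVec_mul_self (Pi.single i 1 + Pi.single j 1)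
  have h2 (k : Fin 5) : cliff k * cliff k = 1 := by
    rw [← cliffVec_single, cliffVec_mul_self, Finset.sum_eq_single k] <;>
      simp +contextual
  have h3 : ∑ k, (Pi.single i 1 + Pi.single j 1 : Fin 5 → ℝ) k ^ 2 = 2 := by
    have h4 : ∀ k, (Pi.single i 1 + Pi.single j 1 : Fin 5 → ℝ) k ^ 2
        = (Pi.single i 1 : Fin 5 → ℝ) k + (Pi.single j 1 : Fin 5 → ℝ) k := by
      intro k
      by_cases hi : k = i <;> by_cases hj : k = j <;> simp_all [Pi.single_apply]
    rw [Finset.sum_congr rfl fun k _ ↦ h4 k, Finset.sum_add_distrib]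
    norm_num
  rw [h3, cliffVec_add, cliffVec_single, cliffVec_single, add_mul, mul_add, mul_add, h2, h2] at h1
  rw [eq_neg_iff_add_eq_zero]
  have h5 : ((2 : ℝ) : ℂ) • (1 : Matrix (Fin 4) (Fin 4) ℂ) = 1 + 1 := by
    simp [two_smul]
  rw [h5] at h1
  have h6 := sub_eq_zero.2 h1
  rw [← h6]
  abel

theorem spinBasis_zero : spinBasis 0 =
    !![0, Complex.I / 2, -(√3 / 2), Complex.I / 2;
       Complex.I / 2, 0, -(Complex.I / 2), -(√3 / 2);
       √3 / 2, -(Complex.I / 2), 0, -(Complex.I / 2);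
       Complex.I / 2, √3 / 2, -(Complex.I / 2), 0] := by
  have h : spinBasis 0 = (1 / 2 : ℂ) •
      ((√3 : ℂ) • (cliff 0 * cliff 4) + cliff 1 * cliff 2 + cliff 3 * cliff 4) := by
    simp only [spinBasis, spinLift, soBasis, Fin.sum_univ_five]
    simp [cliff_mul_comm 4 0, cliff_mul_comm 2 1, cliff_mul_comm 4 3]
    module
  rw [h]
  ext i j
  fin_cases i <;> fin_cases j <;> simp [cliff] <;> ring

theorem spinBasis_one : spinBasis 1 =
    !![Complex.I * (√3 / 2), -(1 / 2), 0, -(1 / 2);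
       1 / 2, Complex.I * (√3 / 2), -(1 / 2), 0;
       0, 1 / 2, -(Complex.I * (√3 / 2)), 1 / 2;
       1 / 2, 0, -(1 / 2), -(Complex.I * (√3 / 2))] := by
  have h : spinBasis 1 = (1 / 2 : ℂ) •
      ((√3 : ℂ) • (cliff 0 * cliff 2) + cliff 1 * cliff 4 + cliff 2 * cliff 3) := by
    simp only [spinBasis, spinLift, soBasis, Fin.sum_univ_five]
    simp [cliff_mul_comm 2 0, cliff_mul_comm 4 1, cliff_mul_comm 3 2]
    module
  rw [h]
  ext i j
  fin_cases i <;> fin_cases j <;> simp [cliff] <;> ring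

theorem spinBasis_two : spinBasis 2 =
    !![Complex.I, 0, Complex.I / 2, 0;
       0, -Complex.I, 0, Complex.I / 2;
       Complex.I / 2, 0, Complex.I, 0;
       0, Complex.I / 2, 0, -Complex.I] := by
  have h : spinBasis 2 = (1 / 2 : ℂ) •
      ((2 : ℂ) • (cliff 1 * cliff 3) + cliff 2 * cliff 4) := by
    simp only [spinBasis, spinLift, soBasis, Fin.sum_univ_five]
    simp [cliff_mul_comm 3 1, cliff_mul_comm 4 2]
    module
  rw [h]
  ext i j
  fin_cases i <;> fin_cases j <;> simp [cliff] <;> ring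

theorem spinMat_eq (a : Fin 3 → ℝ) : spinMat a =
    !![Complex.I * (√3 / 2 * a 1 + a 2), Complex.I / 2 * a 0 - a 1 / 2,
         -(√3 / 2 * a 0) + Complex.I / 2 * a 2, Complex.I / 2 * a 0 - a 1 / 2;
       Complex.I / 2 * a 0 + a 1 / 2, Complex.I * (√3 / 2 * a 1 - a 2),
         -(Complex.I / 2 * a 0) - a 1 / 2, -(√3 / 2 * a 0) + Complex.I / 2 * a 2;
       √3 / 2 * a 0 + Complex.I / 2 * a 2, -(Complex.I / 2 * a 0) + a 1 / 2,
         Complex.I * (-(√3 / 2 * a 1) + a 2), -(Complex.I / 2 * a 0) + a 1 / 2;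
       Complex.I / 2 * a 0 + a 1 / 2, √3 / 2 * a 0 + Complex.I / 2 * a 2,
         -(Complex.I / 2 * a 0) - a 1 / 2, Complex.I * (-(√3 / 2 * a 1) - a 2)] := by
  rw [spinMat, Fin.sum_univ_three, spinBasis_zero, spinBasis_one, spinBasis_two]
  ext i j
  fin_cases i <;> fin_cases j <;> simp <;> ring

theorem det_spinMat (r : Fin 3 → ℝ) :
    (spinMat r).det = ((9 / 16 * (∑ I, r I ^ 2) ^ 2 : ℝ) : ℂ) := by
  rw [spinMat_eq]
  simp [Matrix.det_succ_row_zero, Fin.sum_univ_succ, Fin.succAbove]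
  have hI := Complex.I_sq
  have h3 := ofReal_sqrt_three_sq
  grind

theorem trace_spinMat (a : Fin 3 → ℝ) : (spinMat a).trace = 0 := by
  rw [spinMat_eq, Matrix.trace]
  simp [Fin.sum_univ_four]
  ring

/-- The symplectic form on `ℂ⁴` preserved by `Spin(5)`. -/
def spinSymplectic : Matrix (Fin 4) (Fin 4) ℂ :=
  !![0, 0, 0, -1; 0, 0, -1, 0; 0, 1, 0, 0; 1, 0, 0, 0]

theorem spinSymplectic_mul_self : spinSymplectic * spinSymplectic = -1 := by
  ext i j
  fin_cases i <;> fin_cases j <;> simp [spinSymplectic, Matrix.mul_apply, Fin.sum_univ_four]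

theorem transpose_spinMat (a : Fin 3 → ℝ) :
    (spinMat a)ᵀ = spinSymplectic * -spinMat a * spinSymplectic⁻¹ := by
  have h : spinSymplectic⁻¹ = -spinSymplectic := by
    apply Matrix.inv_eq_left_inv
    rw [neg_mul, spinSymplectic_mul_self, neg_neg]
  rw [h, mul_neg, mul_neg, neg_mul, neg_neg, spinMat_eq]
  ext i j
  fin_cases i <;> fin_cases j <;> simp [spinSymplectic, Matrix.mul_apply, Fin.sum_univ_four] <;>
    ring

theorem isUnit_spinSymplectic : IsUnit spinSymplectic := by
  refine ⟨⟨spinSymplectic, -spinSymplectic, ?_, ?_⟩, rfl⟩ <;> simp [spinSymplectic_mul_self]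

/-- The Lie algebra `spin(3)` is contained in the symplectic Lie algebra. -/
theorem transpose_spinMat_mul_add (a : Fin 3 → ℝ) :
    (spinMat a)ᵀ * spinSymplectic + spinSymplectic * spinMat a = 0 := by
  rw [transpose_spinMat, mul_assoc,
    Matrix.nonsing_inv_mul _ ((Matrix.isUnit_iff_isUnit_det _).1 isUnit_spinSymplectic)]
  simp

theorem transpose_exp_spinMat_mul_mul (a : Fin 3 → ℝ) :
    (NormedSpace.exp (spinMat a))ᵀ * spinSymplectic * NormedSpace.exp (spinMat a)
      = spinSymplectic := by
  have hJ := (Matrix.isUnit_iff_isUnit_det _).1 isUnit_spinSymplectic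
  have hE := (Matrix.isUnit_iff_isUnit_det _).1 (Matrix.isUnit_exp (spinMat a))
  rw [← Matrix.exp_transpose, transpose_spinMat, Matrix.exp_conj _ _ isUnit_spinSymplectic,
    mul_assoc _ _ spinSymplectic, Matrix.nonsing_inv_mul _ hJ, mul_one, mul_assoc, Matrix.exp_neg,
    Matrix.nonsing_inv_mul _ hE, mul_one]

/-- The group `Spin(3)` preserves the symplectic form. -/
theorem transpose_mul_mul_of_mem_spin3 {s : Matrix.GeneralLinearGroup (Fin 4) ℂ} (hs : s ∈ spin3) :
    (s : Matrix (Fin 4) (Fin 4) ℂ)ᵀ * spinSymplectic * s = spinSymplectic := by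
  induction hs using Subgroup.closure_induction with
  | mem s hs =>
    obtain ⟨x, hx⟩ := hs
    rw [hx]
    exact transpose_exp_spinMat_mul_mul x
  | one => simp
  | mul s t _ _ hs ht =>
    calc _ = (t : Matrix (Fin 4) (Fin 4) ℂ)ᵀ
          * ((s : Matrix (Fin 4) (Fin 4) ℂ)ᵀ * spinSymplectic * s) * t := by
          simp [Matrix.transpose_mul, mul_assoc]
      _ = _ := by rw [hs, ht]
  | inv s _ hs =>
    have h1 : (s : Matrix (Fin 4) (Fin 4) ℂ) * (s⁻¹ : Matrix.GeneralLinearGroup (Fin 4) ℂ) = 1 := by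
      rw [← Units.val_mul, mul_inv_cancel, Units.val_one]
    have h2 : ((s⁻¹ : Matrix.GeneralLinearGroup (Fin 4) ℂ) : Matrix (Fin 4) (Fin 4) ℂ)ᵀ
        * (s : Matrix (Fin 4) (Fin 4) ℂ)ᵀ = 1 := by
      rw [← Matrix.transpose_mul, h1, Matrix.transpose_one]
    conv_lhs => rw [← hs]
    rw [mul_assoc, mul_assoc, mul_assoc, h1, mul_one, ← mul_assoc, h2, one_mul]

set_option maxHeartbeats 1000000 in
/-- In the basis `E_I` the bracket of `so(3)` is the cross product. -/
theorem soMat_bracket (a b : Fin 3 → ℝ) :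
    soMat a * soMat b - soMat b * soMat a = soMat (a ⨯₃ b) := by
  have h3 := sqrt_three_sq
  rw [soMat_eq, soMat_eq, soMat_eq, cross_apply]
  ext i j
  fin_cases i <;> fin_cases j <;> simp <;> grind

set_option maxHeartbeats 1000000 in
/-- The infinitesimal form of the double covering `Spin(3) → SO(3)`. -/
theorem spinMat_cliffVec_bracket (a : Fin 3 → ℝ) (u : Fin 5 → ℝ) :
    spinMat a * cliffVec u - cliffVec u * spinMat a = cliffVec (soMat a *ᵥ u) := by
  have h3 := ofReal_sqrt_three_sq
  have hI := Complex.I_sq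
  rw [spinMat_eq, cliffVec_eq, cliffVec_eq, soMat_eq]
  ext i j
  fin_cases i <;> fin_cases j <;>
    simp [Matrix.mulVec, dotProduct, Fin.sum_univ_five] <;> grind

/-- Schur's lemma for the Clifford module `ℂ⁴`, which is irreducible. -/
theorem eq_scalar_of_commute_cliffVec {T : Matrix (Fin 4) (Fin 4) ℂ}
    (h : ∀ u, T * cliffVec u = cliffVec u * T) : T = T 0 0 • 1 := by
  have h0 := fun i j ↦ congrFun₂ (h (Pi.single 0 1)) i j
  have h1 := fun i j ↦ congrFun₂ (h (Pi.single 1 1)) i j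
  have h2 := fun i j ↦ congrFun₂ (h (Pi.single 2 1)) i j
  have h3 := fun i j ↦ congrFun₂ (h (Pi.single 3 1)) i j
  have h4 := fun i j ↦ congrFun₂ (h (Pi.single 4 1)) i j
  simp only [cliffVec_eq] at h0 h1 h2 h3 h4
  simp [Matrix.mul_apply, Fin.sum_univ_four, Fin.forall_fin_succ] at h0 h1 h2 h3 h4
  have hI : Complex.I ≠ 0 := Complex.I_ne_zero
  ext i j
  fin_cases i <;> fin_cases j <;> simp <;> grind

theorem eq_zero_of_commute_cliffVec {T : Matrix (Fin 4) (Fin 4) ℂ}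
    (h : ∀ u, T * cliffVec u = cliffVec u * T) (ht : T.trace = 0) : T = 0 := by
  have h1 := eq_scalar_of_commute_cliffVec h
  rw [h1] at ht
  simp at ht
  rw [h1, ht, zero_smul]

theorem cliffVec_sub (u v : Fin 5 → ℝ) : cliffVec (u - v) = cliffVec u - cliffVec v := by
  simp [cliffVec, sub_smul, Finset.sum_sub_distrib]

/-- In the basis `𝐄_I` the bracket of `spin(3)` is the cross product, too. -/
theorem spinMat_bracket (a b : Fin 3 → ℝ) :
    spinMat a * spinMat b - spinMat b * spinMat a = spinMat (a ⨯₃ b) := by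
  -- by the Jacobi identity the difference of the two sides commutes with Clifford multiplication
  rw [← sub_eq_zero]
  refine eq_zero_of_commute_cliffVec (fun u ↦ ?_) ?_
  · have h := spinMat_cliffVec_bracket (a ⨯₃ b) u
    rw [← soMat_bracket, Matrix.sub_mulVec, cliffVec_sub, ← Matrix.mulVec_mulVec,
      ← Matrix.mulVec_mulVec, ← spinMat_cliffVec_bracket, ← spinMat_cliffVec_bracket,
      ← spinMat_cliffVec_bracket, ← spinMat_cliffVec_bracket, sub_eq_iff_eq_add] at h
    rw [sub_mul, mul_sub, h]
    noncomm_ring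
  · rw [Matrix.trace_sub, Matrix.trace_sub, Matrix.trace_mul_comm, trace_spinMat]
    simp

theorem soMat_injective : Function.Injective soMat := by
  intro a b h
  rw [soMat_eq, soMat_eq] at h
  have h0 := congrFun₂ h 1 2
  have h1 := congrFun₂ h 1 4
  have h2 := congrFun₂ h 2 4
  ext i
  fin_cases i <;> simp_all

/-- Nonzero elements of `spin(3)` are invertible, by the determinant identity. -/
theorem eq_zero_of_spinMat_mulVec {r : Fin 3 → ℝ} {ψ : Fin 4 → ℂ} (hψ : ψ ≠ 0)
    (h : spinMat r *ᵥ ψ = 0) : r = 0 := by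
  have h0 := Matrix.exists_mulVec_eq_zero_iff.1 ⟨ψ, hψ, h⟩
  rw [det_spinMat] at h0
  have h1 : ∑ I, r I ^ 2 = 0 := by
    have : 9 / 16 * (∑ I, r I ^ 2) ^ 2 = 0 := by exact_mod_cast h0
    simpa using this
  ext i
  have := (Finset.sum_eq_zero_iff_of_nonneg (fun i _ ↦ sq_nonneg (r i))).1 h1 i (Finset.mem_univ i)
  simpa using this

/-! ### Algebras of `SO(3)` type and their standard frames -/

/-- The pointwise model of an `SO(3)` geometry: an inner product on a real vector space `V` together
with the commutative product `(v, w) ↦ Υ_v w`. -/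
structure SO3Algebra (V : Type*) [AddCommGroup V] [Module ℝ V] where
  /-- The inner product. -/
  ip : V →ₗ[ℝ] V →ₗ[ℝ] ℝ
  /-- The product `(v, w) ↦ Υ_v w`. -/
  mul : V →ₗ[ℝ] V →ₗ[ℝ] V
  ip_comm (u v : V) : ip u v = ip v u
  ip_pos (v : V) : v ≠ 0 → 0 < ip v v
  ip_mul_swap (u v w : V) : ip u (mul v w) = ip w (mul v u)
  ip_mul_comm (u v w : V) : ip u (mul v w) = ip u (mul w v)
  trace_mul (v : V) : LinearMap.trace ℝ V (mul v) = 0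
  mul_mul_self (v : V) : mul v (mul v v) = ip v v • v

namespace SO3Algebra

variable {V : Type*} [AddCommGroup V] [Module ℝ V] (A : SO3Algebra V)

theorem eq_zero_of_ip_self {v : V} (h : A.ip v v = 0) : v = 0 := by
  by_contra hv
  exact (A.ip_pos v hv).ne' h

theorem mul_comm (v w : V) : A.mul v w = A.mul w v := by
  rw [← sub_eq_zero]
  apply A.eq_zero_of_ip_self
  rw [map_sub (A.ip _), A.ip_mul_comm, sub_self]

theorem ip_mul_left (u v w : V) : A.ip (A.mul u v) w = A.ip v (A.mul u w) := by
  rw [A.ip_comm, A.ip_mul_swap]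

/-- The first polarization of `v(vv) = ⟨v, v⟩ v`. -/
theorem mul_mul_polarized (v w : V) :
    A.mul w (A.mul v v) + (2 : ℝ) • A.mul v (A.mul v w)
      = A.ip v v • w + (2 * A.ip v w) • v := by
  have h1 := A.mul_mul_self (v + w)
  have h2 := A.mul_mul_self (v - w)
  have h3 := A.mul_mul_self w
  simp only [map_add, map_sub, LinearMap.add_apply, LinearMap.sub_apply, A.mul_comm w v,
    A.ip_comm w v] at h1 h2
  linear_combination (norm := module) (1 / 2 : ℝ) • h1 - (1 / 2 : ℝ) • h2 - h3

/-- The full polarization of `v(vv) = ⟨v, v⟩ v`. -/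
theorem mul_mul_trilinear (u v w : V) :
    A.mul u (A.mul v w) + A.mul v (A.mul u w) + A.mul w (A.mul u v)
      = A.ip v w • u + A.ip u w • v + A.ip u v • w := by
  have h1 := A.mul_mul_polarized (u + v) w
  have h2 := A.mul_mul_polarized u w
  have h3 := A.mul_mul_polarized v w
  simp only [map_add, LinearMap.add_apply, A.mul_comm v u, A.ip_comm v u] at h1
  linear_combination (norm := module) (1 / 2 : ℝ) • h1 - (1 / 2 : ℝ) • h2 - (1 / 2 : ℝ) • h3

/-- The cubic form `Υ(v, v, v)`. -/
def form (v : V) : ℝ := A.ip v (A.mul v v)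

theorem ip_mul_self_mul_self (v : V) : A.ip (A.mul v v) (A.mul v v) = A.ip v v ^ 2 := by
  rw [A.ip_mul_left, A.mul_mul_self, map_smul, smul_eq_mul, sq]

theorem mul_self_mul_mul_self (v : V) :
    A.mul (A.mul v v) (A.mul v v) = (2 * A.form v) • v - A.ip v v • A.mul v v := by
  have h := A.mul_mul_polarized v (A.mul v v)
  rw [A.mul_mul_self, map_smul] at h
  rw [form]
  linear_combination (norm := module) h

/-- A vector of `span (v, vv)` on which the cubic form vanishes, when `v` is a unit vector. In the
plane `span (v, vv)` the product is `(z, w) ↦ conj (z w)` in a suitable complex coordinate, and `v`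
has coordinate `i exp (iψ)` where `sin (3ψ) = Υ(v, v, v)`. This is the vector of coordinate `i`. -/
def nullVector (v : V) : V :=
  (√(1 - A.form v ^ 2))⁻¹ • ((1 - 2 * Real.sin (Real.arcsin (A.form v) / 3) ^ 2) • v
    - Real.sin (Real.arcsin (A.form v) / 3) • A.mul v v)

theorem nullVector_spec {v : V} (hv : A.ip v v = 1) (hF : A.form v ^ 2 < 1) :
    A.ip (A.nullVector v) (A.nullVector v) = 1 ∧ A.form (A.nullVector v) = 0 := by
  have hlt := (sq_lt_one_iff_abs_lt_one _).1 hF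
  rw [abs_lt] at hlt
  have hs : 3 * Real.sin (Real.arcsin (A.form v) / 3)
      - 4 * Real.sin (Real.arcsin (A.form v) / 3) ^ 3 = A.form v := by
    rw [← Real.sin_three_mul, mul_div_cancel₀ _ (by norm_num),
      Real.sin_arcsin hlt.1.le hlt.2.le]
  have hr : √(1 - A.form v ^ 2) ^ 2 = 1 - A.form v ^ 2 := Real.sq_sqrt (by linarith)
  have hr0 : √(1 - A.form v ^ 2) ≠ 0 := (Real.sqrt_pos.2 (by linarith)).ne'
  rw [nullVector]
  set s := Real.sin (Real.arcsin (A.form v) / 3)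
  set r := √(1 - A.form v ^ 2)
  have h1 : A.ip v (A.mul v v) = A.form v := rfl
  have h2 : A.ip (A.mul v v) v = A.form v := A.ip_comm _ _
  have h3 := A.ip_mul_self_mul_self v
  have h4 := A.mul_self_mul_mul_self v
  have h5 := A.mul_mul_self v
  have h6 : A.mul (A.mul v v) v = v := by rw [A.mul_comm, h5, hv, one_smul]
  rw [hv, one_smul] at h5 h4
  rw [hv, one_pow] at h3
  constructor
  · simp only [map_sub, map_smul, LinearMap.sub_apply, LinearMap.smul_apply, smul_eq_mul, h1, h2,
      h3, hv]
    field_simp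
    rw [hr, ← hs]
    ring
  · rw [form]
    simp only [map_sub, map_smul, LinearMap.sub_apply, LinearMap.smul_apply, smul_eq_mul, h1, h2,
      h3, hv, h4, h5, h6]
    field_simp
    rw [← hs]
    ring

theorem exists_form_eq_zero (h : 1 < Module.finrank ℝ V) :
    ∃ v, A.ip v v = 1 ∧ A.form v = 0 := by
  have : Nontrivial V := Module.nontrivial_of_finrank_pos (R := ℝ) (by omega)
  obtain ⟨u, hu⟩ := exists_ne (0 : V)
  obtain ⟨w, hw⟩ := exists_linearIndependent_pair_of_one_lt_finrank h hu
  rw [LinearIndependent.pair_iff] at hw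
  -- the cubic form is odd, hence changes sign along a half circle
  have hcont : Continuous fun t : ℝ ↦ A.form (Real.cos t • u + Real.sin t • w) := by
    simp only [form, map_add, map_smul, LinearMap.add_apply, LinearMap.smul_apply, smul_eq_mul]
    fun_prop
  have hπ : A.form (Real.cos Real.pi • u + Real.sin Real.pi • w)
      = -A.form (Real.cos 0 • u + Real.sin 0 • w) := by
    simp [form]
  have hz : (0 : ℝ) ∈ uIcc (A.form (Real.cos 0 • u + Real.sin 0 • w))
      (A.form (Real.cos Real.pi • u + Real.sin Real.pi • w)) := by
    rw [hπ, mem_uIcc]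
    rcases le_total (A.form (Real.cos 0 • u + Real.sin 0 • w)) 0 with h | h
    · left; constructor <;> linarith
    · right; constructor <;> linarith
  obtain ⟨t, -, ht⟩ := intermediate_value_uIcc hcont.continuousOn hz
  set x := Real.cos t • u + Real.sin t • w
  have hx : x ≠ 0 := by
    intro hx
    obtain ⟨h1, h2⟩ := hw _ _ hx
    have := Real.sin_sq_add_cos_sq t
    simp [h1, h2] at this
  have hpos := A.ip_pos x hx
  have hsq := Real.sq_sqrt hpos.le
  have hne := (Real.sqrt_pos.2 hpos).ne'
  refine ⟨(√(A.ip x x))⁻¹ • x, ?_, ?_⟩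
  · simp only [map_smul, LinearMap.smul_apply, smul_eq_mul]
    field_simp
    exact hsq.symm
  · have ht' : A.ip x (A.mul x x) = 0 := ht
    simp [form, ht']

section NullVector

variable {A} {b : V}

theorem mul_mul_self_of_unit (hb : A.ip b b = 1) : A.mul b (A.mul b b) = b := by
  rw [A.mul_mul_self, hb, one_smul]

theorem mul_self_mul (hb : A.ip b b = 1) (w : V) :
    A.mul (A.mul b b) w = w + (2 * A.ip b w) • b - (2 : ℝ) • A.mul b (A.mul b w) := by
  have h := A.mul_mul_polarized b w
  rw [hb, one_smul, A.mul_comm w] at h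
  linear_combination (norm := module) h

theorem four_smul_mul_mul_mul (hb : A.ip b b = 1) (hF : A.form b = 0) (w : V) :
    (4 : ℝ) • A.mul b (A.mul b (A.mul b w))
      = (3 : ℝ) • A.mul b w + A.ip b w • A.mul b b + A.ip (A.mul b b) w • b := by
  have h := A.mul_mul_trilinear b (A.mul b b) w
  have hF' : A.ip b (A.mul b b) = 0 := hF
  rw [mul_mul_self_of_unit hb, mul_self_mul hb, mul_self_mul hb, A.mul_comm w b, hF',
    ← A.ip_mul_left] at h
  simp only [map_add, map_sub, map_smul] at h
  linear_combination (norm := module) -h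

/-- A multiple of the projection to the eigenspace of `Υ_b` of eigenvalue `μ = ± √3 / 2`, for a unit
vector `b` with `Υ(b, b, b) = 0`. -/
def eigenProj (A : SO3Algebra V) (b : V) (μ : ℝ) : V →ₗ[ℝ] V :=
  A.mul b ∘ₗ A.mul b + μ • A.mul b - (A.ip b).smulRight (b + μ • A.mul b b)
    - (A.ip (A.mul b b)).smulRight (A.mul b b + μ • b)

theorem mul_eigenProj (hb : A.ip b b = 1) (hF : A.form b = 0) {μ : ℝ} (hμ : μ ^ 2 = 3 / 4)
    (w : V) : A.mul b (A.eigenProj b μ w) = μ • A.eigenProj b μ w := by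
  have h := four_smul_mul_mul_mul hb hF w
  simp only [eigenProj, LinearMap.add_apply, LinearMap.sub_apply, LinearMap.comp_apply,
    LinearMap.smul_apply, LinearMap.smulRight_apply, map_add, map_sub, map_smul,
    mul_mul_self_of_unit hb, smul_add, smul_sub, smul_smul]
  have h2 : μ * μ = 3 / 4 := by rw [← sq, hμ]
  simp only [h2, mul_left_comm μ]
  linear_combination (norm := module) (1 / 4 : ℝ) • h

theorem exists_eigenProj_ne_zero (hV : Module.finrank ℝ V = 5) (hb : A.ip b b = 1)
    (hF : A.form b = 0) (μ : ℝ) : ∃ w, A.eigenProj b μ w ≠ 0 := by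
  have : FiniteDimensional ℝ V := Module.finite_of_finrank_pos (by omega)
  have hF' : A.ip b (A.mul b b) = 0 := hF
  have hF'' : A.ip (A.mul b b) b = 0 := by rw [A.ip_comm, hF']
  have h0 := A.ip_mul_self_mul_self b
  -- the trace of `Υ_b²` is `7 / 2`, because the trace of `Υ_w` with `w = Υ_b b` vanishes
  have h1 : LinearMap.trace ℝ V (A.mul b ∘ₗ A.mul b) = 7 / 2 := by
    have h2 : A.mul (A.mul b b) = LinearMap.id + (2 : ℝ) • (A.ip b).smulRight b
        - (2 : ℝ) • (A.mul b ∘ₗ A.mul b) := by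
      ext w
      simp [mul_self_mul hb, smul_smul]
    have h3 := A.trace_mul (A.mul b b)
    rw [h2] at h3
    simp only [map_add, map_sub, map_smul, LinearMap.trace_smulRight, LinearMap.trace_id, hV, hb,
      smul_eq_mul] at h3
    push_cast at h3
    linarith
  have h2 : LinearMap.trace ℝ V (A.eigenProj b μ) = 3 / 2 := by
    simp only [eigenProj, map_add, map_sub, map_smul, h1, LinearMap.trace_smulRight, hb, hF', hF'',
      h0, A.trace_mul, smul_eq_mul]
    norm_num
  by_contra! h
  rw [show A.eigenProj b μ = 0 from LinearMap.ext h] at h2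
  norm_num at h2

/-- Unit eigenvectors of `Υ_b` with eigenvalue `μ = ± √3 / 2`. -/
structure IsUnitEigenvector (A : SO3Algebra V) (b : V) (μ : ℝ) (e : V) : Prop where
  ip_self : A.ip e e = 1
  mul_eq : A.mul b e = μ • e

namespace IsUnitEigenvector

variable {μ : ℝ} {e : V}

theorem ip_left (h : A.IsUnitEigenvector b μ e) (hb : A.ip b b = 1) (hμ : μ ^ 2 = 3 / 4) :
    A.ip b e = 0 := by
  have h1 : A.ip b e = A.ip (A.mul b b) (A.mul b e) := by
    conv_lhs => rw [← mul_mul_self_of_unit hb, A.ip_mul_left]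
  have h2 : A.ip (A.mul b b) e = A.ip b (A.mul b e) := A.ip_mul_left _ _ _
  rw [h.mul_eq, map_smul, smul_eq_mul] at h1 h2
  rw [h2] at h1
  linear_combination (norm := ring_nf) 4 * h1 + 4 * A.ip b e * hμ

theorem ip_mul_self_left (h : A.IsUnitEigenvector b μ e) (hb : A.ip b b = 1)
    (hμ : μ ^ 2 = 3 / 4) : A.ip (A.mul b b) e = 0 := by
  rw [A.ip_mul_left, h.mul_eq, map_smul, h.ip_left hb hμ, smul_zero]

theorem mul_self_mul_eq (h : A.IsUnitEigenvector b μ e) (hb : A.ip b b = 1)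
    (hμ : μ ^ 2 = 3 / 4) : A.mul (A.mul b b) e = (-1 / 2 : ℝ) • e := by
  rw [mul_self_mul hb, h.ip_left hb hμ, h.mul_eq, map_smul, h.mul_eq]
  have h2 : μ * μ = 3 / 4 := by rw [← sq, hμ]
  rw [smul_smul μ, h2]
  module

theorem mul_self_eq (h : A.IsUnitEigenvector b μ e) (hb : A.ip b b = 1) (hF : A.form b = 0)
    (hμ : μ ^ 2 = 3 / 4) : A.mul e e = (-1 / 2 : ℝ) • A.mul b b + μ • b := by
  -- both sides have norm one, and so has their inner product
  rw [← sub_eq_zero]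
  apply A.eq_zero_of_ip_self
  have h1 : A.ip (A.mul e e) (A.mul b b) = -1 / 2 := by
    rw [A.ip_mul_left, A.mul_comm e, h.mul_self_mul_eq hb hμ, map_smul, h.ip_self]
    norm_num
  have h2 : A.ip (A.mul e e) b = μ := by
    rw [A.ip_mul_left, A.mul_comm e, h.mul_eq, map_smul, h.ip_self, smul_eq_mul, mul_one]
  have h3 := A.ip_mul_self_mul_self e
  have h4 := A.ip_mul_self_mul_self b
  have hF' : A.ip b (A.mul b b) = 0 := hF
  simp only [map_add, map_sub, map_smul, LinearMap.add_apply, LinearMap.sub_apply,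
    LinearMap.smul_apply, smul_eq_mul, h1, h2, h3, h4, hF', A.ip_comm _ (A.mul e e),
    A.ip_comm (A.mul b b) b, h.ip_self, hb]
  linear_combination -hμ

end IsUnitEigenvector

theorem ip_eigenvectors {e f : V} {μ ν : ℝ} (he : A.IsUnitEigenvector b μ e)
    (hf : A.IsUnitEigenvector b ν f) (h : μ ≠ ν) : A.ip e f = 0 := by
  have h1 := A.ip_mul_left b e f
  rw [he.mul_eq, hf.mul_eq, map_smul, map_smul, LinearMap.smul_apply, smul_eq_mul,
    smul_eq_mul] at h1
  exact (mul_eq_zero.1 (show (μ - ν) * A.ip e f = 0 by linarith)).resolve_left (sub_ne_zero.2 h)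

/-- The orthonormal frame built from a unit vector `b` with `Υ(b, b, b) = 0` and from unit
eigenvectors `e₂`, `e₄` of `Υ_b` with eigenvalues `-√3 / 2` and `√3 / 2`. -/
def stdFrame (A : SO3Algebra V) (b e₂ e₄ : V) : Fin 5 → V :=
  ![A.mul b b, (2 / √3 : ℝ) • A.mul e₂ e₄, e₂, b, e₄]

section Frame

variable {e₂ e₄ : V}

theorem sqrt_three_half_sq : (√3 / 2 : ℝ) ^ 2 = 3 / 4 := by
  rw [div_pow, sqrt_three_sq]
  norm_num

theorem neg_sqrt_three_half_sq : (-(√3 / 2) : ℝ) ^ 2 = 3 / 4 := by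
  rw [neg_sq, sqrt_three_half_sq]

theorem mul_left_eigenvectors (hb : A.ip b b = 1)
    (h₂ : A.IsUnitEigenvector b (-(√3 / 2)) e₂) (h₄ : A.IsUnitEigenvector b (√3 / 2) e₄) :
    A.mul b (A.mul e₂ e₄) = 0 := by
  have h := A.mul_mul_trilinear b e₂ e₄
  have h0 : (-(√3 / 2) : ℝ) ≠ √3 / 2 := by
    have : 0 < √3 := by positivity
    linarith
  rw [h₂.mul_eq, h₄.mul_eq, h₂.ip_left hb neg_sqrt_three_half_sq,
    h₄.ip_left hb sqrt_three_half_sq, ip_eigenvectors h₂ h₄ h0, map_smul, map_smul,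
    A.mul_comm e₄ e₂] at h
  linear_combination (norm := module) h

/-- If `e`, `f` are unit eigenvectors of `Υ_b` with eigenvalues `μ` and `-μ`, then
`e (e f) = ¾ f`. -/
theorem mul_mul_eigenvectors {e f : V} {μ : ℝ} (hb : A.ip b b = 1) (hF : A.form b = 0)
    (hμ : μ ^ 2 = 3 / 4) (he : A.IsUnitEigenvector b μ e) (hf : A.IsUnitEigenvector b (-μ) f) :
    A.mul e (A.mul e f) = (3 / 4 : ℝ) • f := by
  have h := A.mul_mul_polarized e f
  have h0 : μ ≠ -μ := by
    intro h
    have : μ = 0 := by linarith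
    norm_num [this] at hμ
  have h2 : A.mul (A.mul e e) f = (-1 / 2 : ℝ) • f := by
    rw [he.mul_self_eq hb hF hμ, map_add, map_smul, map_smul, LinearMap.add_apply,
      LinearMap.smul_apply, LinearMap.smul_apply, hf.mul_self_mul_eq hb (by rw [neg_sq, hμ]),
      hf.mul_eq, smul_smul, smul_smul, ← add_smul]
    congr 1
    linear_combination -hμ
  rw [he.ip_self, ip_eigenvectors he hf h0, A.mul_comm f, h2] at h
  linear_combination (norm := module) (1 / 2 : ℝ) • h

/-- The data from which a standard frame is built. -/
structure IsFrameData (A : SO3Algebra V) (b e₂ e₄ : V) : Prop where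
  ip_self : A.ip b b = 1
  form_eq : A.form b = 0
  left : A.IsUnitEigenvector b (-(√3 / 2)) e₂
  right : A.IsUnitEigenvector b (√3 / 2) e₄

namespace IsFrameData

theorem ip_left_right (h : A.IsFrameData b e₂ e₄) : A.ip e₂ e₄ = 0 := by
  refine ip_eigenvectors h.left h.right ?_
  have : 0 < √3 := by positivity
  linarith

theorem ip_mul_mul (h : A.IsFrameData b e₂ e₄) :
    A.ip (A.mul e₂ e₄) (A.mul e₂ e₄) = 3 / 4 := by
  rw [A.ip_mul_left, mul_mul_eigenvectors h.ip_self h.form_eq neg_sqrt_three_half_sq h.left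
    (by rw [neg_neg]; exact h.right), map_smul, h.right.ip_self, smul_eq_mul, mul_one]

theorem ip_mul_left_right (h : A.IsFrameData b e₂ e₄) : A.ip b (A.mul e₂ e₄) = 0 := by
  rw [A.ip_comm, A.ip_mul_left, A.mul_comm e₂ b, h.left.mul_eq, map_smul, A.ip_comm e₄,
    h.ip_left_right, smul_zero]

theorem ip_mul_self_mul_left_right (h : A.IsFrameData b e₂ e₄) :
    A.ip (A.mul b b) (A.mul e₂ e₄) = 0 := by
  rw [A.ip_mul_left, mul_left_eigenvectors h.ip_self h.left h.right, map_zero]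

theorem ip_left_mul (h : A.IsFrameData b e₂ e₄) : A.ip e₂ (A.mul e₂ e₄) = 0 := by
  have h1 : A.ip (A.mul b e₂) (A.mul e₂ e₄) = 0 := by
    rw [A.ip_mul_left, mul_left_eigenvectors h.ip_self h.left h.right, map_zero]
  rw [h.left.mul_eq, map_smul, LinearMap.smul_apply, smul_eq_mul] at h1
  exact (mul_eq_zero.1 h1).resolve_left (by simp)

theorem ip_right_mul (h : A.IsFrameData b e₂ e₄) : A.ip e₄ (A.mul e₂ e₄) = 0 := by
  have h1 : A.ip (A.mul b e₄) (A.mul e₂ e₄) = 0 := by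
    rw [A.ip_mul_left, mul_left_eigenvectors h.ip_self h.left h.right, map_zero]
  rw [h.right.mul_eq, map_smul, LinearMap.smul_apply, smul_eq_mul] at h1
  exact (mul_eq_zero.1 h1).resolve_left (by simp)

theorem orthonormal (h : A.IsFrameData b e₂ e₄) (i j : Fin 5) :
    A.ip (A.stdFrame b e₂ e₄ i) (A.stdFrame b e₂ e₄ j) = if i = j then 1 else 0 := by
  have hF : A.ip b (A.mul b b) = 0 := h.form_eq
  have h0 := A.ip_mul_self_mul_self b
  rw [h.ip_self, one_pow] at h0
  have h1 := h.ip_mul_mul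
  have hs := sqrt_three_sq
  have hs0 : √3 ≠ 0 := by positivity
  have h11 : 2 / √3 * (2 / √3 * (3 / 4)) = 1 := by field_simp; linarith
  fin_cases i <;> fin_cases j <;>
    simp [stdFrame, h.ip_self, hF, h0, h1, h11, h.left.ip_self, h.right.ip_self,
      h.left.ip_left h.ip_self neg_sqrt_three_half_sq,
      h.right.ip_left h.ip_self sqrt_three_half_sq,
      h.left.ip_mul_self_left h.ip_self neg_sqrt_three_half_sq,
      h.right.ip_mul_self_left h.ip_self sqrt_three_half_sq,
      h.ip_left_right, h.ip_mul_left_right, h.ip_left_mul, h.ip_right_mul,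
      h.ip_mul_self_mul_left_right, A.ip_comm (A.mul b b) b, A.ip_comm e₂ b, A.ip_comm e₄ b,
      A.ip_comm e₂ (A.mul b b), A.ip_comm e₄ (A.mul b b), A.ip_comm e₄ e₂,
      A.ip_comm (A.mul e₂ e₄)]

/-- The multiplication table of the standard frame. -/
theorem mul_stdFrame (h : A.IsFrameData b e₂ e₄) {e : Fin 5 → V}
    (he : e = A.stdFrame b e₂ e₄) :
    (A.mul (e 0) (e 0) = -e 0 ∧ A.mul (e 0) (e 1) = e 1 ∧
      A.mul (e 0) (e 2) = (-1 / 2 : ℝ) • e 2 ∧ A.mul (e 0) (e 3) = e 3 ∧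
      A.mul (e 0) (e 4) = (-1 / 2 : ℝ) • e 4) ∧
    (A.mul (e 1) (e 1) = e 0 ∧ A.mul (e 1) (e 2) = (√3 / 2) • e 4 ∧
      A.mul (e 1) (e 3) = 0 ∧ A.mul (e 1) (e 4) = (√3 / 2) • e 2) ∧
    (A.mul (e 2) (e 2) = (-1 / 2 : ℝ) • e 0 - (√3 / 2) • e 3 ∧
      A.mul (e 2) (e 3) = (-(√3 / 2)) • e 2 ∧ A.mul (e 2) (e 4) = (√3 / 2) • e 1) ∧
    (A.mul (e 3) (e 3) = e 0 ∧ A.mul (e 3) (e 4) = (√3 / 2) • e 4) ∧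
    A.mul (e 4) (e 4) = (-1 / 2 : ℝ) • e 0 + (√3 / 2) • e 3 := by
  have hs := sqrt_three_sq
  have hs0 : √3 ≠ 0 := by positivity
  have hb := h.ip_self
  have horth := h.orthonormal
  rw [← he] at horth
  have e0 : e 0 = A.mul b b := by rw [he]; rfl
  have e1 : e 1 = (2 / √3 : ℝ) • A.mul e₂ e₄ := by rw [he]; rfl
  have e2 : e 2 = e₂ := by rw [he]; rfl
  have e3 : e 3 = b := by rw [he]; rfl
  have e4 : e 4 = e₄ := by rw [he]; rfl
  have hb1 : A.mul b (e 1) = 0 := by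
    rw [e1, map_smul, mul_left_eigenvectors hb h.left h.right, smul_zero]
  have hc : 2 / √3 * (3 / 4) = √3 / 2 := by field_simp; linarith
  have h01 : A.mul (e 0) (e 1) = e 1 := by
    have h1 := horth 3 1
    simp only [e3, show (3 : Fin 5) ≠ 1 by decide, if_false] at h1
    rw [e0, mul_self_mul hb, hb1, h1]
    simp
  refine ⟨⟨?_, h01, ?_, ?_, ?_⟩, ⟨?_, ?_, ?_, ?_⟩, ⟨?_, ?_, ?_⟩, ⟨?_, ?_⟩, ?_⟩
  · rw [e0, A.mul_self_mul_mul_self, h.form_eq, hb]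
    simp
  · rw [e0, e2, h.left.mul_self_mul_eq hb neg_sqrt_three_half_sq]
  · rw [e0, e3, A.mul_comm, mul_mul_self_of_unit hb]
  · rw [e0, e4, h.right.mul_self_mul_eq hb sqrt_three_half_sq]
  · -- both sides have norm one, and so has their inner product
    rw [← sub_eq_zero]
    apply A.eq_zero_of_ip_self
    have h1 := A.ip_mul_self_mul_self (e 1)
    have h2 : A.ip (A.mul (e 1) (e 1)) (e 0) = 1 := by
      rw [A.ip_mul_left, A.mul_comm, h01, horth]
      rfl
    rw [horth] at h1
    simp only [map_sub, LinearMap.sub_apply, A.ip_comm (e 0), h1, h2]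
    simp [horth]
  · rw [e1, e2, e4, A.mul_comm, map_smul, mul_mul_eigenvectors hb h.form_eq
      neg_sqrt_three_half_sq h.left (by rw [neg_neg]; exact h.right), smul_smul, hc]
  · rw [e3, A.mul_comm, hb1]
  · rw [e1, e2, e4, A.mul_comm, map_smul, A.mul_comm e₂, mul_mul_eigenvectors hb h.form_eq
      sqrt_three_half_sq h.right h.left, smul_smul, hc]
  · rw [e2, e0, e3, h.left.mul_self_eq hb h.form_eq neg_sqrt_three_half_sq]
    module
  · rw [e2, e3, A.mul_comm, h.left.mul_eq]
  · rw [e2, e4, e1, smul_smul, show √3 / 2 * (2 / √3) = 1 by field_simp, one_smul]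
  · rw [e3, e0]
  · rw [e3, e4, h.right.mul_eq]
  · rw [e4, e0, e3, h.right.mul_self_eq hb h.form_eq sqrt_three_half_sq]

end IsFrameData

end Frame

end NullVector

theorem eq_sum_of_orthonormal (hV : Module.finrank ℝ V = 5) {e : Fin 5 → V}
    (he : ∀ i j, A.ip (e i) (e j) = if i = j then 1 else 0) (v : V) :
    v = ∑ i, A.ip (e i) v • e i := by
  have hli : LinearIndependent ℝ e := by
    rw [Fintype.linearIndependent_iff]
    intro g hg i
    have h := congrArg (A.ip (e i)) hg
    simpa [map_sum, he] using h
  have : FiniteDimensional ℝ V := Module.finite_of_finrank_pos (by omega)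
  have hspan := hli.span_eq_top_of_card_eq_finrank' (by simp [hV])
  have hv : v ∈ Submodule.span ℝ (Set.range e) := by rw [hspan]; trivial
  obtain ⟨c, hc⟩ := (Submodule.mem_span_range_iff_exists_fun ℝ).1 hv
  have h (i : Fin 5) : A.ip (e i) v = c i := by
    rw [← hc]
    simp [map_sum, he]
  simp only [h, hc]

theorem ip_eq_sum_of_orthonormal (hV : Module.finrank ℝ V = 5) {e : Fin 5 → V}
    (he : ∀ i j, A.ip (e i) (e j) = if i = j then 1 else 0) (v w : V) :
    A.ip v w = ∑ i, A.ip (e i) v * A.ip (e i) w := by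
  conv_lhs => rw [A.eq_sum_of_orthonormal hV he v]
  simp [map_sum]

theorem IsFrameData.form_eq_cubic {A : SO3Algebra V} (hV : Module.finrank ℝ V = 5) {b e₂ e₄ : V}
    (h : A.IsFrameData b e₂ e₄) (v : V) :
    A.form v = cubic fun i ↦ A.ip (A.stdFrame b e₂ e₄ i) v := by
  obtain ⟨e, he⟩ : ∃ e, e = A.stdFrame b e₂ e₄ := ⟨_, rfl⟩
  have horth := h.orthonormal
  obtain ⟨⟨h00, h01, h02, h03, h04⟩, ⟨h11, h12, h13, h14⟩, ⟨h22, h23, h24⟩, ⟨h33, h34⟩, h44⟩ :=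
    h.mul_stdFrame he
  rw [← he] at horth ⊢
  have hv := A.eq_sum_of_orthonormal hV horth v
  set a : Fin 5 → ℝ := fun i ↦ A.ip (e i) v
  have ha (i : Fin 5) : A.ip v (e i) = a i := A.ip_comm _ _
  have hvv : A.mul v v = (-a 0 ^ 2 + a 1 ^ 2 + a 3 ^ 2 - (a 2 ^ 2 + a 4 ^ 2) / 2) • e 0
      + (2 * a 0 * a 1 + √3 * a 2 * a 4) • e 1 + (-a 0 * a 2 + √3 * a 1 * a 4 - √3 * a 2 * a 3) • e 2
      + (2 * a 0 * a 3 + √3 / 2 * (a 4 ^ 2 - a 2 ^ 2)) • e 3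
      + (-a 0 * a 4 + √3 * a 1 * a 2 + √3 * a 3 * a 4) • e 4 := by
    conv_lhs => rw [hv]
    simp only [Fin.sum_univ_five, map_add, map_smul, LinearMap.add_apply, LinearMap.smul_apply,
      A.mul_comm (e 1) (e 0), A.mul_comm (e 2) (e 0), A.mul_comm (e 3) (e 0),
      A.mul_comm (e 4) (e 0), A.mul_comm (e 2) (e 1), A.mul_comm (e 3) (e 1),
      A.mul_comm (e 4) (e 1), A.mul_comm (e 3) (e 2), A.mul_comm (e 4) (e 2),
      A.mul_comm (e 4) (e 3), h00, h01, h02, h03, h04, h11, h12, h13, h14, h22, h23, h24, h33, h34,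
      h44]
    module
  rw [form, hvv]
  simp only [map_add, map_smul, smul_eq_mul, ha]
  rw [cubic]
  ring

end SO3Algebra

/-! ### Radial integrals of 1-forms -/

section FlatSystems

open Filter Topology MeasureTheory

variable {E F : Type*} [NormedAddCommGroup E] [NormedSpace ℝ E] [NormedAddCommGroup F]
  [NormedSpace ℝ F]

/-- The integral of the 1-form `α` along the segment from `0` to `y`. -/
def radialIntegral (α : E → E →L[ℝ] F) (y : E) : F := ∫ t in (0 : ℝ)..1, α (t • y) y

/-- The derivative of `radialIntegral α`. -/
def radialDeriv (α : E → E →L[ℝ] F) (y : E) : E →L[ℝ] F :=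
  ∫ t in (0 : ℝ)..1, (t • (fderiv ℝ α (t • y)).flip y + α (t • y))

theorem continuous_radialDeriv_integrand {α : E → E →L[ℝ] F} (hα : ContDiff ℝ 1 α) :
    Continuous fun p : E × ℝ ↦ p.2 • (fderiv ℝ α (p.2 • p.1)).flip p.1 + α (p.2 • p.1) := by
  have h1 : Continuous fun p : E × ℝ ↦ p.2 • p.1 := by fun_prop
  have h2 : Continuous fun p : E × ℝ ↦ fderiv ℝ α (p.2 • p.1) :=
    (hα.continuous_fderiv one_ne_zero).comp h1
  have h3 : Continuous fun p : E × ℝ ↦ (fderiv ℝ α (p.2 • p.1)).flip :=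
    (ContinuousLinearMap.flipₗᵢ ℝ E E F).continuous.comp h2
  exact (continuous_snd.smul (h3.clm_apply continuous_fst)).add (hα.continuous.comp h1)

theorem hasFDerivAt_radialIntegral [FiniteDimensional ℝ E] [CompleteSpace F]
    {α : E → E →L[ℝ] F} (hα : ContDiff ℝ 1 α) (y : E) :
    HasFDerivAt (radialIntegral α) (radialDeriv α y) y := by
  have hc := continuous_radialDeriv_integrand hα
  have hc' : Continuous fun p : E × ℝ ↦ α (p.2 • p.1) p.1 :=
    (hα.continuous.comp (by fun_prop)).clm_apply continuous_fst
  have hK : IsCompact (Metric.closedBall y 1 ×ˢ Icc (0 : ℝ) 1) :=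
    (isCompact_closedBall y 1).prod isCompact_Icc
  obtain ⟨C, hC⟩ := hK.exists_bound_of_continuousOn hc.continuousOn
  refine intervalIntegral.hasFDerivAt_integral_of_dominated_of_fderiv_le
    (F := fun y t ↦ α (t • y) y)
    (F' := fun y t ↦ t • (fderiv ℝ α (t • y)).flip y + α (t • y)) (bound := fun _ ↦ C)
    (Metric.closedBall_mem_nhds y one_pos) (Eventually.of_forall fun x ↦ ?_) ?_ ?_ ?_ ?_ ?_
  · exact (hc'.comp (Continuous.prodMk_right x)).aestronglyMeasurable
  · exact (hc'.comp (Continuous.prodMk_right y)).intervalIntegrable _ _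
  · exact (hc.comp (Continuous.prodMk_right y)).aestronglyMeasurable
  · refine Eventually.of_forall fun t ht x hx ↦ hC (x, t) ⟨hx, ?_⟩
    rw [uIoc_of_le zero_le_one] at ht
    exact ⟨ht.1.le, ht.2⟩
  · exact intervalIntegrable_const
  · refine Eventually.of_forall fun t _ x _ ↦ ?_
    have h1 : HasFDerivAt α (fderiv ℝ α (t • x)) (t • x) :=
      (hα.differentiable one_ne_zero _).hasFDerivAt
    have h2 : HasFDerivAt (fun x : E ↦ t • x) (t • ContinuousLinearMap.id ℝ E) x :=
      (hasFDerivAt_id x).const_smul t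
    convert! (h1.comp x h2).clm_apply (hasFDerivAt_id x) using 1
    ext v
    simp [add_comm]

theorem contDiff_radialIntegral [FiniteDimensional ℝ E] [CompleteSpace F]
    {α : E → E →L[ℝ] F} (hα : ContDiff ℝ 1 α) : ContDiff ℝ 1 (radialIntegral α) := by
  rw [contDiff_one_iff_hasFDerivAt]
  exact ⟨radialDeriv α, intervalIntegral.continuous_parametric_intervalIntegral_of_continuous'
    (continuous_radialDeriv_integrand hα) 0 1, hasFDerivAt_radialIntegral hα⟩

/-- A quantitative Poincaré lemma: the radial primitive of `α` fails to have differential `α` by at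
most the size of `dα`. -/
theorem norm_radialDeriv_sub_le [CompleteSpace F] {α : E → E →L[ℝ] F} (hα : ContDiff ℝ 1 α)
    {r c : ℝ} (hc : 0 ≤ c) (h : ∀ x ∈ Metric.ball (0 : E) r, ∀ u v,
      ‖fderiv ℝ α x u v - fderiv ℝ α x v u‖ ≤ c * ‖u‖ * ‖v‖) {y : E}
    (hy : y ∈ Metric.ball (0 : E) r) : ‖radialDeriv α y - α y‖ ≤ c * ‖y‖ := by
  refine ContinuousLinearMap.opNorm_le_bound _ (by positivity) fun v ↦ ?_
  have hc1 : Continuous fun t : ℝ ↦ t • (fderiv ℝ α (t • y)).flip y + α (t • y) :=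
    (continuous_radialDeriv_integrand hα).comp (Continuous.prodMk_right y)
  have hd (t : ℝ) : HasDerivAt (fun t : ℝ ↦ t • α (t • y) v)
      (t • fderiv ℝ α (t • y) y v + α (t • y) v) t := by
    have h1 : HasFDerivAt α (fderiv ℝ α (t • y)) (t • y) :=
      (hα.differentiable one_ne_zero _).hasFDerivAt
    have h2 : HasDerivAt (fun t : ℝ ↦ t • y) y t := by
      simpa using (hasDerivAt_id t).smul_const y
    have h3 : HasDerivAt (fun t : ℝ ↦ α (t • y) v) (fderiv ℝ α (t • y) y v) t := by
      have h4 : HasFDerivAt (fun x ↦ α x v) ((fderiv ℝ α (t • y)).flip v) (t • y) :=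
        (ContinuousLinearMap.apply ℝ F v).hasFDerivAt.comp (t • y) h1
      exact h4.comp_hasDerivAt t h2
    have h5 : HasDerivAt (fun t : ℝ ↦ t • α (t • y) v) _ t := (hasDerivAt_id t).smul h3
    simpa using h5
  have hc2 : Continuous fun t : ℝ ↦ t • fderiv ℝ α (t • y) y v + α (t • y) v := by
    have h1 : Continuous fun t : ℝ ↦ t • y := by fun_prop
    have h2 := (hα.continuous_fderiv one_ne_zero).comp h1
    exact (continuous_id.smul ((h2.clm_apply continuous_const).clm_apply continuous_const)).add
      ((hα.continuous.comp h1).clm_apply continuous_const)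
  have h1 : α y v = ∫ t in (0 : ℝ)..1, (t • fderiv ℝ α (t • y) y v + α (t • y) v) := by
    rw [intervalIntegral.integral_eq_sub_of_hasDerivAt (fun t _ ↦ hd t)
      (hc2.intervalIntegrable _ _)]
    simp
  have h2 : radialDeriv α y v
      = ∫ t in (0 : ℝ)..1, (t • (fderiv ℝ α (t • y)).flip y + α (t • y)) v :=
    ContinuousLinearMap.intervalIntegral_apply (hc1.intervalIntegrable _ _) v
  rw [sub_apply, h1, h2, ← intervalIntegral.integral_sub
    ((hc1.clm_apply continuous_const).intervalIntegrable _ _) (hc2.intervalIntegrable _ _)]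
  have h3 := intervalIntegral.norm_integral_le_of_norm_le_const (a := (0 : ℝ)) (b := 1)
    (C := c * ‖y‖ * ‖v‖)
    (f := fun t ↦ (t • (fderiv ℝ α (t • y)).flip y + α (t • y)) v
      - (t • fderiv ℝ α (t • y) y v + α (t • y) v)) fun t ht ↦ ?_
  · simpa using h3
  · rw [uIoc_of_le zero_le_one] at ht
    have hty : t • y ∈ Metric.ball (0 : E) r := by
      rw [mem_ball_zero_iff] at hy ⊢
      rw [norm_smul, Real.norm_of_nonneg ht.1.le]
      exact (mul_le_of_le_one_left (norm_nonneg _) ht.2).trans_lt hy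
    have h4 : (t • (fderiv ℝ α (t • y)).flip y + α (t • y)) v
        - (t • fderiv ℝ α (t • y) y v + α (t • y) v)
        = t • (fderiv ℝ α (t • y) v y - fderiv ℝ α (t • y) y v) := by
      simp [smul_sub]
    rw [h4, norm_smul, Real.norm_of_nonneg ht.1.le]
    calc t * _ ≤ 1 * (c * ‖v‖ * ‖y‖) := by
          gcongr
          · exact ht.2
          · exact h _ hty _ _
      _ = c * ‖y‖ * ‖v‖ := by ring

theorem norm_radialIntegral_le {α : E → E →L[ℝ] F} {r c : ℝ}
    (h : ∀ x ∈ Metric.ball (0 : E) r, ‖α x‖ ≤ c) {y : E}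
    (hy : y ∈ Metric.ball (0 : E) r) : ‖radialIntegral α y‖ ≤ c * ‖y‖ := by
  have h3 := intervalIntegral.norm_integral_le_of_norm_le_const (a := (0 : ℝ)) (b := 1)
    (C := c * ‖y‖) (f := fun t ↦ α (t • y) y) fun t ht ↦ ?_
  · rw [radialIntegral]
    simpa using h3
  · rw [uIoc_of_le zero_le_one] at ht
    have hty : t • y ∈ Metric.ball (0 : E) r := by
      rw [mem_ball_zero_iff] at hy ⊢
      rw [norm_smul, Real.norm_of_nonneg ht.1.le]
      exact (mul_le_of_le_one_left (norm_nonneg _) ht.2).trans_lt hy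
    exact ((α (t • y)).le_opNorm y).trans (by gcongr; exact h _ hty)

end FlatSystems

/-! ### Linear systems of partial differential equations with vanishing curvature -/

section FlatSystems

open Filter Topology MeasureTheory

variable {E F G : Type*} [NormedAddCommGroup E] [NormedSpace ℝ E] [NormedAddCommGroup F]
  [NormedSpace ℝ F] [NormedAddCommGroup G] [NormedSpace ℝ G]

/-- Picard iteration along rays for the system `dψ = -b(ψ, γ)`, `ψ(0) = ψ₀`. -/
def flatIter (b : F →L[ℝ] G →L[ℝ] F) (γ : E → E →L[ℝ] G) (ψ₀ : F) : ℕ → E → F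
  | 0 => fun _ ↦ ψ₀
  | n + 1 => fun y ↦ ψ₀ - radialIntegral (fun x ↦ (b (flatIter b γ ψ₀ n x)).comp (γ x)) y

/-- The curvature of the connection `dψ + b(ψ, γ)`, applied to the vector `ψ`. -/
def systemCurv (b : F →L[ℝ] G →L[ℝ] F) (γ : E → E →L[ℝ] G) (x u v : E) (ψ : F) : F :=
  b ψ (fderiv ℝ γ x u v - fderiv ℝ γ x v u) + (b (b ψ (γ x v)) (γ x u) - b (b ψ (γ x u)) (γ x v))

variable {b : F →L[ℝ] G →L[ℝ] F} {γ : E → E →L[ℝ] G}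

theorem contDiff_apply_comp (hγ : ContDiff ℝ 1 γ) {ψ : E → F}
    (hψ : ContDiff ℝ 1 ψ) : ContDiff ℝ 1 fun x ↦ (b (ψ x)).comp (γ x) :=
  (b.contDiff.comp hψ).clm_comp hγ

theorem fderiv_apply_comp {ψ : E → F} {x : E}
    (hγ : DifferentiableAt ℝ γ x) (hψ : DifferentiableAt ℝ ψ x) (u v : E) :
    fderiv ℝ (fun x ↦ (b (ψ x)).comp (γ x)) x u v
      = b (ψ x) (fderiv ℝ γ x u v) + b (fderiv ℝ ψ x u) (γ x v) := by
  have h1 : HasFDerivAt (fun x ↦ b (ψ x)) (b.comp (fderiv ℝ ψ x)) x :=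
    b.hasFDerivAt.comp x hψ.hasFDerivAt
  rw [(h1.clm_comp hγ.hasFDerivAt).fderiv]
  simp

theorem norm_apply_comp_le (x : E) (ψ : F) : ‖(b ψ).comp (γ x)‖ ≤ ‖b‖ * ‖γ x‖ * ‖ψ‖ := by
  calc ‖(b ψ).comp (γ x)‖ ≤ ‖b‖ * ‖ψ‖ * ‖γ x‖ :=
        (ContinuousLinearMap.opNorm_comp_le _ _).trans (by gcongr; exact b.le_opNorm ψ)
    _ = _ := by ring

/-- Solutions of a smooth linear system `dψ = -b(ψ, γ)` are smooth. -/
theorem contDiffOn_of_parallel {s : Set E} (hs : IsOpen s)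
    (hγ : ContDiffOn ℝ ∞ γ s) {ψ : E → F}
    (hψ : ∀ y ∈ s, HasFDerivAt ψ (-(b (ψ y)).comp (γ y)) y) : ContDiffOn ℝ ∞ ψ s := by
  rw [contDiffOn_infty]
  intro n
  induction n with
  | zero => exact contDiffOn_zero.2 fun y hy ↦ (hψ y hy).continuousAt.continuousWithinAt
  | succ n ih =>
    rw [Nat.cast_add, Nat.cast_one, contDiffOn_succ_iff_fderiv_of_isOpen hs]
    refine ⟨fun y hy ↦ (hψ y hy).differentiableAt.differentiableWithinAt, by simp, ?_⟩
    have h1 : ContDiffOn ℝ n (fun y ↦ -(b (ψ y)).comp (γ y)) s :=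
      ((b.contDiff.comp_contDiffOn ih).clm_comp (hγ.of_le (by exact_mod_cast le_top))).neg
    exact h1.congr fun y hy ↦ (hψ y hy).fderiv

/-- A solution of `dψ = -b(ψ, γ)` which vanishes at a point vanishes near this point. -/
theorem eventually_eq_zero_of_parallel [FiniteDimensional ℝ E] {z : E} (hγ : ContinuousAt γ z) {ψ : E → F}
    (hψ : ∀ᶠ y in 𝓝 z, HasFDerivAt ψ (-(b (ψ y)).comp (γ y)) y) (h0 : ψ z = 0) :
    ∀ᶠ y in 𝓝 z, ψ y = 0 := by
  have h1 : ∀ᶠ y in 𝓝 z, ‖b‖ * ‖γ y‖ < ‖b‖ * ‖γ z‖ + 1 :=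
    (hγ.norm.const_mul ‖b‖).eventually_lt_const (by linarith)
  obtain ⟨ε, hε, hball⟩ := Metric.nhds_basis_closedBall.eventually_iff.1 (hψ.and h1)
  set a := ‖b‖ * ‖γ z‖ + 1
  have ha : 0 < a := by positivity
  set r := min ε (1 / (2 * a)) with hr
  have hr0 : 0 < r := lt_min hε (by positivity)
  have har : a * r ≤ 1 / 2 := by
    have h1 : a * r ≤ a * (1 / (2 * a)) := by gcongr; exact min_le_right _ _
    have h2 : a * (1 / (2 * a)) = 1 / 2 := by field_simp
    linarith
  have hsub : Metric.closedBall z r ⊆ Metric.closedBall z ε :=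
    Metric.closedBall_subset_closedBall (min_le_left _ _)
  have hcont : ContinuousOn (fun y ↦ ‖ψ y‖) (Metric.closedBall z r) := fun y hy ↦
    (hball (hsub hy)).1.continuousAt.norm.continuousWithinAt
  -- at a point where `‖ψ‖` is maximal, the mean value inequality shows `‖ψ‖ ≤ ‖ψ‖ / 2`
  obtain ⟨x, hx, hmax⟩ := (isCompact_closedBall z r).exists_isMaxOn
    (Metric.nonempty_closedBall.2 hr0.le) hcont
  have h2 := (convex_closedBall z r).norm_image_sub_le_of_norm_hasFDerivWithin_le (𝕜 := ℝ)
    (f := ψ) (C := a * ‖ψ x‖) (fun y hy ↦ (hball (hsub hy)).1.hasFDerivWithinAt) (fun y hy ↦ ?_)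
    (Metric.mem_closedBall_self hr0.le) hx
  · rw [h0, sub_zero] at h2
    have h3 : ‖x - z‖ ≤ r := by rwa [← dist_eq_norm]
    have h4 : a * ‖ψ x‖ * ‖x - z‖ ≤ a * ‖ψ x‖ * r := by gcongr
    have h5 : ‖ψ x‖ ≤ 0 := by nlinarith [norm_nonneg (ψ x)]
    filter_upwards [Metric.closedBall_mem_nhds z hr0] with y hy
    exact norm_le_zero_iff.1 ((hmax hy).trans h5)
  · rw [norm_neg]
    exact (norm_apply_comp_le _ _).trans
      (mul_le_mul (hball (hsub hy)).2.le (hmax hy) (norm_nonneg _) ha.le)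

/-- Parallel sections are annihilated by the curvature, because their second derivative is
symmetric. -/
theorem systemCurv_eq_zero_of_parallel {x : E} (hγ : DifferentiableAt ℝ γ x) {ψ : E → F}
    (hψ : ∀ᶠ y in 𝓝 x, HasFDerivAt ψ (-(b (ψ y)).comp (γ y)) y) (u v : E) :
    systemCurv b γ x u v (ψ x) = 0 := by
  have hψx := hψ.self_of_nhds
  have h1 : DifferentiableAt ℝ (fun y ↦ -(b (ψ y)).comp (γ y)) x :=
    ((b.differentiableAt.comp x hψx.differentiableAt).clm_comp hγ).neg
  have h2 := second_derivative_symmetric_of_eventually_of_real hψ h1.hasFDerivAt u v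
  rw [show (fun y ↦ -(b (ψ y)).comp (γ y)) = -fun y ↦ (b (ψ y)).comp (γ y) from rfl,
    fderiv_neg] at h2
  simp only [neg_apply] at h2
  rw [fderiv_apply_comp hγ hψx.differentiableAt, fderiv_apply_comp hγ hψx.differentiableAt,
    hψx.fderiv] at h2
  simp only [neg_apply, map_neg, ContinuousLinearMap.comp_apply] at h2
  rw [systemCurv, map_sub]
  rw [neg_inj] at h2
  rw [← sub_eq_zero] at h2
  rw [← h2]
  abel

variable [FiniteDimensional ℝ E] [CompleteSpace F]

theorem contDiff_flatIter (hγ : ContDiff ℝ 1 γ) (ψ₀ : F) (n : ℕ) :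
    ContDiff ℝ 1 (flatIter b γ ψ₀ n) := by
  induction n with
  | zero => exact contDiff_const
  | succ n ih => exact contDiff_const.sub (contDiff_radialIntegral (contDiff_apply_comp hγ ih))

theorem hasFDerivAt_flatIter_succ (hγ : ContDiff ℝ 1 γ) (ψ₀ : F)
    (n : ℕ) (y : E) : HasFDerivAt (flatIter b γ ψ₀ (n + 1))
      (-radialDeriv (fun x ↦ (b (flatIter b γ ψ₀ n x)).comp (γ x)) y) y :=
  (hasFDerivAt_radialIntegral (contDiff_apply_comp hγ (contDiff_flatIter hγ ψ₀ n)) y).const_sub ψ₀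

/-- On a ball on which `‖b‖ ‖γ‖` times the radius is at most `1 / 8`, the Picard iteration contracts
with ratio `1 / 2`. -/
theorem norm_flatIter_sub_le (hγ : ContDiff ℝ 1 γ) (ψ₀ : F)
    {r a : ℝ} (ha : 0 ≤ a) (hγ' : ∀ x ∈ Metric.ball (0 : E) r, ‖b‖ * ‖γ x‖ ≤ a) (har : a * r ≤ 1 / 8)
    (n : ℕ) {y : E} (hy : y ∈ Metric.ball (0 : E) r) :
    ‖flatIter b γ ψ₀ (n + 1) y - flatIter b γ ψ₀ n y‖ ≤ ‖ψ₀‖ * (1 / 2) ^ n := by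
  have hyr : a * ‖y‖ ≤ 1 / 8 := by
    rw [mem_ball_zero_iff] at hy
    exact (mul_le_mul_of_nonneg_left hy.le ha).trans har
  induction n generalizing y with
  | zero =>
    simp only [flatIter, sub_sub_cancel_left, norm_neg, pow_zero, mul_one]
    refine (norm_radialIntegral_le (r := r) (c := a * ‖ψ₀‖) (fun x hx ↦ ?_) hy).trans ?_
    · exact (norm_apply_comp_le _ _).trans (by gcongr; exact hγ' x hx)
    · nlinarith [norm_nonneg ψ₀]
  | succ n ih =>
    have hc := fun n ↦ contDiff_apply_comp (b := b) hγ (contDiff_flatIter (b := b) hγ ψ₀ n)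
    have h1 : flatIter b γ ψ₀ (n + 1 + 1) y - flatIter b γ ψ₀ (n + 1) y
        = radialIntegral
          (fun x ↦ (b (flatIter b γ ψ₀ n x - flatIter b γ ψ₀ (n + 1) x)).comp (γ x)) y := by
      have hint (n : ℕ) : IntervalIntegrable
          (fun t : ℝ ↦ (b (flatIter b γ ψ₀ n (t • y))).comp (γ (t • y)) y) volume 0 1 := by
        refine Continuous.intervalIntegrable ?_ _ _
        exact ((hc n).continuous.comp (by fun_prop)).clm_apply continuous_const
      change ψ₀ - radialIntegral (fun x ↦ (b (flatIter b γ ψ₀ (n + 1) x)).comp (γ x)) y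
        - (ψ₀ - radialIntegral (fun x ↦ (b (flatIter b γ ψ₀ n x)).comp (γ x)) y) = _
      rw [sub_sub_sub_cancel_left, radialIntegral, radialIntegral, radialIntegral,
        ← intervalIntegral.integral_sub (hint n) (hint (n + 1))]
      simp only [map_sub, ContinuousLinearMap.sub_comp, sub_apply]
    rw [h1]
    refine (norm_radialIntegral_le (r := r) (c := a * (‖ψ₀‖ * (1 / 2) ^ n)) (fun x hx ↦ ?_)
      hy).trans ?_
    · refine (norm_apply_comp_le _ _).trans ?_
      rw [norm_sub_rev]
      refine mul_le_mul (hγ' x hx) (ih hx ?_) (norm_nonneg _) ha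
      rw [mem_ball_zero_iff] at hx
      exact (mul_le_mul_of_nonneg_left hx.le ha).trans har
    · have h2 : 0 ≤ ‖ψ₀‖ * (1 / 2) ^ n := by positivity
      rw [pow_succ]
      nlinarith

/-- The defect `δₙ = dψₙ + b(ψₙ, γ)` of the Picard iterates decays: by flatness the exterior
derivative of the 1-form `b(ψₙ, γ)` is linear in `δₙ`, and the Poincaré lemma bounds `δₙ₊₁` by it. -/
theorem norm_fderiv_flatIter_add_le (hγ : ContDiff ℝ 1 γ) (ψ₀ : F)
    {r a : ℝ} (ha : 0 ≤ a) (hγ' : ∀ x ∈ Metric.ball (0 : E) r, ‖b‖ * ‖γ x‖ ≤ a) (har : a * r ≤ 1 / 8)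
    (hflat : ∀ x ∈ Metric.ball (0 : E) r, ∀ u v ψ, systemCurv b γ x u v ψ = 0)
    (n : ℕ) {y : E} (hy : y ∈ Metric.ball (0 : E) r) :
    ‖fderiv ℝ (flatIter b γ ψ₀ n) y + (b (flatIter b γ ψ₀ n y)).comp (γ y)‖
      ≤ 4 * a * ‖ψ₀‖ * (1 / 2) ^ n := by
  induction n generalizing y with
  | zero =>
    have h1 : fderiv ℝ (flatIter b γ ψ₀ 0) y = 0 := by simp [flatIter]
    rw [h1, zero_add, pow_zero, mul_one]
    refine (norm_apply_comp_le _ _).trans ?_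
    have := hγ' y hy
    have h2 : ‖b‖ * ‖γ y‖ * ‖ψ₀‖ ≤ a * ‖ψ₀‖ := by gcongr
    have h3 : 0 ≤ a * ‖ψ₀‖ := by positivity
    simp only [flatIter]
    linarith
  | succ n ih =>
    have hψ := contDiff_flatIter (b := b) hγ ψ₀ n
    have hyr : a * ‖y‖ ≤ 1 / 8 := by
      rw [mem_ball_zero_iff] at hy
      exact (mul_le_mul_of_nonneg_left hy.le ha).trans har
    set D := 4 * a * ‖ψ₀‖ * (1 / 2) ^ n with hD
    have hD0 : 0 ≤ D := by positivity
    have h1 := norm_radialDeriv_sub_le (contDiff_apply_comp (b := b) hγ hψ) (r := r) (c := 2 * a * D)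
      (by positivity) (fun x hx u v ↦ ?_) hy
    · rw [(hasFDerivAt_flatIter_succ hγ ψ₀ n y).fderiv]
      have h2 : -radialDeriv (fun x ↦ (b (flatIter b γ ψ₀ n x)).comp (γ x)) y
          + (b (flatIter b γ ψ₀ (n + 1) y)).comp (γ y)
          = (b (flatIter b γ ψ₀ (n + 1) y - flatIter b γ ψ₀ n y)).comp (γ y)
            - (radialDeriv (fun x ↦ (b (flatIter b γ ψ₀ n x)).comp (γ x)) y
              - (b (flatIter b γ ψ₀ n y)).comp (γ y)) := by
        rw [map_sub, ContinuousLinearMap.sub_comp]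
        abel
      rw [h2]
      refine (norm_sub_le _ _).trans ?_
      have h3 : ‖(b (flatIter b γ ψ₀ (n + 1) y - flatIter b γ ψ₀ n y)).comp (γ y)‖
          ≤ a * (‖ψ₀‖ * (1 / 2) ^ n) :=
        (norm_apply_comp_le _ _).trans (mul_le_mul (hγ' y hy)
          (norm_flatIter_sub_le hγ ψ₀ ha hγ' har n hy) (norm_nonneg _) ha)
      have h4 : 2 * a * D * ‖y‖ ≤ D / 4 := by nlinarith
      have h5 : a * (‖ψ₀‖ * (1 / 2) ^ n) = D / 4 := by rw [hD]; ring
      have h6 : 4 * a * ‖ψ₀‖ * (1 / 2) ^ (n + 1) = D / 2 := by rw [hD]; ring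
      linarith
    · have hγx : DifferentiableAt ℝ γ x := hγ.differentiable one_ne_zero x
      have hψx : DifferentiableAt ℝ (flatIter b γ ψ₀ n) x := hψ.differentiable one_ne_zero x
      set δ := fderiv ℝ (flatIter b γ ψ₀ n) x + (b (flatIter b γ ψ₀ n x)).comp (γ x) with hδ
      have h2 : fderiv ℝ (fun x ↦ (b (flatIter b γ ψ₀ n x)).comp (γ x)) x u v
          - fderiv ℝ (fun x ↦ (b (flatIter b γ ψ₀ n x)).comp (γ x)) x v u
          = b (δ u) (γ x v) - b (δ v) (γ x u) := by
        have h3 := hflat x hx u v (flatIter b γ ψ₀ n x)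
        rw [systemCurv] at h3
        rw [fderiv_apply_comp hγx hψx, fderiv_apply_comp hγx hψx, hδ]
        simp only [add_apply, ContinuousLinearMap.comp_apply, map_add, map_sub] at h3 ⊢
        rw [← sub_eq_zero, ← h3]
        abel
      rw [h2]
      have h4 (u v : E) : ‖b (δ u) (γ x v)‖ ≤ a * D * ‖u‖ * ‖v‖ := by
        calc ‖b (δ u) (γ x v)‖ ≤ ‖b‖ * (‖δ‖ * ‖u‖) * (‖γ x‖ * ‖v‖) :=
              (b.le_opNorm₂ _ _).trans (by gcongr <;> exact ContinuousLinearMap.le_opNorm _ _)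
          _ = (‖b‖ * ‖γ x‖) * ‖δ‖ * ‖u‖ * ‖v‖ := by ring
          _ ≤ a * D * ‖u‖ * ‖v‖ := by
              gcongr
              · exact hγ' x hx
              · exact ih hx
      refine (norm_sub_le _ _).trans ?_
      have h5 := h4 u v
      have h6 := h4 v u
      linarith

/-- A flat linear system `dψ + b(ψ, γ) = 0` can be solved near `0` for every initial value. -/
theorem exists_parallel_of_flat (hγ : ContDiff ℝ 1 γ) {R : ℝ}
    (hR : 0 < R) (hflat : ∀ x ∈ Metric.ball (0 : E) R, ∀ u v ψ, systemCurv b γ x u v ψ = 0) :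
    ∃ r, 0 < r ∧ r ≤ R ∧ ∀ ψ₀ : F, ∃ ψ : E → F, ψ 0 = ψ₀ ∧
      ∀ y ∈ Metric.ball (0 : E) r, HasFDerivAt ψ (-(b (ψ y)).comp (γ y)) y := by
  obtain ⟨a, ha⟩ := (isCompact_closedBall (0 : E) R).exists_bound_of_continuousOn
    (f := fun x ↦ ‖b‖ * ‖γ x‖) (continuous_const.mul hγ.continuous.norm).continuousOn
  replace ha : ∀ x ∈ Metric.closedBall (0 : E) R, ‖b‖ * ‖γ x‖ ≤ a := fun x hx ↦
    (le_abs_self _).trans (ha x hx)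
  have ha0 : 0 ≤ a := (by positivity : 0 ≤ ‖b‖ * ‖γ 0‖).trans
    (ha 0 (Metric.mem_closedBall_self hR.le))
  set r := min R (1 / (8 * (a + 1))) with hr
  have hrR : r ≤ R := min_le_left _ _
  have hr0 : 0 < r := lt_min hR (by positivity)
  have har : a * r ≤ 1 / 8 := by
    have h1 : a * r ≤ (a + 1) * (1 / (8 * (a + 1))) := by
      refine mul_le_mul (by linarith) (min_le_right _ _) hr0.le (by positivity)
    have h2 : (a + 1) * (1 / (8 * (a + 1))) = 1 / 8 := by field_simp
    linarith
  have hγ' : ∀ x ∈ Metric.ball (0 : E) r, ‖b‖ * ‖γ x‖ ≤ a := fun x hx ↦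
    ha x (Metric.ball_subset_closedBall (Metric.ball_subset_ball hrR hx))
  have hflat' : ∀ x ∈ Metric.ball (0 : E) r, ∀ u v ψ, systemCurv b γ x u v ψ = 0 := fun x hx ↦
    hflat x (Metric.ball_subset_ball hrR hx)
  refine ⟨r, hr0, hrR, fun ψ₀ ↦ ?_⟩
  have hdist : ∀ y ∈ Metric.ball (0 : E) r, ∀ n,
      dist (flatIter b γ ψ₀ n y) (flatIter b γ ψ₀ (n + 1) y) ≤ ‖ψ₀‖ * (1 / 2) ^ n := by
    intro y hy n
    rw [dist_eq_norm, norm_sub_rev]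
    exact norm_flatIter_sub_le hγ ψ₀ ha0 hγ' har n hy
  have hlim : ∀ y ∈ Metric.ball (0 : E) r,
      ∃ z, Tendsto (fun n ↦ flatIter b γ ψ₀ n y) atTop (𝓝 z) := fun y hy ↦
    cauchySeq_tendsto_of_complete
      (cauchySeq_of_le_geometric (1 / 2) ‖ψ₀‖ (by norm_num) (hdist y hy))
  choose! ψ hψ using hlim
  refine ⟨ψ, ?_, fun y hy ↦ ?_⟩
  · have h0 (n : ℕ) : flatIter b γ ψ₀ n 0 = ψ₀ := by
      cases n <;> simp [flatIter, radialIntegral]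
    have h1 := hψ 0 (Metric.mem_ball_self hr0)
    simp only [h0] at h1
    exact tendsto_nhds_unique h1 tendsto_const_nhds
  · refine hasFDerivAt_of_tendstoUniformlyOn (𝕜 := ℝ) (l := atTop) (f := flatIter b γ ψ₀)
      (f' := fun n ↦ fderiv ℝ (flatIter b γ ψ₀ n)) (g := ψ) (g' := fun y ↦ -(b (ψ y)).comp (γ y))
      Metric.isOpen_ball ?_ (fun n x _ ↦
        ((contDiff_flatIter hγ ψ₀ n).differentiable one_ne_zero x).hasFDerivAt) hψ hy
    have hb : ∀ n, ∀ x ∈ Metric.ball (0 : E) r,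
        ‖-(b (ψ x)).comp (γ x) - fderiv ℝ (flatIter b γ ψ₀ n) x‖
          ≤ 6 * a * ‖ψ₀‖ * (1 / 2) ^ n := by
      intro n x hx
      have h1 := dist_le_of_le_geometric_of_tendsto (1 / 2) ‖ψ₀‖ (by norm_num) (hdist x hx)
        (hψ x hx) n
      rw [dist_eq_norm] at h1
      have h2 : -(b (ψ x)).comp (γ x) - fderiv ℝ (flatIter b γ ψ₀ n) x
          = (b (flatIter b γ ψ₀ n x - ψ x)).comp (γ x)
            - (fderiv ℝ (flatIter b γ ψ₀ n) x + (b (flatIter b γ ψ₀ n x)).comp (γ x)) := by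
        rw [map_sub, ContinuousLinearMap.sub_comp]
        abel
      rw [h2]
      refine (norm_sub_le _ _).trans ?_
      have h3 := norm_fderiv_flatIter_add_le hγ ψ₀ ha0 hγ' har hflat' n hx
      have h4 : ‖(b (flatIter b γ ψ₀ n x - ψ x)).comp (γ x)‖
          ≤ a * (‖ψ₀‖ * (1 / 2) ^ n / (1 - 1 / 2)) :=
        (norm_apply_comp_le _ _).trans (mul_le_mul (hγ' x hx) h1 (norm_nonneg _) ha0)
      have h5 : a * (‖ψ₀‖ * (1 / 2) ^ n / (1 - 1 / 2)) = 2 * a * ‖ψ₀‖ * (1 / 2) ^ n := by ring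
      linarith
    have hlim : Tendsto (fun n : ℕ ↦ 6 * a * ‖ψ₀‖ * (1 / 2 : ℝ) ^ n) atTop (𝓝 0) := by
      simpa using (tendsto_pow_atTop_nhds_zero_of_lt_one (r := (1 / 2 : ℝ)) (by norm_num)
        (by norm_num)).const_mul (6 * a * ‖ψ₀‖)
    rw [Metric.tendstoUniformlyOn_iff]
    intro ε hε
    filter_upwards [hlim.eventually_lt_const hε] with n hn x hx
    rw [dist_eq_norm]
    exact (hb n x hx).trans_lt hn

end FlatSystems

/-! ### 1-forms in charts and the exterior derivative -/

section Charts

open Filter Topology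

variable {E : Type*} [NormedAddCommGroup E] [NormedSpace ℝ E]
  {M : Type*} [TopologicalSpace M] [ChartedSpace E M]

/-- The pull-back of the 1-form `α` by the inverse of the preferred chart at `x₀`. For the model space
`E5` this is `formInChart`. -/
def chartForm (α : ∀ x : M, TangentSpace 𝓘(ℝ, E) x →L[ℝ] ℝ) (x₀ : M) : E → E →L[ℝ] ℝ := fun y ↦
  (α ((extChartAt 𝓘(ℝ, E) x₀).symm y)).comp
    (mfderiv 𝓘(ℝ, E) 𝓘(ℝ, E) (extChartAt 𝓘(ℝ, E) x₀).symm y)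

theorem isOpen_target_inter_preimage {U : Set M} (hU : IsOpen U) (x₀ : M) :
    IsOpen ((extChartAt 𝓘(ℝ, E) x₀).target ∩ (extChartAt 𝓘(ℝ, E) x₀).symm ⁻¹' U) :=
  (continuousOn_extChartAt_symm x₀).isOpen_inter_preimage (isOpen_extChartAt_target x₀) hU

variable [IsManifold 𝓘(ℝ, E) ∞ M]

section Along

variable {EN HN N : Type*} [NormedAddCommGroup EN] [NormedSpace ℝ EN] [TopologicalSpace HN]
  {IN : ModelWithCorners ℝ EN HN} [TopologicalSpace N] [ChartedSpace HN N]

theorem contMDiffWithinAt_oneForm_apply {α : ∀ x : M, TangentSpace 𝓘(ℝ, E) x →L[ℝ] ℝ} {U : Set M}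
    (hα : ContMDiffOn 𝓘(ℝ, E) (𝓘(ℝ, E).prod 𝓘(ℝ, E →L[ℝ] ℝ)) ∞ (fun x ↦
      TotalSpace.mk' (E →L[ℝ] ℝ) (E := fun x : M ↦ TangentSpace 𝓘(ℝ, E) x →L[ℝ] ℝ) x (α x)) U)
    (hU : IsOpen U) {f : N → M} {V : ∀ y, TangentSpace 𝓘(ℝ, E) (f y)} {s : Set N} {y : N}
    (hy : f y ∈ U) (hV : ContMDiffWithinAt IN 𝓘(ℝ, E).tangent ∞
      (fun y ↦ (⟨f y, V y⟩ : TangentBundle 𝓘(ℝ, E) M)) s y) :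
    ContMDiffWithinAt IN 𝓘(ℝ, ℝ) ∞ (fun y ↦ α (f y) (V y)) s y := by
  have hf : ContMDiffWithinAt IN 𝓘(ℝ, E) ∞ f s y :=
    (contMDiff_proj (TangentSpace 𝓘(ℝ, E) : M → Type _)).contMDiffAt.comp_contMDiffWithinAt y hV
  have h1 : ContMDiffWithinAt IN (𝓘(ℝ, E).prod 𝓘(ℝ, E →L[ℝ] ℝ)) ∞ (fun y ↦
      TotalSpace.mk' (E →L[ℝ] ℝ) (E := fun x : M ↦ TangentSpace 𝓘(ℝ, E) x →L[ℝ] ℝ) (f y)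
        (α (f y))) s y :=
    (hα.contMDiffAt (hU.mem_nhds hy)).comp_contMDiffWithinAt y hf
  have h2 := ContMDiffWithinAt.clm_bundle_apply (F₂ := ℝ) (E₂ := fun _ : M ↦ ℝ) h1 hV
  rw [contMDiffWithinAt_totalSpace] at h2
  exact h2.2

end Along

theorem contMDiffOn_mfderiv_extChartAt_symm (x₀ : M) (w : E) :
    ContMDiffOn 𝓘(ℝ, E) 𝓘(ℝ, E).tangent ∞ (fun y ↦ (⟨(extChartAt 𝓘(ℝ, E) x₀).symm y,
      mfderiv 𝓘(ℝ, E) 𝓘(ℝ, E) (extChartAt 𝓘(ℝ, E) x₀).symm y w⟩ : TangentBundle 𝓘(ℝ, E) M))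
      (extChartAt 𝓘(ℝ, E) x₀).target := by
  have ho := isOpen_extChartAt_target (I := 𝓘(ℝ, E)) x₀
  have h1 := (contMDiffOn_extChartAt_symm (I := 𝓘(ℝ, E)) (n := ∞) x₀).contMDiffOn_tangentMapWithin
    (m := ∞) (by simp) ho.uniqueMDiffOn
  have h2 : ContMDiff 𝓘(ℝ, E) (𝓘(ℝ, E)).tangent ∞
      (fun y : E ↦ (⟨y, w⟩ : TangentBundle 𝓘(ℝ, E) E)) :=
    contMDiff_vectorSpace_iff_contDiff.2 contDiff_const
  refine (h1.comp h2.contMDiffOn (fun y hy ↦ hy)).congr fun y hy ↦ ?_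
  simp only [Function.comp, tangentMapWithin]
  rw [mfderivWithin_of_isOpen ho hy]

theorem contDiffOn_chartForm [FiniteDimensional ℝ E]
    {α : ∀ x : M, TangentSpace 𝓘(ℝ, E) x →L[ℝ] ℝ} {U : Set M}
    (hα : ContMDiffOn 𝓘(ℝ, E) (𝓘(ℝ, E).prod 𝓘(ℝ, E →L[ℝ] ℝ)) ∞ (fun x ↦
      TotalSpace.mk' (E →L[ℝ] ℝ) (E := fun x : M ↦ TangentSpace 𝓘(ℝ, E) x →L[ℝ] ℝ) x (α x)) U)
    (hU : IsOpen U) (x₀ : M) : ContDiffOn ℝ ∞ (chartForm α x₀)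
      ((extChartAt 𝓘(ℝ, E) x₀).target ∩ (extChartAt 𝓘(ℝ, E) x₀).symm ⁻¹' U) := by
  rw [contDiffOn_clm_apply]
  intro w
  rw [← contMDiffOn_iff_contDiffOn]
  intro y hy
  exact contMDiffWithinAt_oneForm_apply hα hU
    (V := fun y ↦ mfderiv 𝓘(ℝ, E) 𝓘(ℝ, E) (extChartAt 𝓘(ℝ, E) x₀).symm y w) hy.2
    ((contMDiffOn_mfderiv_extChartAt_symm x₀ w y hy.1).mono inter_subset_left)

theorem mdifferentiableAt_extChartAt_symm {x₀ : M} {y : E}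
    (hy : y ∈ (extChartAt 𝓘(ℝ, E) x₀).target) :
    MDifferentiableAt 𝓘(ℝ, E) 𝓘(ℝ, E) (extChartAt 𝓘(ℝ, E) x₀).symm y :=
  (mdifferentiableWithinAt_extChartAt_symm hy).mdifferentiableAt (by simp)

theorem mfderiv_extChartAt_symm_apply {x₀ x : M} (hx : x ∈ (extChartAt 𝓘(ℝ, E) x₀).source)
    (v : TangentSpace 𝓘(ℝ, E) x) :
    mfderiv 𝓘(ℝ, E) 𝓘(ℝ, E) (extChartAt 𝓘(ℝ, E) x₀).symm (extChartAt 𝓘(ℝ, E) x₀ x)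
      (mfderiv 𝓘(ℝ, E) 𝓘(ℝ, E) (extChartAt 𝓘(ℝ, E) x₀) x v) = v := by
  have h := mfderivWithin_extChartAt_symm_comp_mfderiv_extChartAt' (I := 𝓘(ℝ, E)) hx
  simp only [modelWithCornersSelf_coe, range_id, mfderivWithin_univ] at h
  exact congrArg (fun T ↦ T v) h

theorem chartForm_apply {α : ∀ x : M, TangentSpace 𝓘(ℝ, E) x →L[ℝ] ℝ} {x₀ x : M}
    (hx : x ∈ (extChartAt 𝓘(ℝ, E) x₀).source) (v : TangentSpace 𝓘(ℝ, E) x) :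
    chartForm α x₀ (extChartAt 𝓘(ℝ, E) x₀ x) (mfderiv 𝓘(ℝ, E) 𝓘(ℝ, E) (extChartAt 𝓘(ℝ, E) x₀) x v)
      = α x v := by
  -- all tangent spaces are the model space `E`, so `v` can be viewed as a vector at `x'`
  have key : ∀ x' : M, x' = x → α x' (show E from v) = α x v := by
    rintro _ rfl
    rfl
  rw [← key _ ((extChartAt 𝓘(ℝ, E) x₀).left_inv hx)]
  exact congrArg (α _) (mfderiv_extChartAt_symm_apply hx v)

theorem mfderiv_extChartAt_symm_apply' {x₀ : M} {y : E} (hy : y ∈ (extChartAt 𝓘(ℝ, E) x₀).target)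
    (v : TangentSpace 𝓘(ℝ, E) ((extChartAt 𝓘(ℝ, E) x₀).symm y)) :
    mfderiv 𝓘(ℝ, E) 𝓘(ℝ, E) (extChartAt 𝓘(ℝ, E) x₀).symm y
      (mfderiv 𝓘(ℝ, E) 𝓘(ℝ, E) (extChartAt 𝓘(ℝ, E) x₀) ((extChartAt 𝓘(ℝ, E) x₀).symm y) v) = v := by
  have h := mfderivWithin_extChartAt_symm_comp_mfderiv_extChartAt (I := 𝓘(ℝ, E)) hy
  simp only [modelWithCornersSelf_coe, range_id, mfderivWithin_univ] at h
  exact congrArg (fun T ↦ T v) h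

theorem hasFDerivAt_comp_extChartAt_symm {F : Type*} [NormedAddCommGroup F] [NormedSpace ℝ F]
    {f : M → F} {x₀ : M} {y : E} (hy : y ∈ (extChartAt 𝓘(ℝ, E) x₀).target)
    (hf : MDifferentiableAt 𝓘(ℝ, E) 𝓘(ℝ, F) f ((extChartAt 𝓘(ℝ, E) x₀).symm y)) :
    HasFDerivAt (f ∘ (extChartAt 𝓘(ℝ, E) x₀).symm)
      ((mvfderiv 𝓘(ℝ, E) f ((extChartAt 𝓘(ℝ, E) x₀).symm y)).comp
        (mfderiv 𝓘(ℝ, E) 𝓘(ℝ, E) (extChartAt 𝓘(ℝ, E) x₀).symm y)) y :=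
  hasMFDerivAt_iff_hasFDerivAt.1
    (hf.hasMFDerivAt.comp y (mdifferentiableAt_extChartAt_symm hy).hasMFDerivAt)

/-- The exterior derivative of a 1-form `η` on a normed space. -/
def exteriorDeriv (η : E → E →L[ℝ] ℝ) (y u v : E) : ℝ := fderiv ℝ η y u v - fderiv ℝ η y v u

/-- The exterior derivative commutes with pull-backs: the terms with the second derivative of `T`
cancel by symmetry. -/
theorem exteriorDeriv_pullback {η β : E → E →L[ℝ] ℝ} {T : E → E} {y : E}
    (hT : ContDiffAt ℝ 2 T y) (hη : DifferentiableAt ℝ η (T y))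
    (h : β =ᶠ[𝓝 y] fun z ↦ (η (T z)).comp (fderiv ℝ T z)) (u v : E) :
    exteriorDeriv β y u v = exteriorDeriv η (T y) (fderiv ℝ T y u) (fderiv ℝ T y v) := by
  have h1 : HasFDerivAt (fun z ↦ η (T z)) ((fderiv ℝ η (T y)).comp (fderiv ℝ T y)) y :=
    hη.hasFDerivAt.comp y (hT.differentiableAt (by simp)).hasFDerivAt
  have h2 : HasFDerivAt (fderiv ℝ T) (fderiv ℝ (fderiv ℝ T) y) y :=
    ((hT.fderiv_right (m := 1) (by norm_num)).differentiableAt (by simp)).hasFDerivAt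
  have h3 := (h1.clm_comp h2).congr_of_eventuallyEq h
  have hs : fderiv ℝ (fderiv ℝ T) y u v = fderiv ℝ (fderiv ℝ T) y v u :=
    (hT.isSymmSndFDerivAt (by simp)) u v
  simp [exteriorDeriv, h3.fderiv, hs]

/-- Independence of the exterior derivative of the chart. -/
theorem exteriorDeriv_chartForm [FiniteDimensional ℝ E]
    {α : ∀ x : M, TangentSpace 𝓘(ℝ, E) x →L[ℝ] ℝ} {U : Set M}
    (hα : ContMDiffOn 𝓘(ℝ, E) (𝓘(ℝ, E).prod 𝓘(ℝ, E →L[ℝ] ℝ)) ∞ (fun x ↦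
      TotalSpace.mk' (E →L[ℝ] ℝ) (E := fun x : M ↦ TangentSpace 𝓘(ℝ, E) x →L[ℝ] ℝ) x (α x)) U)
    (hU : IsOpen U) {x₀ x₁ : M} {y : E} (hy : y ∈ (extChartAt 𝓘(ℝ, E) x₀).target)
    (hyU : (extChartAt 𝓘(ℝ, E) x₀).symm y ∈ U)
    (hy₁ : (extChartAt 𝓘(ℝ, E) x₀).symm y ∈ (extChartAt 𝓘(ℝ, E) x₁).source) (u v : E) :
    exteriorDeriv (chartForm α x₀) y u v = exteriorDeriv (chartForm α x₁)
      (extChartAt 𝓘(ℝ, E) x₁ ((extChartAt 𝓘(ℝ, E) x₀).symm y))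
      (mfderiv 𝓘(ℝ, E) 𝓘(ℝ, E) (extChartAt 𝓘(ℝ, E) x₁) ((extChartAt 𝓘(ℝ, E) x₀).symm y)
        (mfderiv 𝓘(ℝ, E) 𝓘(ℝ, E) (extChartAt 𝓘(ℝ, E) x₀).symm y u))
      (mfderiv 𝓘(ℝ, E) 𝓘(ℝ, E) (extChartAt 𝓘(ℝ, E) x₁) ((extChartAt 𝓘(ℝ, E) x₀).symm y)
        (mfderiv 𝓘(ℝ, E) 𝓘(ℝ, E) (extChartAt 𝓘(ℝ, E) x₀).symm y v)) := by
  set φ := extChartAt 𝓘(ℝ, E) x₀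
  set ψ := extChartAt 𝓘(ℝ, E) x₁
  have hT : ∀ z ∈ φ.target, φ.symm z ∈ ψ.source → ∀ w, fderiv ℝ (fun z ↦ ψ (φ.symm z)) z w
      = mfderiv 𝓘(ℝ, E) 𝓘(ℝ, E) ψ (φ.symm z) (mfderiv 𝓘(ℝ, E) 𝓘(ℝ, E) φ.symm z w) := by
    intro z hz hz₁ w
    obtain ⟨D, hD, hDw⟩ : ∃ D : E →L[ℝ] E, HasFDerivAt (fun z ↦ ψ (φ.symm z)) D z ∧
        ∀ w, D w = mfderiv 𝓘(ℝ, E) 𝓘(ℝ, E) ψ (φ.symm z) (mfderiv 𝓘(ℝ, E) 𝓘(ℝ, E) φ.symm z w) :=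
      ⟨_, hasFDerivAt_comp_extChartAt_symm (F := E) (f := ψ) hz (mdifferentiableAt_extChartAt
        (I := 𝓘(ℝ, E)) (by rwa [← extChartAt_source 𝓘(ℝ, E)])), fun w ↦ rfl⟩
    rw [hD.fderiv, hDw]
  have hev : ∀ᶠ z in 𝓝 y, z ∈ φ.target ∧ φ.symm z ∈ ψ.source :=
    (isOpen_target_inter_preimage (isOpen_extChartAt_source (I := 𝓘(ℝ, E)) x₁) x₀).mem_nhds
      ⟨hy, hy₁⟩
  have hT2 : ContDiffAt ℝ 2 (fun z ↦ ψ (φ.symm z)) y := by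
    rw [← contMDiffAt_iff_contDiffAt]
    have ha : ContMDiffAt 𝓘(ℝ, E) 𝓘(ℝ, E) 2 φ.symm y :=
      ((contMDiffOn_extChartAt_symm (I := 𝓘(ℝ, E)) (n := ∞) x₀).contMDiffAt
        ((isOpen_extChartAt_target x₀).mem_nhds hy)).of_le (WithTop.coe_le_coe.2 (le_top : (2 : ℕ∞) ≤ ⊤))
    have hb : ContMDiffAt 𝓘(ℝ, E) 𝓘(ℝ, E) 2 ψ (φ.symm y) :=
      (contMDiffAt_extChartAt' (I := 𝓘(ℝ, E)) (n := ∞) (by rwa [← extChartAt_source 𝓘(ℝ, E)])).of_le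
        (WithTop.coe_le_coe.2 (le_top : (2 : ℕ∞) ≤ ⊤))
    exact hb.comp y ha
  have hη : DifferentiableAt ℝ (chartForm α x₁) (ψ (φ.symm y)) := by
    refine ((contDiffOn_chartForm hα hU x₁).contDiffAt
      ((isOpen_target_inter_preimage hU x₁).mem_nhds ⟨ψ.map_source hy₁, ?_⟩)).differentiableAt
        (by simp)
    change ψ.symm (ψ (φ.symm y)) ∈ U
    rwa [ψ.left_inv hy₁]
  have h := exteriorDeriv_pullback (η := chartForm α x₁) (β := chartForm α x₀) hT2 hη ?_ u v
  · rw [h, hT y hy hy₁, hT y hy hy₁]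
  · filter_upwards [hev] with z hz
    ext w
    rw [ContinuousLinearMap.comp_apply, hT z hz.1 hz.2]
    exact (chartForm_apply (α := α) hz.2 (mfderiv 𝓘(ℝ, E) 𝓘(ℝ, E) φ.symm z w)).symm

end Charts

/-! ### Chart coordinates -/

section ChartCoordinates

open Filter Topology

variable {E : Type*} [NormedAddCommGroup E] [NormedSpace ℝ E]
  {M : Type*} [TopologicalSpace M] [ChartedSpace E M]

/-- The inverse of the preferred chart at `x₀`. -/
def invChart (x₀ : M) : E → M := (extChartAt 𝓘(ℝ, E) x₀).symm

/-- The differential of the inverse of the preferred chart at `x₀`. -/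
def invChartDeriv (x₀ : M) (y : E) : E →L[ℝ] TangentSpace 𝓘(ℝ, E) (invChart x₀ y) :=
  mfderiv 𝓘(ℝ, E) 𝓘(ℝ, E) (extChartAt 𝓘(ℝ, E) x₀).symm y

/-- The part of the preferred chart at `x₀` which corresponds to the set `U`. -/
def chartDomain (x₀ : M) (U : Set M) : Set E :=
  (extChartAt 𝓘(ℝ, E) x₀).target ∩ invChart x₀ ⁻¹' U

theorem isOpen_chartDomain (x₀ : M) {U : Set M} (hU : IsOpen U) :
    IsOpen (chartDomain (E := E) x₀ U) :=
  isOpen_target_inter_preimage hU x₀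

theorem exists_invChart_eq {x₀ x : M} (hx : x ∈ (extChartAt 𝓘(ℝ, E) x₀).source) :
    ∃ y ∈ (extChartAt 𝓘(ℝ, E) x₀).target, invChart x₀ y = x :=
  ⟨_, (extChartAt 𝓘(ℝ, E) x₀).map_source hx, (extChartAt 𝓘(ℝ, E) x₀).left_inv hx⟩

/-- The vector field whose expression in the preferred chart at `x₀` is the constant `w`. -/
def constVectorField (x₀ : M) (w : E) (x : M) : TangentSpace 𝓘(ℝ, E) x :=
  show E from invChartDeriv x₀ (extChartAt 𝓘(ℝ, E) x₀ x) w

theorem constVectorField_invChart {x₀ : M} {y : E} (hy : y ∈ (extChartAt 𝓘(ℝ, E) x₀).target)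
    (w : E) : constVectorField x₀ w (invChart x₀ y) = invChartDeriv x₀ y w := by
  have key : ∀ y' : E, y' = y → (show E from invChartDeriv x₀ y' w) = invChartDeriv x₀ y w := by
    rintro _ rfl
    rfl
  exact key _ ((extChartAt 𝓘(ℝ, E) x₀).right_inv hy)

theorem chartForm_sum {κ : Type*} [Fintype κ] (r : κ → ℝ)
    (α : κ → ∀ x : M, TangentSpace 𝓘(ℝ, E) x →L[ℝ] ℝ) (x₀ : M) :
    chartForm (fun x ↦ ∑ k, r k • α k x) x₀ = fun y ↦ ∑ k, r k • chartForm (α k) x₀ y := by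
  funext y
  refine (ContinuousLinearMap.finsetSum_comp _ _).trans (Finset.sum_congr rfl fun k _ ↦ ?_)
  exact ContinuousLinearMap.smul_comp _ _ _

theorem exteriorDeriv_sum {κ : Type*} [Fintype κ] (r : κ → ℝ) {η : κ → E → E →L[ℝ] ℝ} {y : E}
    (hη : ∀ k, DifferentiableAt ℝ (η k) y) (u v : E) :
    exteriorDeriv (fun y ↦ ∑ k, r k • η k y) y u v = ∑ k, r k * exteriorDeriv (η k) y u v := by
  have h : HasFDerivAt (fun y ↦ ∑ k, r k • η k y) (∑ k, r k • fderiv ℝ (η k) y) y :=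
    HasFDerivAt.fun_sum fun k _ ↦ (hη k).hasFDerivAt.const_smul (r k)
  simp only [exteriorDeriv, h.fderiv, sum_apply, smul_apply, smul_eq_mul,
    mul_sub, Finset.sum_sub_distrib]

variable [IsManifold 𝓘(ℝ, E) ∞ M]

theorem invChartDeriv_surjective {x₀ : M} {y : E} (hy : y ∈ (extChartAt 𝓘(ℝ, E) x₀).target) :
    Function.Surjective (invChartDeriv x₀ y) :=
  fun v ↦ ⟨_, mfderiv_extChartAt_symm_apply' hy v⟩

theorem invChartDeriv_injective {x₀ : M} {y : E} (hy : y ∈ (extChartAt 𝓘(ℝ, E) x₀).target) :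
    Function.Injective (invChartDeriv x₀ y) := by
  refine Function.LeftInverse.injective (g := mfderiv 𝓘(ℝ, E) 𝓘(ℝ, E) (extChartAt 𝓘(ℝ, E) x₀)
    (invChart x₀ y)) fun w ↦ ?_
  have h := mfderiv_extChartAt_comp_mfderivWithin_extChartAt_symm (I := 𝓘(ℝ, E)) hy
  simp only [modelWithCornersSelf_coe, range_id, mfderivWithin_univ] at h
  exact congrArg (fun T ↦ T w) h

theorem hasFDerivAt_comp_invChart {F : Type*} [NormedAddCommGroup F] [NormedSpace ℝ F]
    {f : M → F} {x₀ : M} {y : E} (hy : y ∈ (extChartAt 𝓘(ℝ, E) x₀).target)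
    (hf : MDifferentiableAt 𝓘(ℝ, E) 𝓘(ℝ, F) f (invChart x₀ y)) :
    HasFDerivAt (f ∘ invChart x₀)
      ((mvfderiv 𝓘(ℝ, E) f (invChart x₀ y)).comp (invChartDeriv x₀ y)) y :=
  hasFDerivAt_comp_extChartAt_symm hy hf

theorem contMDiffOn_constVectorField (x₀ : M) (w : E) :
    ContMDiffOn 𝓘(ℝ, E) 𝓘(ℝ, E).tangent ∞
      (fun x ↦ (⟨x, constVectorField x₀ w x⟩ : TangentBundle 𝓘(ℝ, E) M))
      (extChartAt 𝓘(ℝ, E) x₀).source := by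
  have h := (contMDiffOn_mfderiv_extChartAt_symm x₀ w).comp
    (contMDiffOn_extChartAt (I := 𝓘(ℝ, E)) (n := ∞) (x := x₀)) (fun x hx ↦ by
      rw [← extChartAt_source 𝓘(ℝ, E)] at hx
      exact (extChartAt 𝓘(ℝ, E) x₀).map_source hx)
  rw [← extChartAt_source 𝓘(ℝ, E)] at h
  refine h.congr fun x hx ↦ ?_
  -- the vector of the model space `E` that represents the tangent vector is the same at both points
  have key : ∀ (x' : M) (v : E), x' = x →
      (⟨x, v⟩ : TangentBundle 𝓘(ℝ, E) M) = ⟨x', v⟩ := by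
    rintro _ v rfl
    rfl
  exact key _ _ ((extChartAt 𝓘(ℝ, E) x₀).left_inv hx)

theorem contMDiffOn_comp_invChart {F : Type*} [NormedAddCommGroup F] [NormedSpace ℝ F]
    {f : M → F} {U : Set M} (hf : ContMDiffOn 𝓘(ℝ, E) 𝓘(ℝ, F) ∞ f U) (x₀ : M) :
    ContDiffOn ℝ ∞ (f ∘ invChart x₀) (chartDomain (E := E) x₀ U) := by
  rw [← contMDiffOn_iff_contDiffOn]
  exact hf.comp ((contMDiffOn_extChartAt_symm x₀).mono inter_subset_left) fun y hy ↦ hy.2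

end ChartCoordinates

section FiveManifold

variable {M : Type*} [TopologicalSpace M] [ChartedSpace E5 M] [IsManifold (𝓡 5) ∞ M]

/-- The exterior derivative at `x`, which is defined through the preferred chart at `x`, can be
computed in the preferred chart at any other point. -/
theorem extDer_invChartDeriv {α : OneForm M} {U : Set M} (hα : SmoothOn α U) (hU : IsOpen U)
    {x₀ : M} {y : E5} (hy : y ∈ chartDomain x₀ U) (u v : E5) :
    extDer α (invChart x₀ y) (invChartDeriv x₀ y u) (invChartDeriv x₀ y v)
      = exteriorDeriv (chartForm α x₀) y u v :=
  (exteriorDeriv_chartForm (E := E5) (x₁ := invChart x₀ y) hα hU hy.1 hy.2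
    (mem_extChartAt_source _) u v).symm

end FiveManifold

/-! ### Adapted coframes and connections in a chart -/

section Coframes

open Filter Topology

variable {M : Type*} [TopologicalSpace M] [ChartedSpace E5 M] [IsManifold (𝓡 5) ∞ M]
  {G : SO3Structure M}

/-- The expression `y ↦ (θ¹, …, θ⁵)` of an adapted coframe in the preferred chart at `x₀`. -/
def AdaptedCoframe.inChart (c : AdaptedCoframe G) (x₀ : M) (y : E5) : E5 →L[ℝ] (Fin 5 → ℝ) :=
  ContinuousLinearMap.pi fun i ↦ chartForm (E := E5) (c.θ i) x₀ y

/-- The expression `y ↦ (γ¹, γ², γ³)` of the connection form in an adapted coframe in the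
preferred chart at `x₀`. -/
def SO3Connection.inChart (Γ : SO3Connection G) (c : AdaptedCoframe G) (x₀ : M) (y : E5) :
    E5 →L[ℝ] (Fin 3 → ℝ) :=
  ContinuousLinearMap.pi fun I ↦ chartForm (E := E5) (Γ.γ c I) x₀ y

/-- The part of the preferred chart at `x₀` which corresponds to the domain of the coframe. -/
def AdaptedCoframe.chartDomain (c : AdaptedCoframe G) (x₀ : M) : Set E5 :=
  IrreducibleSO3.chartDomain x₀ c.U

theorem AdaptedCoframe.isOpen_chartDomain (c : AdaptedCoframe G) (x₀ : M) :
    IsOpen (c.chartDomain x₀) :=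
  IrreducibleSO3.isOpen_chartDomain x₀ c.U.isOpen

theorem contDiffOn_clm_pi {ι : Type*} [Fintype ι] {f : ι → E5 → E5 →L[ℝ] ℝ} {s : Set E5}
    (hf : ∀ i, ContDiffOn ℝ ∞ (f i) s) :
    ContDiffOn ℝ ∞ (fun y ↦ ContinuousLinearMap.pi fun i ↦ f i y) s := by
  rw [contDiffOn_clm_apply]
  intro w
  rw [contDiffOn_pi]
  intro i
  exact (hf i).clm_apply contDiffOn_const

theorem AdaptedCoframe.contDiffOn_inChart (c : AdaptedCoframe G) (x₀ : M) :
    ContDiffOn ℝ ∞ (c.inChart x₀) (c.chartDomain x₀) :=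
  contDiffOn_clm_pi fun i ↦ contDiffOn_chartForm (E := E5) (c.smoothOn i) c.U.isOpen x₀

theorem SO3Connection.contDiffOn_inChart (Γ : SO3Connection G) (c : AdaptedCoframe G) (x₀ : M) :
    ContDiffOn ℝ ∞ (Γ.inChart c x₀) (c.chartDomain x₀) :=
  contDiffOn_clm_pi fun I ↦ contDiffOn_chartForm (E := E5) (Γ.smoothOn c I) c.U.isOpen x₀

theorem AdaptedCoframe.differentiableAt_inChart (c : AdaptedCoframe G) {x₀ : M} {y : E5}
    (hy : y ∈ c.chartDomain x₀) : DifferentiableAt ℝ (c.inChart x₀) y :=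
  ((c.contDiffOn_inChart x₀).contDiffAt ((c.isOpen_chartDomain x₀).mem_nhds hy)).differentiableAt
    (by simp)

theorem SO3Connection.differentiableAt_inChart (Γ : SO3Connection G) (c : AdaptedCoframe G)
    {x₀ : M} {y : E5} (hy : y ∈ c.chartDomain x₀) : DifferentiableAt ℝ (Γ.inChart c x₀) y :=
  ((Γ.contDiffOn_inChart c x₀).contDiffAt ((c.isOpen_chartDomain x₀).mem_nhds hy)).differentiableAt
    (by simp)

/-- An adapted coframe is pointwise a linear isomorphism, because the metric is definite. -/
theorem AdaptedCoframe.bijective_inChart (c : AdaptedCoframe G) {x₀ : M} {y : E5}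
    (hy : y ∈ c.chartDomain x₀) : Function.Bijective (c.inChart x₀ y) := by
  have hinj : Function.Injective (c.inChart x₀ y) := by
    rw [injective_iff_map_eq_zero]
    intro w hw
    by_contra hw0
    have h1 : invChartDeriv x₀ y w ≠ 0 := fun h ↦
      hw0 ((map_eq_zero_iff _ (invChartDeriv_injective hy.1)).1 h)
    have h2 := G.g.pos _ _ h1
    have h3 : ∀ i, c.θ i (invChart x₀ y) (invChartDeriv x₀ y w) = 0 := fun i ↦ congrFun hw i
    rw [c.metric_eq _ hy.2] at h2
    simp [h3] at h2
  refine ⟨hinj, ?_⟩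
  exact (LinearMap.injective_iff_surjective_of_finrank_eq_finrank
    (f := (c.inChart x₀ y : E5 →ₗ[ℝ] Fin 5 → ℝ)) (by simp)).1 hinj

/-- The curvature `κ = dγ + γ × γ` of the connection as an `ℝ³`-valued 2-form in the preferred
chart at `x₀`. -/
def SO3Connection.curvInChart (Γ : SO3Connection G) (c : AdaptedCoframe G) (x₀ : M) (y u v : E5) :
    Fin 3 → ℝ :=
  fderiv ℝ (Γ.inChart c x₀) y u v - fderiv ℝ (Γ.inChart c x₀) y v u
    + Γ.inChart c x₀ y u ⨯₃ Γ.inChart c x₀ y v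

theorem SO3Connection.fderiv_inChart_apply (Γ : SO3Connection G) (c : AdaptedCoframe G)
    {x₀ : M} {y : E5} (hy : y ∈ c.chartDomain x₀) (u v : E5) (I : Fin 3) :
    fderiv ℝ (Γ.inChart c x₀) y u v I = fderiv ℝ (chartForm (E := E5) (Γ.γ c I) x₀) y u v := by
  have h1 := (Γ.differentiableAt_inChart c hy).hasFDerivAt
  have h2 : HasFDerivAt (chartForm (E := E5) (Γ.γ c I) x₀)
      (((ContinuousLinearMap.compL ℝ E5 (Fin 3 → ℝ) ℝ
        (ContinuousLinearMap.proj I)).comp (fderiv ℝ (Γ.inChart c x₀) y))) y :=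
    (ContinuousLinearMap.compL ℝ E5 (Fin 3 → ℝ) ℝ (ContinuousLinearMap.proj I)).hasFDerivAt.comp y h1
  rw [h2.fderiv]
  rfl

theorem AdaptedCoframe.fderiv_inChart_apply (c : AdaptedCoframe G)
    {x₀ : M} {y : E5} (hy : y ∈ c.chartDomain x₀) (u v : E5) (i : Fin 5) :
    fderiv ℝ (c.inChart x₀) y u v i = fderiv ℝ (chartForm (E := E5) (c.θ i) x₀) y u v := by
  have h1 := (c.differentiableAt_inChart hy).hasFDerivAt
  have h2 : HasFDerivAt (chartForm (E := E5) (c.θ i) x₀)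
      (((ContinuousLinearMap.compL ℝ E5 (Fin 5 → ℝ) ℝ
        (ContinuousLinearMap.proj i)).comp (fderiv ℝ (c.inChart x₀) y))) y :=
    (ContinuousLinearMap.compL ℝ E5 (Fin 5 → ℝ) ℝ (ContinuousLinearMap.proj i)).hasFDerivAt.comp y h1
  rw [h2.fderiv]
  rfl

theorem SO3Connection.extDer_form (Γ : SO3Connection G) (c : AdaptedCoframe G) {x : M}
    (hx : x ∈ c.U) (i j : Fin 5) (v₁ v₂ : TangentSpace (𝓡 5) x) :
    extDer (Γ.form c i j) x v₁ v₂ = ∑ I, soBasis I i j * extDer (Γ.γ c I) x v₁ v₂ := by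
  have hd : ∀ I, DifferentiableAt ℝ (chartForm (E := E5) (Γ.γ c I) x)
      (extChartAt 𝓘(ℝ, E5) x x) := fun I ↦
    ((contDiffOn_chartForm (E := E5) (Γ.smoothOn c I) c.U.isOpen x).contDiffAt
      ((isOpen_chartDomain x c.U.isOpen).mem_nhds ⟨mem_extChartAt_target x, by
        change (extChartAt 𝓘(ℝ, E5) x).symm (extChartAt 𝓘(ℝ, E5) x x) ∈ c.U
        rwa [extChartAt_to_inv]⟩)).differentiableAt (by simp)
  exact (congrArg (fun η ↦ exteriorDeriv (E := E5) η _ _ _)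
    (chartForm_sum (E := E5) (fun I ↦ soBasis I i j) (Γ.γ c) x)).trans
      (exteriorDeriv_sum (fun I ↦ soBasis I i j) hd _ _)

/-- The curvature in the coframe `c` is the `so(3)`-matrix of `κ = dγ + γ × γ`. -/
theorem SO3Connection.curv_invChartDeriv (Γ : SO3Connection G) (c : AdaptedCoframe G)
    {x₀ : M} {y : E5} (hy : y ∈ c.chartDomain x₀) (u v : E5) (i j : Fin 5) :
    Γ.curv c i j (invChart x₀ y) (invChartDeriv x₀ y u) (invChartDeriv x₀ y v)
      = soMat (Γ.curvInChart c x₀ y u v) i j := by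
  have h1 : ∀ w i j, Γ.form c i j (invChart x₀ y) (invChartDeriv x₀ y w)
      = soMat (Γ.inChart c x₀ y w) i j := by
    intro w i j
    simp only [SO3Connection.form, soMat, Fin.sum_univ_three, Matrix.add_apply, Matrix.smul_apply,
      add_apply, smul_apply, smul_eq_mul]
    change _ = Γ.γ c 0 (invChart x₀ y) (invChartDeriv x₀ y w) * _
      + Γ.γ c 1 (invChart x₀ y) (invChartDeriv x₀ y w) * _
      + Γ.γ c 2 (invChart x₀ y) (invChartDeriv x₀ y w) * _
    ring
  have h2 : ∀ I, extDer (Γ.γ c I) (invChart x₀ y) (invChartDeriv x₀ y u) (invChartDeriv x₀ y v)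
      = (fderiv ℝ (Γ.inChart c x₀) y u v - fderiv ℝ (Γ.inChart c x₀) y v u) I := by
    intro I
    rw [extDer_invChartDeriv (Γ.smoothOn c I) c.U.isOpen hy, Pi.sub_apply,
      Γ.fderiv_inChart_apply c hy, Γ.fderiv_inChart_apply c hy]
    rfl
  have h3 := congrFun₂ (soMat_bracket (Γ.inChart c x₀ y u) (Γ.inChart c x₀ y v)) i j
  have h4 : ∀ a b, soMat (a + b) = soMat a + soMat b := by
    intro a b
    simp [soMat, add_smul, Finset.sum_add_distrib]
  rw [SO3Connection.curvInChart, h4, Matrix.add_apply, ← h3, SO3Connection.curv,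
    Γ.extDer_form c hy.2]
  simp only [h1, h2]
  congr 1
  · simp [soMat, Matrix.sum_apply, mul_comm]
  · simp [Matrix.mul_apply, mul_comm]

/-- The structure equation: in every adapted coframe, `dθ(w)(u) = θ(∇_u w) - Γ(u) θ(w)`. -/
theorem SO3Connection.exists_structure_eq (Γ : SO3Connection G) {x₀ : M} {y : E5}
    (hy : y ∈ (extChartAt (𝓡 5) x₀).target) (u w : E5) :
    ∃ n : E5, ∀ c : AdaptedCoframe G, y ∈ c.chartDomain x₀ →
      fderiv ℝ (c.inChart x₀) y u w
        = c.inChart x₀ y n - soMat (Γ.inChart c x₀ y u) *ᵥ c.inChart x₀ y w := by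
  have hsrc : invChart x₀ y ∈ (extChartAt 𝓘(ℝ, E5) x₀).source :=
    (extChartAt 𝓘(ℝ, E5) x₀).map_target hy
  have hX := (contMDiffOn_constVectorField x₀ w).contMDiffAt
    ((isOpen_extChartAt_source (I := 𝓘(ℝ, E5)) x₀).mem_nhds hsrc)
  obtain ⟨n, hn⟩ := invChartDeriv_surjective hy
    (Γ.nabla (constVectorField x₀ w) (invChart x₀ y) (invChartDeriv x₀ y u))
  refine ⟨n, fun c hc ↦ ?_⟩
  funext i
  have h1 := Γ.nabla_eq c (constVectorField x₀ w) (invChart x₀ y) hc.2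
    (hX.mdifferentiableAt (by simp)) (invChartDeriv x₀ y u) i
  have h2 : MDifferentiableAt 𝓘(ℝ, E5) 𝓘(ℝ, ℝ)
      (fun z ↦ c.θ i z (constVectorField x₀ w z)) (invChart x₀ y) :=
    (contMDiffWithinAt_oneForm_apply (f := id) (s := univ) (c.smoothOn i) c.U.isOpen hc.2
      hX).contMDiffAt univ_mem |>.mdifferentiableAt (by simp)
  have h3 := hasFDerivAt_comp_invChart hy h2
  have h4 : (fun z ↦ c.θ i z (constVectorField x₀ w z)) ∘ invChart x₀
      =ᶠ[𝓝 y] fun z ↦ chartForm (E := E5) (c.θ i) x₀ z w := by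
    filter_upwards [(isOpen_extChartAt_target (I := 𝓘(ℝ, E5)) x₀).mem_nhds hy] with z hz
    exact congrArg (c.θ i _) (constVectorField_invChart hz w)
  have h5 : HasFDerivAt (fun z ↦ chartForm (E := E5) (c.θ i) x₀ z w)
      ((fderiv ℝ (chartForm (E := E5) (c.θ i) x₀) y).flip w) y := by
    have h := ((contDiffOn_chartForm (E := E5) (c.smoothOn i) c.U.isOpen x₀).contDiffAt
      ((c.isOpen_chartDomain x₀).mem_nhds hc)).differentiableAt (by simp)
    simpa using h.hasFDerivAt.clm_apply (hasFDerivAt_const w y)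
  have h6 : fderiv ℝ (c.inChart x₀) y u w i = mvfderiv 𝓘(ℝ, E5)
      (fun z ↦ c.θ i z (constVectorField x₀ w z)) (invChart x₀ y) (invChartDeriv x₀ y u) := by
    rw [c.fderiv_inChart_apply hc]
    exact congrArg (fun T ↦ T u) (h5.unique (h3.congr_of_eventuallyEq h4.symm))
  rw [h6, Pi.sub_apply]
  rw [← hn, constVectorField_invChart hy] at h1
  exact eq_sub_of_add_eq h1.symm

end Coframes

/-! ### Change of coframe -/

section MatrixDerivative

variable {E : Type*} [NormedAddCommGroup E] [NormedSpace ℝ E]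

/-- The entrywise derivative of a matrix-valued function in the direction `u`. -/
def matDeriv (A : E → Matrix (Fin 4) (Fin 4) ℂ) (y u : E) : Matrix (Fin 4) (Fin 4) ℂ :=
  fun k l ↦ fderiv ℝ (fun z ↦ A z k l) y u

theorem matDeriv_mul {A B : E → Matrix (Fin 4) (Fin 4) ℂ} {y : E}
    (hA : ∀ k l, DifferentiableAt ℝ (fun z ↦ A z k l) y)
    (hB : ∀ k l, DifferentiableAt ℝ (fun z ↦ B z k l) y) (u : E) :
    matDeriv (fun z ↦ A z * B z) y u = matDeriv A y u * B y + A y * matDeriv B y u := by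
  ext k l
  have h : HasFDerivAt (fun z ↦ ∑ m, A z k m * B z m l) (∑ m, (A y k m • fderiv ℝ (fun z ↦ B z m l) y
      + B y m l • fderiv ℝ (fun z ↦ A z k m) y)) y :=
    HasFDerivAt.fun_sum fun m _ ↦ (hA k m).hasFDerivAt.mul (hB m l).hasFDerivAt
  replace h : HasFDerivAt (fun z ↦ (A z * B z) k l) _ y := h
  rw [matDeriv, h.fderiv]
  simp [matDeriv, Matrix.mul_apply, Finset.sum_add_distrib, mul_comm, add_comm]

theorem matDeriv_transpose (A : E → Matrix (Fin 4) (Fin 4) ℂ) (y u : E) :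
    matDeriv (fun z ↦ (A z)ᵀ) y u = (matDeriv A y u)ᵀ := rfl

theorem matDeriv_const (A : Matrix (Fin 4) (Fin 4) ℂ) (y u : E) :
    matDeriv (fun _ ↦ A) y u = 0 := by
  ext k l
  simp [matDeriv]

theorem matDeriv_congr {A B : E → Matrix (Fin 4) (Fin 4) ℂ} {y : E}
    (h : A =ᶠ[nhds y] B) (u : E) : matDeriv A y u = matDeriv B y u := by
  ext k l
  have h' : (fun z ↦ A z k l) =ᶠ[nhds y] fun z ↦ B z k l := h.mono fun z hz ↦ by simp only [hz]
  rw [matDeriv, h'.fderiv_eq, matDeriv]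

theorem hasFDerivAt_cliffVec_apply {t : E → Fin 5 → ℝ} {t' : E →L[ℝ] Fin 5 → ℝ} {y : E}
    (ht : HasFDerivAt t t' y) (k l : Fin 4) :
    HasFDerivAt (fun z ↦ cliffVec (t z) k l) (∑ i, (Complex.ofRealCLM.comp
      ((ContinuousLinearMap.proj i).comp t')).smulRight (cliff i k l)) y := by
  have h : (fun z ↦ cliffVec (t z) k l) = fun z ↦ ∑ i, (Complex.ofRealCLM (t z i)) • cliff i k l := by
    funext z
    simp [cliffVec, Matrix.sum_apply]
  rw [h]
  exact HasFDerivAt.fun_sum fun i _ ↦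
    (Complex.ofRealCLM.hasFDerivAt.comp y (hasFDerivAt_pi'.1 ht i)).smul_const _

theorem matDeriv_cliffVec {t : E → Fin 5 → ℝ} {t' : E →L[ℝ] Fin 5 → ℝ} {y : E}
    (ht : HasFDerivAt t t' y) (u : E) :
    matDeriv (fun z ↦ cliffVec (t z)) y u = cliffVec (t' u) := by
  ext k l
  rw [matDeriv, (hasFDerivAt_cliffVec_apply ht k l).fderiv]
  simp [cliffVec, Matrix.sum_apply]

end MatrixDerivative

section Transitions

open Filter Topology

variable {M : Type*} [TopologicalSpace M] [ChartedSpace E5 M] [IsManifold (𝓡 5) ∞ M]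
  {G : SO3Structure M}

theorem AdaptedCoframe.hasFDerivAt_inChart_apply (c : AdaptedCoframe G) {x₀ : M} {y : E5}
    (hy : y ∈ c.chartDomain x₀) (w : E5) : HasFDerivAt (fun z ↦ c.inChart x₀ z w)
      ((fderiv ℝ (c.inChart x₀) y).flip w) y := by
  simpa using (c.differentiableAt_inChart hy).hasFDerivAt.clm_apply (hasFDerivAt_const w y)

/-- A smooth `Spin(3)`-valued function `s` covering the change of coframe from `b` to `a`
intertwines the two connection forms: `ds = s Γ_b - Γ_a s`. The defect, multiplied by `s⁻¹`,
commutes with Clifford multiplication, so that it is a scalar, and this scalar vanishes because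
`Spin(3)` preserves a symplectic form. -/
theorem SO3Connection.matDeriv_transition (Γ : SO3Connection G) {a b : AdaptedCoframe G}
    {x₀ : M} {y : E5} (ha : y ∈ a.chartDomain x₀) (hb : y ∈ b.chartDomain x₀)
    {s : E5 → Matrix.GeneralLinearGroup (Fin 4) ℂ} (hs : ∀ᶠ z in 𝓝 y, s z ∈ spin3)
    (hd : ∀ k l, DifferentiableAt ℝ (fun z ↦ (s z : Matrix (Fin 4) (Fin 4) ℂ) k l) y)
    (hcov : ∀ᶠ z in 𝓝 y, ∀ w, (s z : Matrix (Fin 4) (Fin 4) ℂ) * cliffVec (b.inChart x₀ z w)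
      = cliffVec (a.inChart x₀ z w) * (s z : Matrix (Fin 4) (Fin 4) ℂ)) (u : E5) :
    matDeriv (fun z ↦ (s z : Matrix (Fin 4) (Fin 4) ℂ)) y u
      = s y * spinMat (Γ.inChart b x₀ y u) - spinMat (Γ.inChart a x₀ y u) * s y := by
  set σ : E5 → Matrix (Fin 4) (Fin 4) ℂ := fun z ↦ (s z : Matrix (Fin 4) (Fin 4) ℂ) with hσ
  set σ' := matDeriv σ y u
  set S := spinMat (Γ.inChart a x₀ y u)
  set T := spinMat (Γ.inChart b x₀ y u)
  set D := σ' - σ y * T + S * σ y with hD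
  set τ := ((s y)⁻¹ : Matrix.GeneralLinearGroup (Fin 4) ℂ) * D with hτ
  have hinv : σ y * ((s y)⁻¹ : Matrix.GeneralLinearGroup (Fin 4) ℂ) = 1 := by
    rw [hσ, ← Units.val_mul, mul_inv_cancel, Units.val_one]
  have hinv' : ((s y)⁻¹ : Matrix.GeneralLinearGroup (Fin 4) ℂ) * σ y = 1 := by
    rw [hσ, ← Units.val_mul, inv_mul_cancel, Units.val_one]
  have hDτ : D = σ y * τ := by rw [hτ, ← mul_assoc, hinv, one_mul]
  -- the derivative of the covering relation `s (θ_b · 𝐞) = (θ_a · 𝐞) s`, in which the terms with the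
  -- covariant derivative `n` cancel
  have hcomm : ∀ t, D * cliffVec t = σ y * cliffVec t * ((s y)⁻¹ :
      Matrix.GeneralLinearGroup (Fin 4) ℂ) * D := by
    intro t
    obtain ⟨w, rfl⟩ := (b.bijective_inChart hb).2 t
    obtain ⟨n, hn⟩ := Γ.exists_structure_eq ha.1 u w
    have h1 := matDeriv_mul hd
      (fun k l ↦ (hasFDerivAt_cliffVec_apply (b.hasFDerivAt_inChart_apply hb w) k l).differentiableAt) u
    have h2 := matDeriv_mul
      (fun k l ↦ (hasFDerivAt_cliffVec_apply (a.hasFDerivAt_inChart_apply ha w) k l).differentiableAt)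
      hd u
    rw [matDeriv_congr (hcov.mono fun z hz ↦ hz w), h2] at h1
    rw [matDeriv_cliffVec (b.hasFDerivAt_inChart_apply hb w),
      matDeriv_cliffVec (a.hasFDerivAt_inChart_apply ha w), ContinuousLinearMap.flip_apply,
      ContinuousLinearMap.flip_apply, hn a ha, hn b hb, cliffVec_sub, cliffVec_sub,
      ← spinMat_cliffVec_bracket, ← spinMat_cliffVec_bracket] at h1
    have h3 := hcov.self_of_nhds w
    have h4 := hcov.self_of_nhds n
    change σ y * cliffVec _ = cliffVec _ * σ y at h3
    change σ y * cliffVec _ = cliffVec _ * σ y at h4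
    rw [h3, mul_assoc (cliffVec _) (σ y), hinv, mul_one, hD]
    change _ + _ * σ' = σ' * _ + _ at h1
    change (cliffVec (a.inChart x₀ y n) - (S * _ - _ * S)) * σ y + _ = _ + σ y * (_ - (T * _ - _ * T)) at h1
    have h5 : σ y * T * cliffVec (b.inChart x₀ y w) = σ y * (T * cliffVec (b.inChart x₀ y w)) :=
      mul_assoc _ _ _
    generalize cliffVec (a.inChart x₀ y w) = A at *
    generalize cliffVec (b.inChart x₀ y w) = B at *
    generalize cliffVec (a.inChart x₀ y n) = A' at *
    generalize cliffVec (b.inChart x₀ y n) = B' at *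
    have e1 : (A' - (S * A - A * S)) * σ y = A' * σ y - S * (A * σ y) + A * (S * σ y) := by
      noncomm_ring
    have e2 : σ y * (B' - (T * B - B * T)) = σ y * B' - σ y * T * B + (σ y * B) * T := by
      noncomm_ring
    rw [e1, e2, h3, h4] at h1
    have e3 : (σ' - σ y * T + S * σ y) * B = σ' * B - σ y * T * B + S * (σ y * B) := by
      noncomm_ring
    rw [e3, h3]
    have e4 : A * (σ' - σ y * T + S * σ y) = A * σ' - A * σ y * T + A * (S * σ y) := by
      noncomm_ring
    rw [e4]
    linear_combination (norm := abel) -h1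
  have hscal : τ = τ 0 0 • 1 := by
    refine eq_scalar_of_commute_cliffVec fun t ↦ ?_
    rw [hτ, mul_assoc, hcomm t, ← hτ]
    rw [← mul_assoc, ← mul_assoc, ← mul_assoc, hinv', one_mul, mul_assoc]
  have hDs : D = τ 0 0 • σ y := by rw [hDτ, hscal]; simp
  -- the derivative of the invariance of the symplectic form
  have hsym := matDeriv_congr (hs.mono fun z hz ↦ transpose_mul_mul_of_mem_spin3 hz) u
  rw [matDeriv_const, matDeriv_mul (A := fun z ↦ (σ z)ᵀ * spinSymplectic) (B := σ) ?_ hd,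
    matDeriv_mul (A := fun z ↦ (σ z)ᵀ) (B := fun _ ↦ spinSymplectic) (fun k l ↦ hd l k) (fun k l ↦ differentiableAt_const _),
    matDeriv_const, mul_zero, add_zero, matDeriv_transpose] at hsym
  · have hJ : (σ y)ᵀ * spinSymplectic * σ y = spinSymplectic :=
      transpose_mul_mul_of_mem_spin3 hs.self_of_nhds
    change σ'ᵀ * _ * _ + _ * σ' = 0 at hsym
    have hσ' : σ' = τ 0 0 • σ y + σ y * T - S * σ y := by rw [← hDs, hD]; abel
    have hST := transpose_spinMat_mul_add (Γ.inChart a x₀ y u)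
    have hTT := transpose_spinMat_mul_add (Γ.inChart b x₀ y u)
    have hsum : (2 * τ 0 0) • spinSymplectic = 0 := by
      calc (2 * τ 0 0) • spinSymplectic
          = (2 * τ 0 0) • ((σ y)ᵀ * spinSymplectic * σ y)
            + (Tᵀ * ((σ y)ᵀ * spinSymplectic * σ y) + (σ y)ᵀ * spinSymplectic * σ y * T)
            - (σ y)ᵀ * (Sᵀ * spinSymplectic + spinSymplectic * S) * σ y := by
            rw [hST, hJ, hTT]
            simp
        _ = (τ 0 0 • σ y + σ y * T - S * σ y)ᵀ * spinSymplectic * σ y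
            + (σ y)ᵀ * spinSymplectic * (τ 0 0 • σ y + σ y * T - S * σ y) := by
            simp only [Matrix.transpose_sub, Matrix.transpose_add, Matrix.transpose_mul,
              Matrix.transpose_smul, sub_mul, add_mul, mul_sub, mul_add, smul_mul_assoc,
              mul_smul_comm, two_mul, add_smul, mul_assoc]
            abel
        _ = 0 := by rw [← hσ', hsym]
    have h0 : τ 0 0 = 0 := by
      have h := congrFun₂ hsum 3 0
      simpa [spinSymplectic] using h
    rw [hσ', h0, zero_smul, zero_add]
  · intro k l
    have h : DifferentiableAt ℝ (fun z ↦ ∑ m, σ z m k * spinSymplectic m l) y :=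
      (HasFDerivAt.fun_sum fun m _ ↦
        (hd m k).hasFDerivAt.mul_const (spinSymplectic m l)).differentiableAt
    exact h

/-- Matrices of `so(3)` as continuous linear maps, depending linearly on the coefficients. -/
def soMatL : (Fin 3 → ℝ) →L[ℝ] (Fin 5 → ℝ) →L[ℝ] (Fin 5 → ℝ) :=
  LinearMap.toContinuousLinearMap
    { toFun := fun a ↦ LinearMap.toContinuousLinearMap (soMat a).mulVecLin
      map_add' := fun a b ↦ by
        ext v
        simp [soMat, add_smul, Finset.sum_add_distrib]
      map_smul' := fun r a ↦ by
        ext v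
        simp [soMat, mul_smul, ← Finset.smul_sum] }

theorem soMatL_apply (a : Fin 3 → ℝ) (t : Fin 5 → ℝ) : soMatL a t = soMat a *ᵥ t := rfl

/-- The action `(h, (a, c)) ↦ soMat c ∘ h - h ∘ soMat a` of pairs of elements of `so(3)`
on endomorphisms of `ℝ⁵`. -/
def coframeAction : ((Fin 5 → ℝ) →L[ℝ] (Fin 5 → ℝ)) →L[ℝ] ((Fin 3 → ℝ) × (Fin 3 → ℝ)) →L[ℝ]
    ((Fin 5 → ℝ) →L[ℝ] (Fin 5 → ℝ)) :=
  ((ContinuousLinearMap.compL ℝ (Fin 5 → ℝ) (Fin 5 → ℝ) (Fin 5 → ℝ)).comp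
      (soMatL.comp (ContinuousLinearMap.snd ℝ _ _))).flip
    - (((ContinuousLinearMap.compL ℝ (Fin 5 → ℝ) (Fin 5 → ℝ) (Fin 5 → ℝ)).flip.comp
      (soMatL.comp (ContinuousLinearMap.fst ℝ _ _)))).flip

theorem coframeAction_apply (h : (Fin 5 → ℝ) →L[ℝ] (Fin 5 → ℝ)) (g : (Fin 3 → ℝ) × (Fin 3 → ℝ))
    (t : Fin 5 → ℝ) :
    coframeAction h g t = soMat g.2 *ᵥ h t - h (soMat g.1 *ᵥ t) := rfl

theorem AdaptedCoframe.isInvertible_inChart (c : AdaptedCoframe G) {x₀ : M} {y : E5}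
    (hy : y ∈ c.chartDomain x₀) : (c.inChart x₀ y).IsInvertible := by
  have h := c.bijective_inChart hy
  exact ⟨ContinuousLinearEquiv.ofBijective (c.inChart x₀ y) (LinearMap.ker_eq_bot.2 h.1)
    (LinearMap.range_eq_top.2 h.2), ContinuousLinearEquiv.coe_ofBijective _ _ _⟩

/-- The change of coframe `h` between two adapted coframes is parallel for the two connection
forms, as follows from the structure equations of both coframes: `dh = h Γ_a - Γ_c h`. -/
theorem SO3Connection.exists_coframe_change (Γ : SO3Connection G) (a c : AdaptedCoframe G)
    {x₀ : M} {y : E5} (ha : y ∈ a.chartDomain x₀) (hc : y ∈ c.chartDomain x₀) :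
    ∃ h : E5 → (Fin 5 → ℝ) →L[ℝ] (Fin 5 → ℝ),
      (∀ᶠ z in 𝓝 y, HasFDerivAt h
        (-(coframeAction (h z)).comp ((Γ.inChart a x₀ z).prod (Γ.inChart c x₀ z))) z) ∧
      (∀ w, h y (a.inChart x₀ y w) = c.inChart x₀ y w) := by
  refine ⟨fun z ↦ (c.inChart x₀ z).comp (a.inChart x₀ z).inverse, ?_, ?_⟩
  · filter_upwards [(a.isOpen_chartDomain x₀).mem_nhds ha, (c.isOpen_chartDomain x₀).mem_nhds hc]
      with z hza hzc
    have hi := a.isInvertible_inChart hza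
    have ha' := a.differentiableAt_inChart hza
    have hdiff : DifferentiableAt ℝ
        (fun z ↦ (c.inChart x₀ z).comp (a.inChart x₀ z).inverse) z :=
      (c.differentiableAt_inChart hzc).clm_comp
        ((hi.contDiffAt_map_inverse (n := 1)).differentiableAt (by simp) |>.comp z ha')
    set h := fun z ↦ (c.inChart x₀ z).comp (a.inChart x₀ z).inverse
    have hw : ∀ z ∈ a.chartDomain x₀, ∀ w, h z (a.inChart x₀ z w) = c.inChart x₀ z w :=
      fun z hz w ↦ congrArg (c.inChart x₀ z) ((a.isInvertible_inChart hz).inverse_apply_self w)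
    convert hdiff.hasFDerivAt using 1
    ext1 u
    ext1 t
    obtain ⟨w, rfl⟩ := (a.bijective_inChart hza).2 t
    obtain ⟨n, hn⟩ := Γ.exists_structure_eq hza.1 u w
    have h1 := hdiff.hasFDerivAt.clm_apply (a.hasFDerivAt_inChart_apply hza w)
    have h2 : (fun z ↦ h z (a.inChart x₀ z w)) =ᶠ[𝓝 z] fun z ↦ c.inChart x₀ z w := by
      filter_upwards [(a.isOpen_chartDomain x₀).mem_nhds hza] with z hz using hw z hz w
    have h3 := congrArg (fun T ↦ T u)
      (h1.unique ((c.hasFDerivAt_inChart_apply hzc w).congr_of_eventuallyEq h2))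
    simp only [add_apply, ContinuousLinearMap.comp_apply, ContinuousLinearMap.flip_apply, hn a hza,
      hn c hzc, map_sub, hw z hza] at h3
    change -(soMat (Γ.inChart c x₀ z u) *ᵥ h z (a.inChart x₀ z w)
      - h z (soMat (Γ.inChart a x₀ z u) *ᵥ a.inChart x₀ z w))
      = fderiv ℝ h z u (a.inChart x₀ z w)
    rw [hw z hza]
    linear_combination (norm := abel) -h3
  · exact fun w ↦ congrArg (c.inChart x₀ y) ((a.isInvertible_inChart ha).inverse_apply_self w)

theorem SO3Connection.soMat_curvInChart_mulVec (Γ : SO3Connection G) (c : AdaptedCoframe G)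
    (x₀ : M) (y u v : E5) (t : Fin 5 → ℝ) :
    soMat (Γ.curvInChart c x₀ y u v) *ᵥ t
      = soMat (fderiv ℝ (Γ.inChart c x₀) y u v - fderiv ℝ (Γ.inChart c x₀) y v u) *ᵥ t
        + (soMat (Γ.inChart c x₀ y u) *ᵥ soMat (Γ.inChart c x₀ y v) *ᵥ t
          - soMat (Γ.inChart c x₀ y v) *ᵥ soMat (Γ.inChart c x₀ y u) *ᵥ t) := by
  rw [SO3Connection.curvInChart, ← soMatL_apply, map_add, add_apply, soMatL_apply, soMatL_apply,
    ← soMat_bracket, Matrix.sub_mulVec, Matrix.mulVec_mulVec, Matrix.mulVec_mulVec]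

/-- The curvature is a tensor: its vanishing does not depend on the adapted coframe. The curvature of
the system satisfied by the change of coframe `h` annihilates `h`, that is,
`soMat κ_c ∘ h = h ∘ soMat κ_a`. -/
theorem SO3Connection.curvInChart_eq_zero (Γ : SO3Connection G) {a c : AdaptedCoframe G}
    {x₀ : M} {y : E5} (ha : y ∈ a.chartDomain x₀) (hc : y ∈ c.chartDomain x₀) {u v : E5}
    (h0 : Γ.curvInChart a x₀ y u v = 0) : Γ.curvInChart c x₀ y u v = 0 := by
  obtain ⟨h, hh, hac⟩ := Γ.exists_coframe_change a c ha hc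
  let P : ((E5 →L[ℝ] Fin 3 → ℝ) × (E5 →L[ℝ] Fin 3 → ℝ)) ≃ₗᵢ[ℝ]
    (E5 →L[ℝ] (Fin 3 → ℝ) × (Fin 3 → ℝ)) := ContinuousLinearMap.prodₗᵢ ℝ
  have hd : HasFDerivAt (fun z ↦ (Γ.inChart a x₀ z).prod (Γ.inChart c x₀ z))
      (P.toContinuousLinearEquiv.toContinuousLinearMap.comp
        ((fderiv ℝ (Γ.inChart a x₀) y).prod (fderiv ℝ (Γ.inChart c x₀) y))) y :=
    P.toContinuousLinearEquiv.toContinuousLinearMap.hasFDerivAt.comp y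
      ((Γ.differentiableAt_inChart a ha).hasFDerivAt.prodMk
        (Γ.differentiableAt_inChart c hc).hasFDerivAt)
  have h1 := systemCurv_eq_zero_of_parallel hd.differentiableAt hh u v
  have hz : ∀ t, soMat (Γ.curvInChart c x₀ y u v) *ᵥ t = 0 := by
    intro t
    obtain ⟨w, rfl⟩ := (c.bijective_inChart hc).2 t
    have h2 := congrArg (fun T ↦ T (a.inChart x₀ y w)) h1
    rw [systemCurv, hd.fderiv] at h2
    have h3 : soMat (fderiv ℝ (Γ.inChart c x₀) y u v - fderiv ℝ (Γ.inChart c x₀) y v u)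
          *ᵥ h y (a.inChart x₀ y w)
        - h y (soMat (fderiv ℝ (Γ.inChart a x₀) y u v - fderiv ℝ (Γ.inChart a x₀) y v u)
          *ᵥ a.inChart x₀ y w)
        + ((coframeAction (coframeAction (h y) (Γ.inChart a x₀ y v, Γ.inChart c x₀ y v))
            (Γ.inChart a x₀ y u, Γ.inChart c x₀ y u)) (a.inChart x₀ y w)
          - (coframeAction (coframeAction (h y) (Γ.inChart a x₀ y u, Γ.inChart c x₀ y u))
            (Γ.inChart a x₀ y v, Γ.inChart c x₀ y v)) (a.inChart x₀ y w)) = 0 := h2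
    simp only [coframeAction_apply, Matrix.mulVec_sub, hac] at h3
    have h4 := Γ.soMat_curvInChart_mulVec a x₀ y u v (a.inChart x₀ y w)
    rw [h0, ← soMatL_apply, map_zero, zero_apply] at h4
    have h5 := congrArg (h y) h4
    simp only [map_add, map_sub, map_zero] at h5
    rw [Γ.soMat_curvInChart_mulVec]
    linear_combination (norm := abel) h3 - h5
  apply soMat_injective
  ext i j
  have h2 := congrFun (hz (Pi.single j 1)) i
  simpa [soMat] using h2

end Transitions

/-! ### Parallel spinors in a coframe -/

section ParallelSpinors

open Filter Topology

variable {M : Type*} [TopologicalSpace M] [ChartedSpace E5 M] [IsManifold (𝓡 5) ∞ M]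
  {G : SO3Structure M}

/-- The action `(ψ, a) ↦ spinMat a *ᵥ ψ` of `spin(3)` on spinors, as a continuous bilinear map. -/
def spinAction : (Fin 4 → ℂ) →L[ℝ] (Fin 3 → ℝ) →L[ℝ] (Fin 4 → ℂ) :=
  LinearMap.toContinuousLinearMap (LinearMap.toContinuousLinearMap.toLinearMap ∘ₗ
    LinearMap.mk₂ ℝ (fun (ψ : Fin 4 → ℂ) (a : Fin 3 → ℝ) ↦ spinMat a *ᵥ ψ)
      (fun ψ φ a ↦ Matrix.mulVec_add _ _ _)
      (fun r ψ a ↦ Matrix.mulVec_smul _ _ _)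
      (fun ψ a b ↦ by simp [spinMat, add_smul, Finset.sum_add_distrib, Matrix.add_mulVec])
      (fun r ψ a ↦ by
        rw [← Matrix.smul_mulVec]
        congr 1
        simp only [spinMat, Finset.smul_sum]
        refine Finset.sum_congr rfl fun I _ ↦ ?_
        rw [← Complex.coe_smul r, smul_smul]
        simp))

theorem spinAction_apply (ψ : Fin 4 → ℂ) (a : Fin 3 → ℝ) : spinAction ψ a = spinMat a *ᵥ ψ := rfl

theorem SO3Connection.spinForm_invChartDeriv (Γ : SO3Connection G) (c : AdaptedCoframe G)
    (x₀ : M) (y u : E5) :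
    Γ.spinForm c (invChart x₀ y) (invChartDeriv x₀ y u) = spinMat (Γ.inChart c x₀ y u) := rfl

/-- The curvature of the system of parallel spinors. -/
theorem SO3Connection.systemCurv_spinAction (Γ : SO3Connection G) (c : AdaptedCoframe G)
    (x₀ : M) (y u v : E5) (ψ : Fin 4 → ℂ) :
    systemCurv spinAction (Γ.inChart c x₀) y u v ψ
      = spinMat (Γ.curvInChart c x₀ y u v) *ᵥ ψ := by
  rw [systemCurv, SO3Connection.curvInChart, ← spinAction_apply, map_add]
  congr 1
  simp only [spinAction_apply, Matrix.mulVec_mulVec]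
  rw [← Matrix.sub_mulVec, spinMat_bracket]

/-- The representative `ψ` of a spinor field in the coframe `c` is parallel on `U`. -/
structure SO3Connection.IsParallelOn (Γ : SO3Connection G) (c : AdaptedCoframe G) (U : Set M)
    (ψ : M → Fin 4 → ℂ) : Prop where
  smooth : ContMDiffOn (𝓡 5) 𝓘(ℝ, Fin 4 → ℂ) ∞ ψ U
  eq_zero (x : M) (hx : x ∈ U) (v : TangentSpace (𝓡 5) x) :
    mvfderiv (𝓡 5) ψ x v + Γ.spinForm c x v *ᵥ ψ x = 0

theorem SO3Connection.IsParallelOn.hasFDerivAt {Γ : SO3Connection G} {c : AdaptedCoframe G}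
    {U : Set M} {ψ : M → Fin 4 → ℂ} (h : Γ.IsParallelOn c U ψ) (hU : IsOpen U) {x₀ : M} {y : E5}
    (hy : y ∈ chartDomain x₀ U) :
    HasFDerivAt (ψ ∘ invChart x₀)
      (-(spinAction ((ψ ∘ invChart x₀) y)).comp (Γ.inChart c x₀ y)) y := by
  have hd : MDifferentiableAt 𝓘(ℝ, E5) 𝓘(ℝ, Fin 4 → ℂ) ψ (invChart x₀ y) :=
    (h.smooth.contMDiffAt (hU.mem_nhds hy.2)).mdifferentiableAt (by simp)
  refine (hasFDerivAt_comp_invChart hy.1 hd).congr_fderiv ?_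
  ext1 u
  exact (eq_neg_of_add_eq_zero_left (h.eq_zero _ hy.2 (invChartDeriv x₀ y u)))

/-- Solutions of the system of parallel spinors in a chart define parallel spinors. -/
theorem SO3Connection.isParallelOn_of_hasFDerivAt {Γ : SO3Connection G} {c : AdaptedCoframe G}
    {x₀ : M} {V : Set E5} (hV : IsOpen V) (hVc : V ⊆ c.chartDomain x₀) {f : E5 → Fin 4 → ℂ}
    (hf : ∀ y ∈ V, HasFDerivAt f (-(spinAction (f y)).comp (Γ.inChart c x₀ y)) y) :
    Γ.IsParallelOn c ((extChartAt 𝓘(ℝ, E5) x₀).source ∩ extChartAt 𝓘(ℝ, E5) x₀ ⁻¹' V)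
      (f ∘ extChartAt 𝓘(ℝ, E5) x₀) := by
  have hsm : ContDiffOn ℝ ∞ f V :=
    contDiffOn_of_parallel hV ((Γ.contDiffOn_inChart c x₀).mono hVc) hf
  have hO : IsOpen ((extChartAt 𝓘(ℝ, E5) x₀).source ∩ extChartAt 𝓘(ℝ, E5) x₀ ⁻¹' V) :=
    (continuousOn_extChartAt x₀).isOpen_inter_preimage (isOpen_extChartAt_source x₀) hV
  have hsmooth : ContMDiffOn 𝓘(ℝ, E5) 𝓘(ℝ, Fin 4 → ℂ) ∞ (f ∘ extChartAt 𝓘(ℝ, E5) x₀)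
      ((extChartAt 𝓘(ℝ, E5) x₀).source ∩ extChartAt 𝓘(ℝ, E5) x₀ ⁻¹' V) := by
    refine (contMDiffOn_iff_contDiffOn.2 hsm).comp
      ((contMDiffOn_extChartAt (I := 𝓘(ℝ, E5)) (x := x₀)).mono fun x hx ↦ ?_) fun x hx ↦ hx.2
    rw [← extChartAt_source 𝓘(ℝ, E5)]
    exact hx.1
  refine ⟨hsmooth, fun x hx v ↦ ?_⟩
  obtain ⟨y, hy, rfl⟩ := exists_invChart_eq hx.1
  obtain ⟨u, rfl⟩ := invChartDeriv_surjective hy v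
  have hyV : y ∈ V := by
    have h : extChartAt 𝓘(ℝ, E5) x₀ (invChart x₀ y) = y :=
      (extChartAt 𝓘(ℝ, E5) x₀).right_inv hy
    rw [← h]
    exact hx.2
  have h1 := hasFDerivAt_comp_invChart hy
    ((hsmooth.contMDiffAt (hO.mem_nhds hx)).mdifferentiableAt (by simp))
  have h2 : (f ∘ extChartAt 𝓘(ℝ, E5) x₀) ∘ invChart x₀ =ᶠ[𝓝 y] f := by
    filter_upwards [(isOpen_extChartAt_target (I := 𝓘(ℝ, E5)) x₀).mem_nhds hy] with z hz
    exact congrArg f ((extChartAt 𝓘(ℝ, E5) x₀).right_inv hz)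
  have h3 := congrArg (fun T ↦ T u) (h1.unique ((hf y hyV).congr_of_eventuallyEq h2))
  rw [Γ.spinForm_invChartDeriv, ← spinAction_apply]
  have h4 : (f ∘ extChartAt 𝓘(ℝ, E5) x₀) (invChart x₀ y) = f y := h2.self_of_nhds
  rw [h4]
  exact add_eq_zero_iff_eq_neg.2 h3

/-- A parallel spinor that does not vanish at a point forces the curvature to vanish there,
because `spinMat κ` is invertible for `κ ≠ 0`. -/
theorem SO3Connection.IsParallelOn.curvInChart_eq_zero {Γ : SO3Connection G}
    {c : AdaptedCoframe G} {U : Set M} {ψ : M → Fin 4 → ℂ} (h : Γ.IsParallelOn c U ψ)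
    (hU : IsOpen U) (hUc : U ⊆ c.U) {x₀ : M} {y : E5} (hy : y ∈ chartDomain x₀ U)
    (h0 : ψ (invChart x₀ y) ≠ 0) (u v : E5) : Γ.curvInChart c x₀ y u v = 0 := by
  have h1 := systemCurv_eq_zero_of_parallel (Γ.differentiableAt_inChart c ⟨hy.1, hUc hy.2⟩)
    (((isOpen_chartDomain x₀ hU).eventually_mem hy).mono fun z hz ↦ h.hasFDerivAt hU hz) u v
  rw [Γ.systemCurv_spinAction] at h1
  exact eq_zero_of_spinMat_mulVec h0 h1

theorem SO3Connection.IsParallelOn.eventually_eq_zero {Γ : SO3Connection G}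
    {c : AdaptedCoframe G} {U : Set M} {ψ : M → Fin 4 → ℂ} (h : Γ.IsParallelOn c U ψ)
    (hU : IsOpen U) (hUc : U ⊆ c.U) {x : M} (hx : x ∈ U) (h0 : ψ x = 0) :
    ∀ᶠ z in 𝓝 x, ψ z = 0 := by
  have hinv : invChart x (extChartAt 𝓘(ℝ, E5) x x) = x := extChartAt_to_inv x
  have hy : extChartAt 𝓘(ℝ, E5) x x ∈ chartDomain x U :=
    ⟨mem_extChartAt_target x, by rwa [mem_preimage, hinv]⟩
  have h1 := eventually_eq_zero_of_parallel
    (Γ.differentiableAt_inChart c (x₀ := x) ⟨hy.1, hUc hy.2⟩).continuousAt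
    (((isOpen_chartDomain x hU).eventually_mem hy).mono fun z hz ↦ h.hasFDerivAt hU hz)
    (by rw [Function.comp, hinv, h0])
  filter_upwards [(continuousAt_extChartAt (I := 𝓘(ℝ, E5)) x).eventually h1,
    extChartAt_source_mem_nhds (I := 𝓘(ℝ, E5)) x] with z hz hz'
  rwa [Function.comp, show invChart x (extChartAt 𝓘(ℝ, E5) x z) = z from
    (extChartAt 𝓘(ℝ, E5) x).left_inv hz'] at hz

end ParallelSpinors

/-! ### Spinor fields and the change of coframe -/

section SpinorFields

open Filter Topology

variable {M : Type*} [TopologicalSpace M] [ChartedSpace E5 M] [IsManifold (𝓡 5) ∞ M]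
  {G : SO3Structure M} {Γ : SO3Connection G} {Ω : Opens M} {ι : Type*}
  {S : SpinStructure G Ω ι} {U : Opens M} {Ψ : ι → M → Fin 4 → ℂ}

theorem isParallelOn_of_mem_parallelSpinors (hΨ : Ψ ∈ S.parallelSpinors Γ U) (a : ι) :
    Γ.IsParallelOn (S.coframe a) ((S.coframe a).U ∩ U) (Ψ a) :=
  ⟨hΨ.1.smooth a, fun x hx v ↦ hΨ.2 a x hx.2 hx.1 v⟩

theorem SpinStructure.exists_mem_coframe (S : SpinStructure G Ω ι) {x : M} (hx : x ∈ Ω) :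
    ∃ a, x ∈ (S.coframe a).U := by
  have h : x ∈ ⋃ a, ((S.coframe a).U : Set M) := by
    rw [S.cover]
    exact hx
  simpa using h

theorem SpinStructure.s_self (S : SpinStructure G Ω ι) {a : ι} {x : M}
    (hx : x ∈ (S.coframe a).U) : S.s a a x = 1 :=
  mul_eq_left.1 (S.s_cocycle a a a x hx hx hx)

/-- A parallel spinor field over a connected open set that vanishes at a point is zero: the set of
its zeros and the complement of this set are open. -/
theorem eq_zero_of_mem_parallelSpinors (hU : U ≤ Ω) (hconn : IsPreconnected (U : Set M))
    (hΨ : Ψ ∈ S.parallelSpinors Γ U) {x : M} (hx : x ∈ U) {a : ι} (ha : x ∈ (S.coframe a).U)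
    (h0 : Ψ a x = 0) : Ψ = 0 := by
  have hcompat : ∀ z ∈ U, ∀ b c, z ∈ (S.coframe b).U → z ∈ (S.coframe c).U → Ψ b z = 0 →
      Ψ c z = 0 := by
    intro z hz b c hb hc h
    rw [hΨ.1.compat c b z hz hc hb, h, Matrix.mulVec_zero]
  set Z : Set M := {z | z ∈ U ∧ ∃ b, z ∈ (S.coframe b).U ∧ Ψ b z = 0}
  set N : Set M := {z | z ∈ U ∧ ∃ b, z ∈ (S.coframe b).U ∧ Ψ b z ≠ 0}
  have hZ : IsOpen Z := by
    rw [isOpen_iff_mem_nhds]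
    rintro z ⟨hz, b, hb, h⟩
    have hO := (S.coframe b).U.isOpen.inter U.isOpen
    filter_upwards [(isParallelOn_of_mem_parallelSpinors hΨ b).eventually_eq_zero hO
      inter_subset_left ⟨hb, hz⟩ h, hO.mem_nhds ⟨hb, hz⟩] with z' h' hz'
    exact ⟨hz'.2, b, hz'.1, h'⟩
  have hN : IsOpen N := by
    rw [isOpen_iff_mem_nhds]
    rintro z ⟨hz, b, hb, h⟩
    have hO := (S.coframe b).U.isOpen.inter U.isOpen
    have hc := ((hΨ.1.smooth b).continuousOn.continuousAt (hO.mem_nhds ⟨hb, hz⟩)).eventually_ne h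
    filter_upwards [hc, hO.mem_nhds ⟨hb, hz⟩] with z' h' hz'
    exact ⟨hz'.2, b, hz'.1, h'⟩
  have hZU : (U : Set M) ⊆ Z := by
    refine hconn.subset_left_of_subset_union hZ hN ?_ ?_ ⟨x, hx, hx, a, ha, h0⟩
    · rw [Set.disjoint_left]
      rintro z ⟨hz, b, hb, h⟩ ⟨_, c, hc, h'⟩
      exact h' (hcompat z hz b c hb hc h)
    · intro z hz
      obtain ⟨b, hb⟩ := S.exists_mem_coframe (hU hz)
      by_cases h : Ψ b z = 0
      · exact Or.inl ⟨hz, b, hb, h⟩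
      · exact Or.inr ⟨hz, b, hb, h⟩
  funext b z
  by_cases hz : z ∈ (S.coframe b).U ⊓ U
  · obtain ⟨_, c, hc, h⟩ := hZU hz.2
    exact hcompat z hz.2 c b hc hz.1 h
  · exact hΨ.1.eq_zero b z hz

/-- The connection is flat where a non-trivial parallel spinor field exists. -/
theorem isFlatOn_of_mem_parallelSpinors (hconn : IsPreconnected (Ω : Set M))
    (hΨ : Ψ ∈ S.parallelSpinors Γ Ω) (h0 : Ψ ≠ 0) : Γ.IsFlatOn Ω := by
  intro c x hx hxc i j v₁ v₂
  obtain ⟨a, ha⟩ := S.exists_mem_coframe hx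
  have h1 : Ψ a x ≠ 0 := fun h ↦ h0 (eq_zero_of_mem_parallelSpinors le_rfl hconn hΨ hx ha h)
  -- with a base point `x₀` of the chart independent of `x`, the point `x` can be replaced by
  -- `invChart x₀ y`
  suffices h : ∀ x₀, x ∈ (extChartAt 𝓘(ℝ, E5) x₀).source → Γ.curv c i j x v₁ v₂ = 0 from
    h x (mem_extChartAt_source x)
  intro x₀ hs
  obtain ⟨y, hy, rfl⟩ := exists_invChart_eq hs
  obtain ⟨u, rfl⟩ := invChartDeriv_surjective hy v₁
  obtain ⟨v, rfl⟩ := invChartDeriv_surjective hy v₂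
  have h2 : Γ.curvInChart (S.coframe a) x₀ y u v = 0 :=
    (isParallelOn_of_mem_parallelSpinors hΨ a).curvInChart_eq_zero
      ((S.coframe a).U.isOpen.inter Ω.isOpen) inter_subset_left ⟨hy, ha, hx⟩ h1 u v
  rw [Γ.curv_invChartDeriv c ⟨hy, hxc⟩,
    Γ.curvInChart_eq_zero (a := S.coframe a) ⟨hy, ha⟩ ⟨hy, hxc⟩ h2]
  simp [soMat]

/-- Where `Γ` is flat, also the coefficients `κ` of its curvature vanish. -/
theorem curvInChart_eq_zero_of_isFlatOn {W : Set M} (hW : Γ.IsFlatOn W) {c : AdaptedCoframe G}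
    {x₀ : M} {y : E5} (hy : y ∈ c.chartDomain x₀) (hyW : invChart x₀ y ∈ W) (u v : E5) :
    Γ.curvInChart c x₀ y u v = 0 := by
  apply soMat_injective
  ext i j
  rw [← Γ.curv_invChartDeriv c hy, hW c _ hyW hy.2]
  simp [soMat]

/-- A smooth `Spin(3)`-valued function covering the change of coframe from `b` to `a` maps
parallel spinors in the coframe `b` to parallel spinors in the coframe `a`. -/
theorem SO3Connection.IsParallelOn.transition {a b : AdaptedCoframe G} {O : Set M} (hO : IsOpen O)
    (hOa : O ⊆ a.U) (hOb : O ⊆ b.U) {ψ φ : M → Fin 4 → ℂ} (hψ : Γ.IsParallelOn b O ψ)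
    {s : M → Matrix.GeneralLinearGroup (Fin 4) ℂ} (hs : ∀ x ∈ O, s x ∈ spin3)
    (hsm : ∀ k l, ContMDiffOn (𝓡 5) 𝓘(ℝ, ℂ) ∞
      (fun x ↦ (s x : Matrix (Fin 4) (Fin 4) ℂ) k l) O)
    (hcov : ∀ x ∈ O, ∀ v : TangentSpace (𝓡 5) x,
      (s x : Matrix (Fin 4) (Fin 4) ℂ) * cliffVec (fun i ↦ b.θ i x v)
        = cliffVec (fun i ↦ a.θ i x v) * (s x : Matrix (Fin 4) (Fin 4) ℂ))
    (hφ : ∀ x ∈ O, φ x = (s x : Matrix (Fin 4) (Fin 4) ℂ) *ᵥ ψ x) :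
    Γ.IsParallelOn a O φ := by
  have hsmooth : ContMDiffOn 𝓘(ℝ, E5) 𝓘(ℝ, Fin 4 → ℂ) ∞ φ O := by
    refine ContMDiffOn.congr (f := fun x ↦ (s x : Matrix (Fin 4) (Fin 4) ℂ) *ᵥ ψ x) ?_ hφ
    rw [contMDiffOn_pi_space]
    intro k
    refine ContMDiffOn.congr (f := fun x ↦ ∑ l, (s x : Matrix (Fin 4) (Fin 4) ℂ) k l * ψ x l)
      (contMDiffOn_finsetSum fun l _ ↦ ?_) fun x _ ↦ rfl
    have h1 : ContMDiffOn 𝓘(ℝ, E5) 𝓘(ℝ, ℂ) ∞ (fun x ↦ ψ x l) O :=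
      contMDiffOn_pi_space.1 hψ.smooth l
    exact (ContDiff.contMDiff (f := fun p : ℂ × ℂ ↦ p.1 * p.2) contDiff_mul).comp_contMDiffOn
      ((hsm k l).prodMk_space h1)
  refine ⟨hsmooth, fun x hx v ↦ ?_⟩
  -- the base point `x₀` of the chart is independent of `x`, which becomes `invChart x₀ y`
  suffices h : ∀ x₀, x ∈ (extChartAt 𝓘(ℝ, E5) x₀).source →
      mvfderiv (𝓡 5) φ x v + Γ.spinForm a x v *ᵥ φ x = 0 from h x (mem_extChartAt_source x)
  intro x₀ hx₀
  obtain ⟨y, hy, rfl⟩ := exists_invChart_eq hx₀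
  obtain ⟨u, rfl⟩ := invChartDeriv_surjective hy v
  have hev := (isOpen_chartDomain (E := E5) x₀ hO).eventually_mem ⟨hy, hx⟩
  have hd : ∀ k l, DifferentiableAt ℝ
      (fun z ↦ (s (invChart x₀ z) : Matrix (Fin 4) (Fin 4) ℂ) k l) y := fun k l ↦
    ((contMDiffOn_comp_invChart (E := E5) (hsm k l) x₀).contDiffAt
      hev).differentiableAt (by simp)
  have h1 := Γ.matDeriv_transition (a := a) (b := b) (s := fun z ↦ s (invChart x₀ z))
    ⟨hy, hOa hx⟩ ⟨hy, hOb hx⟩ (hev.mono fun z hz ↦ hs _ hz.2) hd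
    (hev.mono fun z hz w ↦ hcov _ hz.2 (invChartDeriv x₀ z w)) u
  have h2 := hψ.hasFDerivAt hO (x₀ := x₀) ⟨hy, hx⟩
  have h3 : HasFDerivAt (φ ∘ invChart x₀) ((mvfderiv 𝓘(ℝ, E5) φ (invChart x₀ y)).comp
      (invChartDeriv x₀ y)) y := hasFDerivAt_comp_invChart hy
    ((hsmooth.contMDiffAt (hO.mem_nhds hx)).mdifferentiableAt (by simp))
  rw [Γ.spinForm_invChartDeriv, hφ _ hx]
  funext k
  have h4 : HasFDerivAt (fun z ↦ ∑ l, (s (invChart x₀ z) : Matrix (Fin 4) (Fin 4) ℂ) k l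
      * ψ (invChart x₀ z) l) _ y :=
    HasFDerivAt.fun_sum fun l _ ↦ (hd k l).hasFDerivAt.mul (hasFDerivAt_pi'.1 h2 l)
  have h5 : (fun z ↦ (φ ∘ invChart x₀) z k) =ᶠ[𝓝 y] fun z ↦ ∑ l,
      (s (invChart x₀ z) : Matrix (Fin 4) (Fin 4) ℂ) k l * ψ (invChart x₀ z) l := by
    filter_upwards [hev] with z hz
    exact congrFun (hφ _ hz.2) k
  have h6 := congrArg (fun T ↦ T u) ((hasFDerivAt_pi'.1 h3 k).unique (h4.congr_of_eventuallyEq h5))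
  set σ := (s (invChart x₀ y) : Matrix (Fin 4) (Fin 4) ℂ)
  set p := ψ (invChart x₀ y) with hp
  have h7 : mvfderiv 𝓘(ℝ, E5) φ (invChart x₀ y) (invChartDeriv x₀ y u) k
      = (σ *ᵥ (-(spinMat (Γ.inChart b x₀ y u) *ᵥ p))
        + matDeriv (fun z ↦ (s (invChart x₀ z) : Matrix (Fin 4) (Fin 4) ℂ)) y u *ᵥ p) k := by
    refine h6.trans ?_
    rw [sum_apply, Pi.add_apply, Matrix.mulVec, dotProduct, Matrix.mulVec, dotProduct,
      ← Finset.sum_add_distrib]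
    refine Finset.sum_congr rfl fun l _ ↦ ?_
    rw [mul_comm (matDeriv _ _ _ _ _)]
    rfl
  rw [h1] at h7
  refine (congrArg (· + _) h7).trans ?_
  rw [← Pi.add_apply, Matrix.sub_mulVec, Matrix.mulVec_neg, ← Matrix.mulVec_mulVec,
    ← Matrix.mulVec_mulVec]
  simp
  ring

end SpinorFields

/-! ### Local parallel spinors -/

section LocalSolutions

open Filter Topology

/-- A smooth function on a neighbourhood of `y₀`, translated to the origin, agrees near the origin
with a globally smooth function. -/
theorem exists_contDiff_eqOn_ball {F : Type*} [NormedAddCommGroup F] [NormedSpace ℝ F]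
    {f : E5 → F} {O : Set E5} (hO : IsOpen O) (hf : ContDiffOn ℝ ∞ f O) {y₀ : E5} (hy₀ : y₀ ∈ O) :
    ∃ (f' : E5 → F) (R : ℝ), ContDiff ℝ 1 f' ∧ 0 < R ∧
      ∀ z ∈ Metric.ball (0 : E5) R, y₀ + z ∈ O ∧ f' z = f (y₀ + z) := by
  obtain ⟨ε, hε, hball⟩ := Metric.isOpen_iff.1 hO y₀ hy₀
  let χ : ContDiffBump (0 : E5) := ⟨ε / 3, ε / 2, by positivity, by linarith⟩
  have hmem : ∀ z ∈ Metric.ball (0 : E5) ε, y₀ + z ∈ O := fun z hz ↦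
    hball (by simpa using hz)
  refine ⟨fun z ↦ χ z • f (y₀ + z), ε / 3, ?_, by positivity, fun z hz ↦ ⟨hmem z ?_, ?_⟩⟩
  · rw [contDiff_iff_contDiffAt]
    intro z
    by_cases hz : z ∈ Metric.ball (0 : E5) ε
    · have h1 : ContDiffAt ℝ 1 f (y₀ + z) :=
        ((hf.contDiffAt (hO.mem_nhds (hmem z hz)))).of_le (by exact_mod_cast le_top)
      exact (χ.contDiff.contDiffAt).smul (h1.comp z (by fun_prop))
    · refine (contDiffAt_const (c := (0 : F))).congr_of_eventuallyEq ?_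
      have hz' : z ∈ (Metric.closedBall (0 : E5) (ε / 2))ᶜ := fun h ↦
        hz (Metric.closedBall_subset_ball (by linarith) h)
      filter_upwards [Metric.isClosed_closedBall.isOpen_compl.mem_nhds hz'] with w hw
      have h0 : χ w = 0 := χ.zero_of_le_dist (by
        rw [mem_compl_iff, Metric.mem_closedBall, not_le] at hw
        exact hw.le)
      rw [h0, zero_smul]
  · exact Metric.ball_subset_ball (by linarith) hz
  · have h1 : χ z = 1 := χ.one_of_mem_closedBall (Metric.ball_subset_closedBall hz)
    simp only [h1, one_smul]

variable {M : Type*} [TopologicalSpace M] [ChartedSpace E5 M] [IsManifold (𝓡 5) ∞ M]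
  {G : SO3Structure M} {Γ : SO3Connection G}

/-- Where the connection is flat, parallel spinors with arbitrary initial values exist on small
connected neighbourhoods of a given point. -/
theorem exists_isParallelOn {W : Opens M} (hW : Γ.IsFlatOn W) (c : AdaptedCoframe G) {x : M}
    (hxW : x ∈ W) (hxc : x ∈ c.U) {O : Opens M} (hxO : x ∈ O) :
    ∃ U : Opens M, x ∈ U ∧ U ≤ W ∧ U ≤ c.U ∧ U ≤ O ∧ IsPreconnected (U : Set M) ∧
      ∀ ψ₀ : Fin 4 → ℂ, ∃ ψ, Γ.IsParallelOn c U ψ ∧ ψ x = ψ₀ := by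
  set N : Set M := c.U ∩ W ∩ O
  have hN : IsOpen N := (c.U.isOpen.inter W.isOpen).inter O.isOpen
  set y₀ : E5 := extChartAt 𝓘(ℝ, E5) x x with hy₀_def
  have hinv : invChart x y₀ = x := extChartAt_to_inv x
  have hy₀ : y₀ ∈ chartDomain x N :=
    ⟨mem_extChartAt_target x, by rw [mem_preimage, hinv]; exact ⟨⟨hxc, hxW⟩, hxO⟩⟩
  have hsub : chartDomain x N ⊆ c.chartDomain x := fun y hy ↦ ⟨hy.1, hy.2.1.1⟩
  have hDo := isOpen_chartDomain (E := E5) x hN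
  obtain ⟨γ', R, hγ', hR, heq⟩ := exists_contDiff_eqOn_ball hDo
    ((Γ.contDiffOn_inChart c x).mono hsub) hy₀
  have hflat : ∀ z ∈ Metric.ball (0 : E5) R, ∀ u v ψ, systemCurv spinAction γ' z u v ψ = 0 := by
    intro z hz u v ψ
    have h1 : γ' =ᶠ[𝓝 z] fun z ↦ Γ.inChart c x (y₀ + z) := by
      filter_upwards [Metric.isOpen_ball.mem_nhds hz] with w hw using (heq w hw).2
    have h2 : fderiv ℝ γ' z = fderiv ℝ (Γ.inChart c x) (y₀ + z) := by
      rw [h1.fderiv_eq, fderiv_comp_add_left]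
    have h3 := Γ.systemCurv_spinAction c x (y₀ + z) u v ψ
    rw [curvInChart_eq_zero_of_isFlatOn hW (hsub (heq z hz).1) (heq z hz).1.2.1.2] at h3
    rw [systemCurv, h2, (heq z hz).2]
    refine h3.trans ?_
    rw [← spinAction_apply, map_zero]
  obtain ⟨r, hr, hrR, hsol⟩ := exists_parallel_of_flat hγ' hR hflat
  have hVD : Metric.ball y₀ r ⊆ chartDomain x N := by
    intro y hy
    have h := (heq (y - y₀) (Metric.ball_subset_ball hrR (by simpa [dist_eq_norm] using hy))).1
    simpa using h
  have hVt : Metric.ball y₀ r ⊆ (extChartAt 𝓘(ℝ, E5) x).target := fun y hy ↦ (hVD hy).1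
  have himage : (extChartAt 𝓘(ℝ, E5) x).source ∩ extChartAt 𝓘(ℝ, E5) x ⁻¹' Metric.ball y₀ r
      = invChart x '' Metric.ball y₀ r :=
    ((extChartAt 𝓘(ℝ, E5) x).symm_image_eq_source_inter_preimage hVt).symm
  refine ⟨⟨(extChartAt 𝓘(ℝ, E5) x).source ∩ extChartAt 𝓘(ℝ, E5) x ⁻¹' Metric.ball y₀ r,
    (continuousOn_extChartAt x).isOpen_inter_preimage (isOpen_extChartAt_source x)
      Metric.isOpen_ball⟩, ⟨mem_extChartAt_source x, Metric.mem_ball_self hr⟩, ?_, ?_, ?_, ?_, ?_⟩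
  · intro z hz
    obtain ⟨y, hy, rfl⟩ := himage.subset hz
    exact (hVD hy).2.1.2
  · intro z hz
    obtain ⟨y, hy, rfl⟩ := himage.subset hz
    exact (hVD hy).2.1.1
  · intro z hz
    obtain ⟨y, hy, rfl⟩ := himage.subset hz
    exact (hVD hy).2.2
  · change IsPreconnected (_ ∩ _)
    rw [himage]
    exact (convex_ball y₀ r).isPreconnected.image _ ((continuousOn_extChartAt_symm x).mono hVt)
  · intro ψ₀
    obtain ⟨ψ, hψ0, hψ⟩ := hsol ψ₀
    refine ⟨(fun y ↦ ψ (y - y₀)) ∘ extChartAt 𝓘(ℝ, E5) x,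
      SO3Connection.isParallelOn_of_hasFDerivAt Metric.isOpen_ball (hVD.trans hsub)
        fun y hy ↦ ?_, ?_⟩
    · have hz : y - y₀ ∈ Metric.ball (0 : E5) r := by simpa [dist_eq_norm] using hy
      have h1 := (hasFDerivAt_comp_sub y₀).2 (hψ _ hz)
      rw [(heq _ (Metric.ball_subset_ball hrR hz)).2, add_sub_cancel] at h1
      exact h1
    · rw [Function.comp, ← hy₀_def, sub_self, hψ0]

variable {Ω : Opens M} {ι : Type*}

/-- Evaluation at a point of a connected open set is an isomorphism from the parallel spinor
fields to `ℂ⁴` as soon as there are local parallel spinors with all initial values. -/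
theorem finrank_parallelSpinors (S : SpinStructure G Ω ι) {U : Opens M} (hU : U ≤ Ω)
    (hconn : IsPreconnected (U : Set M)) {a : ι} (hUa : U ≤ (S.coframe a).U) {x : M} (hx : x ∈ U)
    (hsol : ∀ ψ₀ : Fin 4 → ℂ, ∃ ψ, Γ.IsParallelOn (S.coframe a) U ψ ∧ ψ x = ψ₀) :
    Module.finrank ℂ (S.parallelSpinors Γ U) = 4 := by
  classical
  let ev : S.parallelSpinors Γ U →ₗ[ℂ] Fin 4 → ℂ :=
    { toFun := fun Ψ ↦ Ψ.1 a x
      map_add' := fun Ψ Φ ↦ rfl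
      map_smul' := fun r Ψ ↦ rfl }
  have hinj : Function.Injective ev := by
    rw [injective_iff_map_eq_zero]
    intro Ψ h
    exact Subtype.ext (eq_zero_of_mem_parallelSpinors hU hconn Ψ.2 hx (hUa hx) h)
  have hsurj : Function.Surjective ev := by
    intro ψ₀
    obtain ⟨ψ, hψ, hψ0⟩ := hsol ψ₀
    -- the spinor field with representative `ψ` in the coframe `a`
    let Ψ : ι → M → Fin 4 → ℂ := fun b z ↦ if z ∈ (S.coframe b).U ⊓ U then
      (S.s b a z : Matrix (Fin 4) (Fin 4) ℂ) *ᵥ ψ z else 0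
    have hΨ : ∀ b, ∀ z ∈ (S.coframe b).U ⊓ U,
        Ψ b z = (S.s b a z : Matrix (Fin 4) (Fin 4) ℂ) *ᵥ ψ z := fun b z hz ↦ if_pos hz
    have hpar : ∀ b, Γ.IsParallelOn (S.coframe b) ((S.coframe b).U ∩ U) (Ψ b) := by
      intro b
      refine SO3Connection.IsParallelOn.transition (b := S.coframe a) (ψ := ψ)
        ((S.coframe b).U.isOpen.inter U.isOpen) inter_subset_left
        (fun z hz ↦ hUa hz.2) ⟨hψ.smooth.mono inter_subset_right, fun z hz ↦ hψ.eq_zero z hz.2⟩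
        (s := S.s b a) (fun z hz ↦ S.s_mem b a z hz.1 (hUa hz.2))
        (fun k l ↦ (S.s_smooth b a k l).mono fun z hz ↦ ⟨hz.1, hUa hz.2⟩)
        (fun z hz v ↦ S.s_covers b a z hz.1 (hUa hz.2) v) (fun z hz ↦ hΨ b z hz)
    refine ⟨⟨Ψ, ⟨fun b z hz ↦ if_neg hz, fun b ↦ (hpar b).smooth, fun b c z hz hb hc ↦ ?_⟩,
      fun b z hz hb v ↦ (hpar b).eq_zero z ⟨hb, hz⟩ v⟩, ?_⟩
    · rw [hΨ b z ⟨hb, hz⟩, hΨ c z ⟨hc, hz⟩, Matrix.mulVec_mulVec, ← Units.val_mul,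
        S.s_cocycle b c a z hb hc (hUa hz)]
    · change Ψ a x = ψ₀
      rw [hΨ a x ⟨hUa hx, hx⟩, S.s_self (hUa hx), Units.val_one, Matrix.one_mulVec, hψ0]
  rw [(LinearEquiv.ofBijective ev ⟨hinj, hsurj⟩).finrank_eq, Module.finrank_fin_fun]

/-- The spin structure given by a single adapted coframe. -/
def AdaptedCoframe.spinStructure (c : AdaptedCoframe G) : SpinStructure G c.U Unit where
  coframe _ := c
  cover := iUnion_const _
  s _ _ _ := 1
  s_mem _ _ _ _ _ := one_mem _
  s_smooth _ _ _ _ := contMDiffOn_const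
  s_cocycle _ _ _ _ _ _ _ := one_mul _
  s_covers _ _ _ _ _ _ := by simp

/-- The restriction of an adapted coframe to a smaller open set. -/
def AdaptedCoframe.restrict (c : AdaptedCoframe G) (U : Opens M) (hU : U ≤ c.U) :
    AdaptedCoframe G where
  U := U
  θ := c.θ
  smoothOn i := (c.smoothOn i).mono hU
  metric_eq x hx := c.metric_eq x (hU hx)
  cubic_eq x hx := c.cubic_eq x (hU hx)

/-- The connection forms of a coframe and of its restriction agree, because the constant function
`1` covers the change of coframe. -/
theorem SO3Connection.IsParallelOn.restrict {c : AdaptedCoframe G} {U : Opens M} (hU : U ≤ c.U)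
    {ψ : M → Fin 4 → ℂ} (h : Γ.IsParallelOn c U ψ) : Γ.IsParallelOn (c.restrict U hU) U ψ :=
  h.transition U.isOpen (fun x hx ↦ hx) hU (s := fun _ ↦ 1) (fun x _ ↦ one_mem _)
    (fun k l ↦ contMDiffOn_const) (fun x _ v ↦ by simp [AdaptedCoframe.restrict])
    (fun x _ ↦ by simp)

end LocalSolutions

/-! ### Existence of adapted coframes -/

section ExistenceOfCoframes

open Filter Topology

variable {M : Type*} [TopologicalSpace M] [ChartedSpace E5 M]

theorem finrank_tangentSpace (x : M) : Module.finrank ℝ (TangentSpace (𝓡 5) x) = 5 :=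
  finrank_euclideanSpace_fin (𝕜 := ℝ) (n := 5)

variable [IsManifold (𝓡 5) ∞ M]

/-- Smoothness of a vector field at a point. (Since the order of differentiability is `∞`, it does not
follow that the field is smooth near the point.) -/
def SmoothFieldAt (V : ∀ x : M, TangentSpace (𝓡 5) x) (x : M) : Prop :=
  ContMDiffAt (𝓡 5) (𝓡 5).tangent ∞ (fun y ↦ (⟨y, V y⟩ : TangentBundle (𝓡 5) M)) x

/-- Every tangent vector extends to a vector field that is smooth near its base point. -/
theorem exists_smoothField (x₀ : M) (v : TangentSpace (𝓡 5) x₀) :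
    ∃ V : ∀ x : M, TangentSpace (𝓡 5) x, (∀ᶠ x in 𝓝 x₀, SmoothFieldAt V x) ∧ V x₀ = v := by
  suffices h : ∀ x₁ x : M, ∀ v : TangentSpace (𝓡 5) x, x ∈ (extChartAt 𝓘(ℝ, E5) x₁).source →
      ∃ w : E5, constVectorField x₁ w x = v by
    obtain ⟨w, hw⟩ := h x₀ x₀ v (mem_extChartAt_source x₀)
    refine ⟨constVectorField x₀ w, ?_, hw⟩
    filter_upwards [(isOpen_extChartAt_source (I := 𝓘(ℝ, E5)) x₀).mem_nhds
      (mem_extChartAt_source x₀)] with x hx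
    exact (contMDiffOn_constVectorField x₀ w).contMDiffAt
      ((isOpen_extChartAt_source (I := 𝓘(ℝ, E5)) x₀).mem_nhds hx)
  intro x₁ x v hx
  obtain ⟨y, hy, rfl⟩ := exists_invChart_eq hx
  obtain ⟨w, rfl⟩ := invChartDeriv_surjective hy v
  exact ⟨w, constVectorField_invChart hy w⟩

namespace SmoothFieldAt

variable {V W : ∀ x : M, TangentSpace (𝓡 5) x} {x : M}

theorem add (hV : SmoothFieldAt V x) (hW : SmoothFieldAt W x) :
    SmoothFieldAt (fun x ↦ V x + W x) x :=
  ContMDiffAt.add_section hV hW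

theorem sub (hV : SmoothFieldAt V x) (hW : SmoothFieldAt W x) :
    SmoothFieldAt (fun x ↦ V x - W x) x :=
  ContMDiffAt.sub_section hV hW

theorem smul {f : M → ℝ} (hf : ContMDiffAt (𝓡 5) 𝓘(ℝ, ℝ) ∞ f x) (hV : SmoothFieldAt V x) :
    SmoothFieldAt (fun x ↦ f x • V x) x :=
  ContMDiffAt.smul_section hf hV

theorem comp_smul {f : M → ℝ} (hf : ContMDiffAt (𝓡 5) 𝓘(ℝ, ℝ) ∞ f x) {φ : ℝ → ℝ}
    (hφ : ContDiffAt ℝ ∞ φ (f x)) (hV : SmoothFieldAt V x) :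
    SmoothFieldAt (fun x ↦ φ (f x) • V x) x :=
  smul (hφ.contMDiffAt.comp x hf) hV

variable (G : SO3Structure M)

theorem mul (hV : SmoothFieldAt V x) (hW : SmoothFieldAt W x) :
    SmoothFieldAt (fun x ↦ G.Υ x (V x) (W x)) x :=
  ContMDiffAt.clm_bundle_apply₂ (G.contMDiff_Υ x) hV hW

theorem inner (hV : SmoothFieldAt V x) (hW : SmoothFieldAt W x) :
    ContMDiffAt (𝓡 5) 𝓘(ℝ, ℝ) ∞ (fun x ↦ G.g.inner x (V x) (W x)) x := by
  have h := ContMDiffAt.clm_bundle_apply₂ (F₃ := ℝ) (E₃ := fun _ : M ↦ ℝ) (G.g.contMDiff x) hV hW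
  rw [contMDiffAt_totalSpace] at h
  exact h.2

/-- The 1-form dual to a smooth vector field is smooth. -/
theorem flat (hV : SmoothFieldAt V x) :
    ContMDiffAt (𝓡 5) ((𝓡 5).prod 𝓘(ℝ, E5 →L[ℝ] ℝ)) ∞
      (fun x ↦ TotalSpace.mk' (E5 →L[ℝ] ℝ) (E := fun x : M ↦ TangentSpace (𝓡 5) x →L[ℝ] ℝ) x
        (G.g.inner x (V x))) x :=
  ContMDiffAt.clm_bundle_apply (G.g.contMDiff x) hV

end SmoothFieldAt

/-- The `SO(3)` algebra on the tangent space at `x`. -/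
def SO3Structure.algebra (G : SO3Structure M) (x : M) : SO3Algebra (TangentSpace (𝓡 5) x) where
  ip := (ContinuousLinearMap.coeLM ℝ).comp (G.g.inner x).toLinearMap
  mul := (ContinuousLinearMap.coeLM ℝ).comp (G.Υ x).toLinearMap
  ip_comm := G.g.symm x
  ip_pos := G.g.pos x
  ip_mul_swap := G.symm₁ x
  ip_mul_comm := G.symm₂ x
  trace_mul := G.trace_free x
  mul_mul_self := G.sq_apply x

variable (G : SO3Structure M)

/-- Normalization of a vector field that does not vanish. -/
theorem SmoothFieldAt.normalize {V : ∀ x : M, TangentSpace (𝓡 5) x} {x : M}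
    (hV : SmoothFieldAt V x) (h0 : 0 < G.g.inner x (V x) (V x)) :
    SmoothFieldAt (fun x ↦ (√(G.g.inner x (V x) (V x)))⁻¹ • V x) x := by
  have h : ContDiffAt ℝ ∞ (fun t : ℝ ↦ (√t)⁻¹) (G.g.inner x (V x) (V x)) :=
    (contDiffAt_id.sqrt h0.ne').inv (Real.sqrt_pos.2 h0).ne'
  have h' := comp_smul (hV.inner G hV) h hV
  exact h'

theorem SO3Structure.inner_normalize {x : M} {v : TangentSpace (𝓡 5) x}
    (h0 : 0 < G.g.inner x v v) :
    G.g.inner x ((√(G.g.inner x v v))⁻¹ • v) ((√(G.g.inner x v v))⁻¹ • v) = 1 := by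
  have h1 : √(G.g.inner x v v) ≠ 0 := (Real.sqrt_pos.2 h0).ne'
  have h2 := Real.sq_sqrt h0.le
  simp only [map_smul, smul_apply, smul_eq_mul]
  field_simp
  exact h2.symm

theorem SmoothFieldAt.eventually_pos {V : ∀ x : M, TangentSpace (𝓡 5) x} {x : M}
    (hV : SmoothFieldAt V x) (h0 : V x ≠ 0) : ∀ᶠ z in 𝓝 x, 0 < G.g.inner z (V z) (V z) :=
  (hV.inner G hV).continuousAt.eventually (lt_mem_nhds (G.g.pos x (V x) h0))

/-- Near every point there is a smooth unit vector field on which the cubic form vanishes. -/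
theorem SO3Structure.exists_null_field (x₀ : M) : ∃ B : ∀ x : M, TangentSpace (𝓡 5) x,
    ∀ᶠ x in 𝓝 x₀, SmoothFieldAt B x ∧ (G.algebra x).ip (B x) (B x) = 1 ∧
      (G.algebra x).form (B x) = 0 := by
  obtain ⟨v, hv, hF⟩ := (G.algebra x₀).exists_form_eq_zero (by rw [finrank_tangentSpace]; norm_num)
  obtain ⟨V, hV, hV0⟩ := exists_smoothField x₀ v
  have hv0 : V x₀ ≠ 0 := by
    rintro h
    rw [h] at hV0
    rw [← hV0] at hv
    simp at hv
  have hpos := hV.self_of_nhds.eventually_pos G hv0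
  set N : ∀ x : M, TangentSpace (𝓡 5) x := fun x ↦ (√(G.g.inner x (V x) (V x)))⁻¹ • V x with hN
  have hNs : ∀ᶠ x in 𝓝 x₀, SmoothFieldAt N x := by
    filter_upwards [hV, hpos] with x h1 h2 using h1.normalize G h2
  have hform : ∀ x, SmoothFieldAt N x →
      ContMDiffAt (𝓡 5) 𝓘(ℝ, ℝ) ∞ (fun x ↦ (G.algebra x).form (N x)) x := fun x h ↦
    h.inner G (h.mul G h)
  have hN0 : N x₀ = v := by
    have h1 : G.g.inner x₀ v v = 1 := hv
    rw [hN]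
    simp only [hV0, h1]
    simp
  have hF1 : ∀ᶠ x in 𝓝 x₀, (G.algebra x).form (N x) ^ 2 < 1 := by
    refine ((hform x₀ hNs.self_of_nhds).continuousAt.pow 2).eventually (gt_mem_nhds ?_)
    change (G.algebra x₀).form (N x₀) ^ 2 < 1
    rw [hN0, hF]
    norm_num
  refine ⟨fun x ↦ (G.algebra x).nullVector (N x), ?_⟩
  filter_upwards [hNs, hpos, hF1] with x h1 h2 h3
  refine ⟨?_, (G.algebra x).nullVector_spec (G.inner_normalize h2) h3⟩
  have hlt := abs_lt.1 ((sq_lt_one_iff_abs_lt_one _).1 h3)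
  set t := (G.algebra x).form (N x)
  have ha : ContDiffAt ℝ ∞ (fun t : ℝ ↦ Real.sin (Real.arcsin t / 3)) t :=
    Real.contDiff_sin.contDiffAt.comp t
      ((Real.contDiffAt_arcsin hlt.1.ne' hlt.2.ne).div_const 3)
  have hb : ContDiffAt ℝ ∞ (fun t : ℝ ↦ (√(1 - t ^ 2))⁻¹) t :=
    ((contDiffAt_const.sub (contDiffAt_id.pow 2)).sqrt (by
      change 1 - t ^ 2 ≠ 0
      linarith)).inv (Real.sqrt_pos.2 (by change 0 < 1 - t ^ 2; linarith)).ne'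
  have hc : ContDiffAt ℝ ∞ (fun t : ℝ ↦ 1 - 2 * Real.sin (Real.arcsin t / 3) ^ 2) t :=
    contDiffAt_const.sub (contDiffAt_const.mul (ha.pow 2))
  have hf := hform x h1
  have h4 := SmoothFieldAt.comp_smul hf hc h1
  have h5 := SmoothFieldAt.comp_smul hf ha (h1.mul G h1)
  have h6 := SmoothFieldAt.comp_smul hf hb (h4.sub h5)
  exact h6

/-- Near every point there are smooth unit eigenvector fields of `Υ_B` with eigenvalue
`μ = ± √3 / 2`: the normalized projections of suitable vector fields. -/
theorem SO3Structure.exists_eigenvector_field {x₀ : M} {B : ∀ x : M, TangentSpace (𝓡 5) x}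
    (hB : ∀ᶠ x in 𝓝 x₀, SmoothFieldAt B x ∧ (G.algebra x).ip (B x) (B x) = 1 ∧
      (G.algebra x).form (B x) = 0) {μ : ℝ} (hμ : μ ^ 2 = 3 / 4) :
    ∃ e : ∀ x : M, TangentSpace (𝓡 5) x, ∀ᶠ x in 𝓝 x₀, SmoothFieldAt e x ∧
      (G.algebra x).IsUnitEigenvector (B x) μ (e x) := by
  obtain ⟨-, hb, hF⟩ := hB.self_of_nhds
  obtain ⟨w, hw⟩ := SO3Algebra.exists_eigenProj_ne_zero (finrank_tangentSpace x₀) hb hF μ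
  obtain ⟨W, hW, hW0⟩ := exists_smoothField x₀ w
  set Q : ∀ x : M, TangentSpace (𝓡 5) x := fun x ↦ (G.algebra x).eigenProj (B x) μ (W x) with hQ
  have hQs : ∀ᶠ x in 𝓝 x₀, SmoothFieldAt Q x := by
    filter_upwards [hB, hW] with x h1 h2
    have h3 := h1.1.mul G h1.1
    have hμ' : ContMDiffAt (𝓡 5) 𝓘(ℝ, ℝ) ∞ (fun _ : M ↦ μ) x := contMDiffAt_const
    exact (((h1.1.mul G (h1.1.mul G h2)).add (SmoothFieldAt.smul hμ' (h1.1.mul G h2))).sub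
      (SmoothFieldAt.smul (h1.1.inner G h2) (h1.1.add (SmoothFieldAt.smul hμ' h3)))).sub
      (SmoothFieldAt.smul (h3.inner G h2) (h3.add (SmoothFieldAt.smul hμ' h1.1)))
  have hpos := hQs.self_of_nhds.eventually_pos G (by rw [hQ]; simpa only [hW0] using hw)
  refine ⟨fun x ↦ (√(G.g.inner x (Q x) (Q x)))⁻¹ • Q x, ?_⟩
  filter_upwards [hB, hQs, hpos] with x h1 h2 h3
  refine ⟨h2.normalize G h3, G.inner_normalize h3, ?_⟩
  rw [map_smul, SO3Algebra.mul_eigenProj h1.2.1 h1.2.2 hμ, smul_comm]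

/-- Adapted coframes exist near every point. -/
theorem SO3Structure.exists_adaptedCoframe (x₀ : M) : ∃ c : AdaptedCoframe G, x₀ ∈ c.U := by
  obtain ⟨B, hB⟩ := G.exists_null_field x₀
  obtain ⟨e₂, h₂⟩ := G.exists_eigenvector_field hB SO3Algebra.neg_sqrt_three_half_sq
  obtain ⟨e₄, h₄⟩ := G.exists_eigenvector_field hB SO3Algebra.sqrt_three_half_sq
  obtain ⟨O, hO, hOo, hx₀⟩ := eventually_nhds_iff.1 (hB.and (h₂.and h₄))
  have hframe : ∀ x ∈ O, (G.algebra x).IsFrameData (B x) (e₂ x) (e₄ x) := fun x hx ↦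
    ⟨(hO x hx).1.2.1, (hO x hx).1.2.2, (hO x hx).2.1.2, (hO x hx).2.2.2⟩
  have hsm : ∀ x ∈ O, ∀ i,
      SmoothFieldAt (fun x ↦ (G.algebra x).stdFrame (B x) (e₂ x) (e₄ x) i) x := by
    intro x hx i
    obtain ⟨⟨hb, -⟩, ⟨h2, -⟩, ⟨h4, -⟩⟩ := hO x hx
    fin_cases i
    · exact hb.mul G hb
    · exact SmoothFieldAt.smul contMDiffAt_const (h2.mul G h4)
    · exact h2
    · exact hb
    · exact h4
  exact ⟨{
    U := ⟨O, hOo⟩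
    θ := fun i x ↦ G.g.inner x ((G.algebra x).stdFrame (B x) (e₂ x) (e₄ x) i)
    smoothOn := fun i x hx ↦ ((hsm x hx i).flat G).contMDiffWithinAt
    metric_eq := fun x hx v w ↦ (G.algebra x).ip_eq_sum_of_orthonormal (finrank_tangentSpace x)
      (hframe x hx).orthonormal v w
    cubic_eq := fun x hx v ↦ (hframe x hx).form_eq_cubic (finrank_tangentSpace x) v }, hx₀⟩

end ExistenceOfCoframes

end IrreducibleSO3

end

open IrreducibleSO3
theorem mainTheorem12 {M : Type*} [TopologicalSpace M] [ChartedSpace E5 M]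
    [IsManifold (𝓡 5) ∞ M] (G : SO3Structure M) (Γ : SO3Connection G) :
    -- the determinant identity
    (∀ r : Fin 3 → ℝ,
      (∑ I, (r I : ℂ) • spinBasis I).det = ((9 / 16 * (∑ I, r I ^ 2) ^ 2 : ℝ) : ℂ)) ∧
    -- a nonzero parallel spinor field over a connected open set forces `Γ` to be flat there
    (∀ (Ω : Opens M) (ι : Type*) (S : SpinStructure G Ω ι) (Ψ : ι → M → Fin 4 → ℂ),
      IsPreconnected (Ω : Set M) → Ψ ∈ S.parallelSpinors Γ Ω → Ψ ≠ 0 → Γ.IsFlatOn Ω) ∧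
    -- if `Γ` is flat, then near every point there is a 4-dimensional space of parallel spinors,
    -- both for a suitable local spin structure and for every given spin structure
    (∀ W : Opens M, Γ.IsFlatOn W → ∀ x ∈ W,
      (∃ U : Opens M, x ∈ U ∧ U ≤ W ∧ ∃ S : SpinStructure G U Unit,
        Module.finrank ℂ (S.parallelSpinors Γ U) = 4) ∧
      (∀ (Ω : Opens M) (ι : Type*) (S : SpinStructure G Ω ι), x ∈ Ω →
        ∃ U : Opens M, x ∈ U ∧ U ≤ W ⊓ Ω ∧
          Module.finrank ℂ (S.parallelSpinors Γ U) = 4)) := by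
  refine ⟨det_spinMat, fun Ω ι S Ψ hΩ hΨ h0 ↦ isFlatOn_of_mem_parallelSpinors hΩ hΨ h0,
    fun W hW x hx ↦ ⟨?_, fun Ω ι S hxΩ ↦ ?_⟩⟩
  · obtain ⟨c, hxc⟩ := G.exists_adaptedCoframe x
    obtain ⟨U, hxU, hUW, hUc, -, hconn, hsol⟩ := exists_isParallelOn hW c hx hxc (O := W) hx
    refine ⟨U, hxU, hUW, (c.restrict U hUc).spinStructure, ?_⟩
    refine finrank_parallelSpinors (a := ()) _ le_rfl hconn (fun z hz ↦ hz) hxU fun ψ₀ ↦ ?_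
    obtain ⟨ψ, hψ, hψ0⟩ := hsol ψ₀
    exact ⟨ψ, hψ.restrict hUc, hψ0⟩
  · obtain ⟨a, ha⟩ := S.exists_mem_coframe hxΩ
    obtain ⟨U, hxU, hUW, hUa, hUΩ, hconn, hsol⟩ := exists_isParallelOn hW (S.coframe a) hx ha hxΩ
    exact ⟨U, hxU, le_inf hUW hUΩ, finrank_parallelSpinors S hUΩ hconn hUa hxU hsol⟩
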